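/- Let $\mathbb N=\{1,2,\dots\}$ and $[m]=\{1,\dots,m\}$. A random partition $\Pi_\infty$ of $\mathbb N$ with restrictions $\Pi_m$ to $[m]$ is *partially exchangeable* if there is a function $p$ of compositions (finite sequences of positive integers), called its PEPPF, such that for every $m$ and every partition of $[m]$ into clusters $C_1,\dots,C_k$, listed in order of appearance (increasing order of least elements), $\mathbb P(\Pi_m=\{C_1,\dots,C_k\})=p(\#C_1,\dots,\#C_k)$. It is *exchangeable* if for every $m$ the law of $\Pi_m$ is invariant under permutations of $[m]$; then it is partially exchangeable, and its PEPPF is called its EPPF. Let $\Pi_\infty$ be a partially exchangeable random partition of $\mathbb N$. Almost surely every cluster $C$ of $\Pi_\infty$ has a limiting relative frequency $\lim_N \#(C\cap[N])/N$. Let $(P^{\downarrow}_j)_{j\ge1}$ be these frequencies in weakly decreasing order (followed by zeros if there are only finitely many clusters). For $n=0,1,\dots$ let $\Pi^{(n)}_\infty$ be the partition of $\mathbb N$ obtained by restricting $\Pi_\infty$ to $\{n+1,n+2,\dots\}$ and subtracting $n$ from each element, and let $P^{(n)}=(P^{(n)}_j)_{j\ge1}$ be the frequencies of the clusters of $\Pi_\infty$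 in order of their appearance in $\{n+1,n+2,\dots\}$ (followed by zeros if there are only finitely many). Then each $\Pi^{(n)}_\infty$ is partially exchangeable, with a PEPPF $p^{(n)}$, where $p^{(0)}=p$ is the PEPPF of $\Pi_\infty$; there is an exchangeable random partition of $\mathbb N$ whose ranked frequencies have the law of $(P^{\downarrow}_j)$; and, for every such exchangeable partition $\widetilde\Pi_\infty$ with EPPF $p^{(\infty)}$: 1. As $n\to\infty$, the law of $\Pi^{(n)}_\infty$ converges weakly to that of $\widetilde\Pi_\infty$, meaning that $p^{(n)}(n_1,\dots,n_k)\to p^{(\infty)}(n_1,\dots,n_k)$ for every composition $(n_1,\dots,n_k)$. 2. As $n\to\infty$, the finite-dimensional distributions of $P^{(n)}$ converge weakly to those of the sequence $(P_j)$ of cluster frequencies of $\widetilde\Pi_\infty$ in order of appearance. If $\sum_jP^{\downarrow}_j=1$ almost surely, then $(P_j)$ has the law of a size-biased random permutation of $(P^{\downarrow}_j)$, and also, for every fixed $n\ge0$, that of a size-biased random permutation of $P^{(n)}$. (A size-biased random permutation of a random sequence of non-negative terms with sum $1$ lists its terms by drawing them successively without replacement, each time with conditional probabilities proportional to the remaining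 terms, as long as positive terms remain, and then continues with zeros.) 3. The following are equivalent: (a) $\Pi_\infty$ is exchangeable; (b) $\Pi^{(1)}_\infty$ has the same law as $\Pi_\infty$; (c) $\Pi^{(n)}_\infty$ has the same law as $\Pi_\infty$ for all $n\ge1$; (d) $p^{(1)}=p$; (e) $p^{(n)}=p$ for all $n\ge1$. -/

import Mathlib

open MeasureTheory ProbabilityTheory Filter Topology

/-!
Partitions of the positive integers are encoded as equivalence relations on `ℕ`, the natural
number `i` standing for the positive integer `i + 1`; likewise `Fin n` stands for `{1, …, n}`, and
the terms of a sequence are numbered from `0`. Clusters are equivalence classes.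
-/

/-- The σ-algebra on the set of partitions of the positive integers that is generated by the
events that `i` and `j` lie in the same cluster. -/
instance Setoid.instMeasurableSpaceNat : MeasurableSpace (Setoid ℕ) :=
  MeasurableSpace.generateFrom {A | ∃ i j : ℕ, A = {π : Setoid ℕ | π i j}}

namespace RandomPartition

/-- The restriction of a partition to the first `n` positive integers. -/
def restrict (n : ℕ) (π : Setoid ℕ) : Setoid (Fin n) :=
  π.comap (fun i : Fin n => (i : ℕ))

/-- The partition restricted to `{n + 1, n + 2, …}` and then shifted back by `n`. -/
def shift (n : ℕ) (π : Setoid ℕ) : Setoid ℕ :=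
  π.comap (fun i : ℕ => i + n)

section Sizes

open scoped Classical in
/-- The cluster of `i` in a partition of `{1, …, n}`. -/
noncomputable def finCluster {n : ℕ} (s : Setoid (Fin n)) (i : Fin n) : Finset (Fin n) :=
  Finset.univ.filter (fun j => s i j)

/-- `i` is the least element of its cluster. -/
def IsFirst {n : ℕ} (s : Setoid (Fin n)) (i : Fin n) : Prop :=
  ∀ j, j < i → ¬ s j i

theorem exists_isFirst {n : ℕ} (s : Setoid (Fin n)) (i : Fin n) :
    ∃ j, IsFirst s j ∧ s j i := by
  induction i using WellFoundedLT.induction with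
  | ind i ih =>
    by_cases h : IsFirst s i
    · exact ⟨i, h, s.refl i⟩
    · unfold IsFirst at h
      push Not at h
      obtain ⟨j, hj, hji⟩ := h
      obtain ⟨l, hl, hlj⟩ := ih j hj
      exact ⟨l, hl, s.trans hlj hji⟩

theorem isFirst_unique {n : ℕ} (s : Setoid (Fin n)) {i j : Fin n} (hi : IsFirst s i)
    (hj : IsFirst s j) (h : s i j) : i = j := by
  rcases lt_trichotomy i j with hlt | heq | hgt
  · exact absurd h (hj i hlt)
  · exact heq
  · exact absurd (s.symm h) (hi j hgt)

open scoped Classical in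
/-- The sizes of the clusters of a partition of `{1, …, n}`, the clusters being listed in order of
appearance, that is, in increasing order of their least elements. -/
noncomputable def clusterSizes {n : ℕ} (s : Setoid (Fin n)) : Composition n where
  blocks := ((List.finRange n).filter (fun i => IsFirst s i)).map (fun i => (finCluster s i).card)
  blocks_pos := by
    intro a ha
    obtain ⟨i, -, rfl⟩ := List.mem_map.1 ha
    exact Finset.card_pos.2 ⟨i, by simp [finCluster]⟩
  blocks_sum := by
    have hnd : ((List.finRange n).filter (fun i => IsFirst s i)).Nodup :=
      (List.nodup_finRange n).filter _
    rw [← List.sum_toFinset _ hnd]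
    have hcard : (Finset.univ : Finset (Fin n)).card = n := by simp
    choose f hf using exists_isFirst s
    conv_rhs => rw [← hcard]
    rw [Finset.card_eq_sum_card_fiberwise (f := f)
      (t := ((List.finRange n).filter (fun i => IsFirst s i)).toFinset)]
    · refine Finset.sum_congr rfl fun i hi => ?_
      have hi' : IsFirst s i := by simpa using hi
      congr 1
      ext j
      simp only [finCluster, Finset.mem_filter, Finset.mem_univ, true_and]
      constructor
      · intro hij
        exact isFirst_unique s (hf j).1 hi' (s.trans (hf j).2 (s.symm hij))
      · rintro rfl
        exact (hf j).2
    · intro j _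
      simpa using (hf j).1

end Sizes

/-- Real-valued functions of compositions of natural numbers. -/
abbrev CompositionFun : Type := ∀ n : ℕ, Composition n → ℝ

section Laws

variable {Ω : Type*} [MeasurableSpace Ω]

/-- `p` is the partially exchangeable partition probability function of the random partition `X`:
for each `n`, the restriction of `X` to `{1, …, n}` is equal to any given partition with
probability `p (n₁, …, n_k)`, where `n₁, …, n_k` are the cluster sizes of this given
partition in order of appearance. -/
def HasPEPPF (μ : Measure Ω) (X : Ω → Setoid ℕ) (p : CompositionFun) : Prop :=
  ∀ (n : ℕ) (s : Setoid (Fin n)), μ.real {ω | restrict n (X ω) = s} = p n (clusterSizes s)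

/-- Partially exchangeable random partitions. -/
def IsPartiallyExchangeable (μ : Measure Ω) (X : Ω → Setoid ℕ) : Prop :=
  ∃ p : CompositionFun, HasPEPPF μ X p

/-- Exchangeable random partitions: for each `n`, the law of the restriction to `{1, …, n}` is
invariant under permutations of `{1, …, n}`. -/
def IsExchangeable (μ : Measure Ω) (X : Ω → Setoid ℕ) : Prop :=
  ∀ (n : ℕ) (σ : Equiv.Perm (Fin n)) (s : Setoid (Fin n)),
    μ {ω | restrict n (X ω) = s.comap σ} = μ {ω | restrict n (X ω) = s}

end Laws

/-- The relative frequency of `C` among the first `N` positive integers. -/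
noncomputable def relFreq (C : Set ℕ) (N : ℕ) : ℝ :=
  ((C ∩ Set.Iio N).ncard : ℝ) / N

/-- The limiting relative frequency of `C` (the upper limit, in case that there is no limit). -/
noncomputable def freq (C : Set ℕ) : ℝ :=
  limsup (relFreq C) atTop

/-- `i` is the first element of its cluster to appear in `{n + 1, n + 2, …}`. -/
def IsFirstAfter (π : Setoid ℕ) (n i : ℕ) : Prop :=
  n ≤ i ∧ ∀ l, n ≤ l → l < i → ¬ π l i

/-- The cluster of `π` that is the `j`-th one (counted from `0`) to appear in
`{n + 1, n + 2, …}`; the empty set if at most `j` clusters appear there. -/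
def cluster (π : Setoid ℕ) (n j : ℕ) : Set ℕ :=
  {m | ∃ i, IsFirstAfter π n i ∧ {l | l < i ∧ IsFirstAfter π n l}.ncard = j ∧ π i m}

/-- The frequencies of the clusters of `π`, in order of appearance of these clusters in
`{n + 1, n + 2, …}`, followed by zeros if there are only finitely many such clusters. -/
noncomputable def appearanceFreq (π : Setoid ℕ) (n j : ℕ) : ℝ :=
  freq (cluster π n j)

/-- The terms of a bounded sequence `x` of non-negative numbers in weakly decreasing order: the
`j`-th one (counted from `0`) is the largest `t` such that more than `j` terms are at least `t`. -/
noncomputable def ranked (x : ℕ → ℝ) (j : ℕ) : ℝ :=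
  sSup {t : ℝ | 0 ≤ t ∧ (j : ℕ∞) < {i | t ≤ x i}.encard}

/-- The ranked frequencies of the clusters of `π`. -/
noncomputable def rankedFreq (π : Setoid ℕ) : ℕ → ℝ :=
  ranked (appearanceFreq π 0)

/-- `L'` is the law of a size-biased random permutation of a random sequence with law `L`, whose
terms are non-negative with sum `1`. Here `ρ` is the joint law of the sequence `x` and of the
indices `σ 0, σ 1, …` of its terms in the new order: given `x`, successive indices are
picked with probabilities proportional to the terms of `x`, without repetition, as long as there
are positive terms left (`1 - ∑ l < i, x (j l)` is the total of the remaining terms), and the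
zeros follow. -/
def IsSizeBiasedPermutation (L L' : Measure (ℕ → ℝ)) : Prop :=
  (∀ᵐ x ∂L, (∀ j, 0 ≤ x j) ∧ HasSum x 1) ∧
  ∃ ρ : Measure ((ℕ → ℝ) × (ℕ → ℕ)), IsProbabilityMeasure ρ ∧
    ρ.map Prod.fst = L ∧
    ρ.map (fun z j => z.1 (z.2 j)) = L' ∧
    (∀ᵐ z ∂ρ, Function.Injective z.2) ∧
    ∀ (k : ℕ) (j : Fin k → ℕ), Function.Injective j →
      ∀ᵐ z ∂ρ, (∀ i, 0 < z.1 (j i)) →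
        (ρ⟦{y : (ℕ → ℝ) × (ℕ → ℕ) | ∀ i : Fin k, y.2 i = j i} |
            MeasurableSpace.comap Prod.fst inferInstance⟧) z
          = ∏ i : Fin k, z.1 (j i) / (1 - ∑ l ∈ Finset.Iio i, z.1 (j l))

end RandomPartition

/-! Partial exchangeability is used through one symmetry: the law is invariant under exchanging two
neighbouring positions unless both are least elements of their clusters
(`HasPEPPF.isSwapInvariant`). Fix an event `E` about the first `n` positions. Exchanges from
position `n` on do not affect `E`, and they permute the later positions among themselves as far as
membership in already present clusters is concerned. So on `E` the indicators that a later position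
joins the cluster of a given `i < n` form an exchangeable family. A second moment estimate gives
limiting frequencies (`ae_regular`), and averaging over disjoint windows gives a de Finetti moment
formula (`measureReal_posEvent`): the probability that prescribed later positions join prescribed
old clusters, on `E`, is the integral over `E` of the product of the frequencies of these clusters.

Convergence of the shifted partitions is tested on the events that the window `{n + 1, …, n + m}` is
partitioned more coarsely than `s`. If all elements of non-trivial clusters of `s` fall into
clusters seen before, the moment formula yields an expectation of a product of truncated power sums
of frequencies. The remaining case needs a cluster that starts inside the window and acquires a
second element there; its probability tends to zero because the frequencies are summable. The limit
is an expectation of power sums, which depend only on the ranked frequencies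
(`tendsto_measureReal_coarserEvent`). An exchangeable law is invariant under shifts, so its
corresponding probabilities equal their own limit; subtracting strictly coarser partitions passes
from coarsenings to single partitions (`tendsto_measureReal_restrict_shift`). The same argument
shows that an exchangeable law is determined by the law of its ranked frequencies
(`eq_of_map_rankedFreq_eq`), and existence comes from the paintbox construction.

The frequency of the `j`-th cluster to appear is not a function of finitely many positions, but it
is approximated in mean by such a function with an error bound that is the same for all swap
invariant laws (`integral_abs_approxFreq_sub_le`). This uniformity lifts the convergence of the
finite restrictions to the frequencies in order of appearance.

If the frequencies sum to one, uniqueness allows the exchangeable limit to be realised as a paintbox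
with any sequence `y` that has the same positive terms as the ranked frequencies, in particular with
the frequencies in order of appearance after `n`. Its clusters are found by independent sampling, so
their frequencies appear in size-biased order (`isSizeBiasedPermutation_paintbox`). Finally, a law
invariant under one shift is invariant under all of them, hence equals its exchangeable limit. -/

namespace RandomPartition

/-! ### Permutations that respect the order of appearance -/

section Order

variable {n : ℕ}

/-- The permutation `σ` maps the clusters of `s.comap σ` to those of `s` in such a way that the
order of appearance is preserved. -/
def PreservesOrder (σ : Equiv.Perm (Fin n)) (s : Setoid (Fin n)) : Prop :=
  ∀ i j i' j', IsFirst (s.comap σ) i → IsFirst (s.comap σ) j → i < j → IsFirst s i' →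
    IsFirst s j' → s i' (σ i) → s j' (σ j) → i' < j'

open scoped Classical in
/-- The least elements of the clusters, in increasing order. -/
noncomputable def firsts (s : Setoid (Fin n)) : List (Fin n) :=
  (List.finRange n).filter (fun i => IsFirst s i)

theorem mem_firsts {s : Setoid (Fin n)} {i : Fin n} : i ∈ firsts s ↔ IsFirst s i := by
  simp [firsts]

theorem pairwise_firsts (s : Setoid (Fin n)) : (firsts s).Pairwise (· < ·) :=
  (List.pairwise_lt_finRange n).filter _

theorem nodup_firsts (s : Setoid (Fin n)) : (firsts s).Nodup :=
  (List.nodup_finRange n).filter _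

theorem blocks_clusterSizes (s : Setoid (Fin n)) :
    (clusterSizes s).blocks = (firsts s).map (fun i => (finCluster s i).card) := rfl

theorem mem_finCluster {s : Setoid (Fin n)} {i j : Fin n} : j ∈ finCluster s i ↔ s i j := by
  simp [finCluster]

/-- Sending the least element of a cluster of `s.comap σ` to the least element of its image cluster
maps one list of least elements increasingly onto the other. Two strictly sorted lists with the same
members coincide, and `σ` itself matches the cardinalities cluster by cluster. -/
theorem clusterSizes_comap {σ : Equiv.Perm (Fin n)} {s : Setoid (Fin n)}
    (h : PreservesOrder σ s) : clusterSizes (s.comap σ) = clusterSizes s := by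
  choose φ hφ hφs using fun i => exists_isFirst s (σ i)
  have hmap : (firsts (s.comap σ)).map φ = firsts s := by
    have hsort : ((firsts (s.comap σ)).map φ).Pairwise (· < ·) := by
      rw [List.pairwise_map]
      refine (pairwise_firsts _).imp_of_mem ?_
      intro i j hi hj hij
      exact h i j _ _ (mem_firsts.1 hi) (mem_firsts.1 hj) hij (hφ i) (hφ j) (hφs i) (hφs j)
    have hperm : ((firsts (s.comap σ)).map φ).Perm (firsts s) := by
      rw [List.perm_ext_iff_of_nodup (hsort.imp ne_of_lt) (nodup_firsts s)]
      intro a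
      rw [List.mem_map, mem_firsts]
      constructor
      · rintro ⟨i, -, rfl⟩
        exact hφ i
      · intro ha
        obtain ⟨i, hi, hia⟩ := exists_isFirst (s.comap σ) (σ.symm a)
        refine ⟨i, mem_firsts.2 hi, isFirst_unique s (hφ i) ha (s.trans (hφs i) ?_)⟩
        simpa [Setoid.comap_rel] using hia
    exact hperm.eq_of_pairwise (fun a b _ _ hab hba => absurd hba (lt_asymm hab)) hsort
      (pairwise_firsts s)
  apply Composition.ext
  rw [blocks_clusterSizes, blocks_clusterSizes, ← hmap, List.map_map]
  refine List.map_congr_left fun i _ => ?_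
  refine Finset.card_bij (fun j _ => σ j) ?_ (fun _ _ _ _ hab => σ.injective hab) ?_
  · intro j hj
    rw [mem_finCluster] at hj ⊢
    exact s.trans (hφs i) hj
  · intro j hj
    rw [mem_finCluster] at hj
    refine ⟨σ.symm j, ?_, by simp⟩
    rw [mem_finCluster, Setoid.comap_rel]
    simpa using s.trans (s.symm (hφs i)) hj

/-- Number the clusters of both partitions by order of appearance. Equal size lists mean that
clusters with the same number are equinumerous, so bijections between them can be glued to a
permutation. -/
theorem exists_comap_of_clusterSizes_eq {s s' : Setoid (Fin n)}
    (h : clusterSizes s' = clusterSizes s) :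
    ∃ σ : Equiv.Perm (Fin n), s' = s.comap σ ∧ PreservesOrder σ s := by
  classical
  have hb : (firsts s').map (fun i => (finCluster s' i).card) =
      (firsts s).map (fun i => (finCluster s i).card) := by
    rw [← blocks_clusterSizes, ← blocks_clusterSizes, h]
  have hlen : (firsts s').length = (firsts s).length := by simpa using congrArg List.length hb
  choose φ hφ hφs using exists_isFirst s
  choose φ' hφ' hφs' using exists_isFirst s'
  let g : Fin n → ℕ := fun a => (firsts s).idxOf (φ a)
  let g' : Fin n → ℕ := fun a => (firsts s').idxOf (φ' a)
  have hg : ∀ a, g a < (firsts s).length := fun a =>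
    List.idxOf_lt_length_iff.2 (mem_firsts.2 (hφ a))
  have hg' : ∀ a, g' a < (firsts s').length := fun a =>
    List.idxOf_lt_length_iff.2 (mem_firsts.2 (hφ' a))
  have hget : ∀ a, (firsts s)[g a]'(hg a) = φ a := fun a => List.getElem_idxOf (hg a)
  have hget' : ∀ a, (firsts s')[g' a]'(hg' a) = φ' a := fun a => List.getElem_idxOf (hg' a)
  have hfib : ∀ c (hc : c < (firsts s).length) a, g a = c ↔ a ∈ finCluster s (firsts s)[c] := by
    intro c hc a
    rw [mem_finCluster]
    constructor
    · rintro rfl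
      rw [hget]
      exact hφs a
    · intro hca
      have : φ a = (firsts s)[c] := isFirst_unique s (hφ a)
        (mem_firsts.1 (List.getElem_mem hc)) (s.trans (hφs a) (s.symm hca))
      simp only [g, this]
      exact (nodup_firsts s).idxOf_getElem c hc
  have hfib' : ∀ c (hc : c < (firsts s').length) a,
      g' a = c ↔ a ∈ finCluster s' (firsts s')[c] := by
    intro c hc a
    rw [mem_finCluster]
    constructor
    · rintro rfl
      rw [hget']
      exact hφs' a
    · intro hca
      have : φ' a = (firsts s')[c] := isFirst_unique s' (hφ' a)
        (mem_firsts.1 (List.getElem_mem hc)) (s'.trans (hφs' a) (s'.symm hca))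
      simp only [g', this]
      exact (nodup_firsts s').idxOf_getElem c hc
  have hcard : ∀ c, Nonempty ({a // g' a = c} ≃ {a // g a = c}) := by
    intro c
    rw [← Fintype.card_eq]
    by_cases hc : c < (firsts s).length
    · have hc' : c < (firsts s').length := hlen ▸ hc
      rw [Fintype.card_of_subtype _ (fun a => (hfib c hc a).symm),
        Fintype.card_of_subtype _ (fun a => (hfib' c hc' a).symm)]
      have := List.getElem_of_eq hb (i := c) (by simpa using hc')
      simpa using this
    · have : IsEmpty {a // g a = c} := ⟨fun a => hc (a.2 ▸ hg a.1)⟩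
      have : IsEmpty {a // g' a = c} := ⟨fun a => hc (a.2 ▸ hlen ▸ hg' a.1)⟩
      simp
  -- The fibres of `g'` and `g` are the numbered clusters of `s'` and `s`; gluing gives `g ∘ σ =
  -- g'`, from which both claims are read off.
  let σ : Equiv.Perm (Fin n) := Equiv.ofFiberEquiv fun c => (hcard c).some
  have hσ : ∀ a, g (σ a) = g' a := fun a => Equiv.ofFiberEquiv_map _ a
  have hrel : ∀ a b, s a b ↔ g a = g b := by
    intro a b
    rw [hfib (g b) (hg b) a, mem_finCluster, hget]
    exact ⟨fun hab => s.trans (hφs b) (s.symm hab), fun hab => s.trans (s.symm hab) (hφs b)⟩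
  have hrel' : ∀ a b, s' a b ↔ g' a = g' b := by
    intro a b
    rw [hfib' (g' b) (hg' b) a, mem_finCluster, hget']
    exact ⟨fun hab => s'.trans (hφs' b) (s'.symm hab), fun hab => s'.trans (s'.symm hab) (hφs' b)⟩
  have hs' : s' = s.comap σ := by
    ext a b
    change s' a b ↔ s (σ a) (σ b)
    rw [hrel, hrel', hσ, hσ]
  refine ⟨σ, hs', ?_⟩
  intro i j i' j' hi hj hij hi' hj' hii hjj
  rw [← hs'] at hi hj
  have key : ∀ i i', IsFirst s' i → IsFirst s i' → s i' (σ i) →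
      ∃ (h1 : g' i < (firsts s').length) (h2 : g' i < (firsts s).length),
        (firsts s')[g' i] = i ∧ (firsts s)[g' i] = i' := by
    intro i i' hi hi' hii
    refine ⟨hg' i, hlen ▸ hg' i, ?_, ?_⟩
    · rw [hget']
      exact isFirst_unique s' (hφ' i) hi (hφs' i)
    · have h1 := hget i'
      have h2 : φ i' = i' := isFirst_unique s (hφ i') hi' (hφs i')
      have h3 : g i' = g' i := by rw [← hσ, ← hrel]; exact hii
      simp only [h3] at h1
      rw [h1, h2]
  obtain ⟨h1, h2, h3, h4⟩ := key i i' hi hi' hii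
  obtain ⟨k1, k2, k3, k4⟩ := key j j' hj hj' hjj
  have hlt : g' i < g' j := by
    by_contra hcon
    rcases (not_lt.1 hcon).lt_or_eq with h5 | h5
    · have := List.pairwise_iff_getElem.1 (pairwise_firsts s') _ _ k1 h1 h5
      rw [h3, k3] at this
      exact lt_asymm hij this
    · simp only [h5] at k3
      rw [← h3, ← k3] at hij
      exact lt_irrefl _ hij
  have := List.pairwise_iff_getElem.1 (pairwise_firsts s) _ _ h2 k2 hlt
  rwa [h4, k4] at this

end Order

/-! ### Exchanging two neighbouring positions -/

section Swap

variable {n : ℕ}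

theorem comap_swap_of_rel {α : Type*} [DecidableEq α] {s : Setoid α} {b b' : α} (h : s b b') :
    s.comap (Equiv.swap b b') = s := by
  have key : ∀ i, s (Equiv.swap b b' i) i := by
    intro i
    by_cases h1 : i = b
    · subst h1; rw [Equiv.swap_apply_left]; exact s.symm h
    by_cases h2 : i = b'
    · subst h2; rw [Equiv.swap_apply_right]; exact h
    rw [Equiv.swap_apply_of_ne_of_ne h1 h2]
  ext i j
  change s _ _ ↔ s _ _
  exact ⟨fun h => s.trans (s.symm (key i)) (s.trans h (key j)),
    fun h => s.trans (key i) (s.trans h (s.symm (key j)))⟩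

theorem swap_lt_swap {b b' i j : Fin n} (hb : (b' : ℕ) = b + 1) (hij : i < j)
    (h : ¬ (i = b ∧ j = b')) : Equiv.swap b b' i < Equiv.swap b b' j := by
  simp only [Equiv.swap_apply_def]
  simp only [Fin.lt_def, Fin.ext_iff] at *
  split_ifs <;> omega

/-- The only pair whose order an exchange of neighbours reverses is `b, b'` itself, and this pair
does not lie in one cluster. -/
theorem isFirst_comap_swap_of_isFirst {s : Setoid (Fin n)} {b b' : Fin n}
    (hb : (b' : ℕ) = b + 1) (h : ¬ s b b') {i : Fin n} (hi : IsFirst s (Equiv.swap b b' i)) :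
    IsFirst (s.comap (Equiv.swap b b')) i := by
  intro j hj hji
  change s _ _ at hji
  refine hi _ (swap_lt_swap hb hj ?_) hji
  rintro ⟨rfl, rfl⟩
  simp only [Equiv.swap_apply_left, Equiv.swap_apply_right] at hji
  exact h (s.symm hji)

theorem isFirst_comap_swap {s : Setoid (Fin n)} {b b' : Fin n} (hb : (b' : ℕ) = b + 1)
    (h : ¬ s b b') (i : Fin n) :
    IsFirst (s.comap (Equiv.swap b b')) i ↔ IsFirst s (Equiv.swap b b' i) := by
  refine ⟨fun hi => ?_, isFirst_comap_swap_of_isFirst hb h⟩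
  have := isFirst_comap_swap_of_isFirst (s := s.comap (Equiv.swap b b')) (b := b) (b' := b')
    (i := Equiv.swap b b' i) hb ?_ (by simpa using hi)
  · have h2 : (s.comap (Equiv.swap b b')).comap (Equiv.swap b b') = s := by
      ext x y
      change s _ _ ↔ s _ _
      simp
    rwa [h2] at this
  · change ¬ s _ _
    simp only [Equiv.swap_apply_left, Equiv.swap_apply_right]
    exact fun h' => h (s.symm h')

/-- If `b` and `b'` share a cluster, the partition does not change. Otherwise least elements go to
least elements, and two of them change their order only if they are `b` and `b'`, the excluded case.
-/
theorem preservesOrder_swap {s : Setoid (Fin n)} {b b' : Fin n} (hb : (b' : ℕ) = b + 1)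
    (h : ¬ (IsFirst s b ∧ IsFirst s b')) : PreservesOrder (Equiv.swap b b') s := by
  intro i j i' j' hi hj hij hi' hj' hii hjj
  by_cases hs : s b b'
  · rw [comap_swap_of_rel hs] at hi hj
    have key : ∀ i i', IsFirst s i → IsFirst s i' → s i' (Equiv.swap b b' i) → i' = i := by
      intro i i' hi hi' hii
      refine isFirst_unique s hi' hi (s.trans hii ?_)
      have : (s.comap (Equiv.swap b b')) (Equiv.swap b b' i) i := by
        rw [comap_swap_of_rel hs]
        simp only [Equiv.swap_apply_def]
        split_ifs with h1 h2
        · subst h1; exact s.symm hs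
        · subst h2; exact hs
        · exact s.refl _
      rwa [comap_swap_of_rel hs] at this
    rwa [key i i' hi hi' hii, key j j' hj hj' hjj]
  · rw [isFirst_comap_swap hb hs] at hi hj
    rw [isFirst_unique s hi' hi hii, isFirst_unique s hj' hj hjj]
    refine swap_lt_swap hb hij ?_
    rintro ⟨rfl, rfl⟩
    simp only [Equiv.swap_apply_left, Equiv.swap_apply_right] at hi hj
    exact h ⟨hj, hi⟩

open scoped Classical in
/-- Exchange the positions `b` and `b' = b + 1`, unless both are least elements of their
clusters. -/
noncomputable def finSwap (b b' : Fin n) (s : Setoid (Fin n)) : Setoid (Fin n) :=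
  if IsFirst s b ∧ IsFirst s b' then s else s.comap (Equiv.swap b b')

theorem clusterSizes_finSwap {b b' : Fin n} (hb : (b' : ℕ) = b + 1) (s : Setoid (Fin n)) :
    clusterSizes (finSwap b b' s) = clusterSizes s := by
  unfold finSwap
  split_ifs with h
  · rfl
  · exact clusterSizes_comap (preservesOrder_swap hb h)

/-- The point is that the exceptional condition is itself invariant under the exchange, so that both
applications fall into the same branch. -/
theorem finSwap_finSwap {b b' : Fin n} (hb : (b' : ℕ) = b + 1) (s : Setoid (Fin n)) :
    finSwap b b' (finSwap b b' s) = s := by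
  by_cases h : IsFirst s b ∧ IsFirst s b'
  · simp [finSwap, h]
  · have h' : ¬ (IsFirst (s.comap (Equiv.swap b b')) b ∧
        IsFirst (s.comap (Equiv.swap b b')) b') := by
      by_cases hs : s b b'
      · rwa [comap_swap_of_rel hs]
      · rw [isFirst_comap_swap hb hs, isFirst_comap_swap hb hs, Equiv.swap_apply_left,
          Equiv.swap_apply_right]
        exact fun h2 => h ⟨h2.2, h2.1⟩
    simp only [finSwap, h, h', if_false]
    ext x y
    change s _ _ ↔ s _ _
    simp

open scoped Classical in
/-- Exchange the positions `b` and `b + 1`, unless both are least elements of their clusters. -/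
noncomputable def adjSwap (b : ℕ) (π : Setoid ℕ) : Setoid ℕ :=
  if IsFirstAfter π 0 b ∧ IsFirstAfter π 0 (b + 1) then π else π.comap (Equiv.swap b (b + 1))

theorem isFirst_restrict {N : ℕ} {π : Setoid ℕ} (i : Fin N) :
    IsFirst (restrict N π) i ↔ IsFirstAfter π 0 i := by
  simp only [IsFirst, IsFirstAfter, zero_le, true_and, true_implies]
  exact ⟨fun h l hl => h ⟨l, hl.trans i.2⟩ hl, fun h j hj => h j hj⟩

theorem restrict_adjSwap {N b : ℕ} (hb : b + 1 < N) (π : Setoid ℕ) :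
    restrict N (adjSwap b π) = finSwap ⟨b, by omega⟩ ⟨b + 1, hb⟩ (restrict N π) := by
  by_cases h : IsFirstAfter π 0 b ∧ IsFirstAfter π 0 (b + 1)
  · rw [adjSwap, finSwap, if_pos h, if_pos]
    rwa [isFirst_restrict, isFirst_restrict]
  · rw [adjSwap, finSwap, if_neg h, if_neg (by rwa [isFirst_restrict, isFirst_restrict])]
    have key : ∀ i : Fin N, ((Equiv.swap (⟨b, by omega⟩ : Fin N) ⟨b + 1, hb⟩ i : Fin N) : ℕ) =
        Equiv.swap b (b + 1) (i : ℕ) := by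
      intro i
      simp only [Equiv.swap_apply_def, Fin.ext_iff]
      split_ifs <;> rfl
    ext x y
    change π _ _ ↔ π (Fin.val _) (Fin.val _)
    rw [key, key]

end Swap

/-! ### Measurability, and laws determined by finite restrictions -/

section Measurability

theorem measurableSet_rel (i j : ℕ) : MeasurableSet {π : Setoid ℕ | π i j} :=
  MeasurableSpace.measurableSet_generateFrom ⟨i, j, rfl⟩

theorem measurableSet_restrict (N : ℕ) (s : Setoid (Fin N)) :
    MeasurableSet {π : Setoid ℕ | restrict N π = s} := by
  have : {π : Setoid ℕ | restrict N π = s} =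
      ⋂ i : Fin N, ⋂ j : Fin N, {π : Setoid ℕ | π i j ↔ s i j} := by
    ext π
    simp only [Set.mem_ofPred_eq, Set.mem_iInter, Setoid.ext_iff]
    exact ⟨fun h i j => h i j, fun h i j => h i j⟩
  rw [this]
  refine MeasurableSet.iInter fun i => MeasurableSet.iInter fun j => ?_
  exact (measurableSet_rel i j).iff (MeasurableSet.const _)

instance (n : ℕ) : Finite (Setoid (Fin n)) :=
  Finite.of_injective (fun s i j => s i j : Setoid (Fin n) → Fin n → Fin n → Prop)
    fun s t h => by ext i j; exact iff_of_eq (congrFun (congrFun h i) j)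

theorem measurableSet_restrict_mem (N : ℕ) (T : Set (Setoid (Fin N))) :
    MeasurableSet {π : Setoid ℕ | restrict N π ∈ T} := by
  have : {π : Setoid ℕ | restrict N π ∈ T} = ⋃ s ∈ T, {π : Setoid ℕ | restrict N π = s} := by
    ext; simp
  rw [this]
  exact MeasurableSet.biUnion (Set.toFinite T).countable fun s _ => measurableSet_restrict N s

theorem measurable_of_rel {α : Type*} [MeasurableSpace α] {f : α → Setoid ℕ}
    (h : ∀ i j, MeasurableSet {a | f a i j}) : Measurable f := by
  refine measurable_generateFrom ?_
  rintro _ ⟨i, j, rfl⟩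
  exact h i j

theorem measurable_shift (n : ℕ) : Measurable (shift n) :=
  measurable_of_rel fun i j => measurableSet_rel (i + n) (j + n)

theorem measurableSet_isFirstAfter (n i : ℕ) :
    MeasurableSet {π : Setoid ℕ | IsFirstAfter π n i} := by
  have : {π : Setoid ℕ | IsFirstAfter π n i} =
      {_π : Setoid ℕ | n ≤ i} ∩ ⋂ l, {π : Setoid ℕ | n ≤ l → l < i → ¬ π l i} := by
    ext; simp [IsFirstAfter]
  rw [this]
  refine (MeasurableSet.const _).inter (MeasurableSet.iInter fun l => ?_)
  refine (MeasurableSet.const _).imp ((MeasurableSet.const _).imp (measurableSet_rel l i).compl)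

theorem measurable_adjSwap (b : ℕ) : Measurable (adjSwap b) := by
  classical
  refine Measurable.ite ((measurableSet_isFirstAfter 0 b).inter
    (measurableSet_isFirstAfter 0 (b + 1))) measurable_id ?_
  exact measurable_of_rel fun i j => measurableSet_rel _ _

theorem measure_restrict_mem (P : Measure (Setoid ℕ)) (N : ℕ) (T : Finset (Setoid (Fin N))) :
    P {π | restrict N π ∈ T} = ∑ s ∈ T, P {π | restrict N π = s} := by
  have : {π : Setoid ℕ | restrict N π ∈ T} = ⋃ s ∈ T, {π : Setoid ℕ | restrict N π = s} := by
    ext; simp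
  rw [this, measure_biUnion_finset]
  · intro s _ t _ hst
    exact Set.disjoint_left.2 fun π h1 h2 => hst (Eq.trans (Eq.symm h1) h2)
  · exact fun s _ => measurableSet_restrict N s

/-- The event that all the pairs in `F` consist of elements of the same cluster. -/
def upperEvent (F : Finset (ℕ × ℕ)) : Set (Setoid ℕ) := {π | ∀ p ∈ F, π p.1 p.2}

theorem isPiSystem_upperEvent : IsPiSystem (Set.range upperEvent) := by
  classical
  rintro _ ⟨F, rfl⟩ _ ⟨G, rfl⟩ -
  refine ⟨F ∪ G, ?_⟩
  ext π
  simp only [upperEvent, Set.mem_ofPred_eq, Set.mem_inter_iff, Finset.mem_union]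
  exact ⟨fun h => ⟨fun p hp => h p (Or.inl hp), fun p hp => h p (Or.inr hp)⟩,
    fun h p hp => hp.elim (h.1 p) (h.2 p)⟩

theorem generateFrom_upperEvent : MeasurableSpace.generateFrom (Set.range upperEvent) =
    Setoid.instMeasurableSpaceNat := by
  refine le_antisymm (MeasurableSpace.generateFrom_le ?_) (MeasurableSpace.generateFrom_le ?_)
  · rintro _ ⟨F, rfl⟩
    have : upperEvent F = ⋂ p ∈ F, {π : Setoid ℕ | π p.1 p.2} := by
      ext; simp [upperEvent]
    rw [this]
    exact Finset.measurableSet_biInter _ fun p _ => measurableSet_rel _ _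
  · rintro _ ⟨i, j, rfl⟩
    refine MeasurableSpace.measurableSet_generateFrom ⟨{(i, j)}, ?_⟩
    ext; simp [upperEvent]

/-- Events requiring finitely many pairs to be related form a generating π-system, and each is
decided by a sufficiently long restriction. The freedom to ignore restrictions shorter than `N₀`
matters because an exchange of `b` and `b + 1` acts on a restriction only if that contains both
positions. -/
theorem ext_of_restrict {P Q : Measure (Setoid ℕ)} [IsFiniteMeasure P] (N₀ : ℕ)
    (h : ∀ N, N₀ ≤ N → ∀ s : Setoid (Fin N), P {π | restrict N π = s} = Q {π | restrict N π = s}) :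
    P = Q := by
  classical
  have key : ∀ N, N₀ ≤ N → ∀ T : Set (Setoid (Fin N)),
      P {π | restrict N π ∈ T} = Q {π | restrict N π ∈ T} := by
    intro N hN T
    have hT := measure_restrict_mem P N (Set.toFinite T).toFinset
    have hT' := measure_restrict_mem Q N (Set.toFinite T).toFinset
    simp only [Set.Finite.mem_toFinset] at hT hT'
    rw [hT, hT']
    exact Finset.sum_congr rfl fun s _ => h N hN s
  refine ext_of_generate_finite _ generateFrom_upperEvent.symm isPiSystem_upperEvent ?_ ?_
  · rintro _ ⟨F, rfl⟩
    let N := N₀ + (F.sup (fun p => p.1 + p.2) + 1)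
    have hN : ∀ p ∈ F, p.1 + p.2 < N := fun p hp => by
      have := Finset.le_sup (f := fun p : ℕ × ℕ => p.1 + p.2) hp
      omega
    have : upperEvent F = {π | restrict N π ∈ {s : Setoid (Fin N) | ∀ p (hp : p ∈ F),
        s ⟨p.1, by have := hN p hp; omega⟩ ⟨p.2, by have := hN p hp; omega⟩}} := rfl
    rw [this]
    exact key N (by omega) _
  · simpa using key N₀ le_rfl Set.univ

end Measurability

/-! ### Swap invariance, and stability of the hypotheses under shifts -/

section PEPPF

/-- The law `P` is invariant under the exchange of two neighbouring positions that are not both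
least elements of their clusters. -/
def IsSwapInvariant (P : Measure (Setoid ℕ)) : Prop := ∀ b, P.map (adjSwap b) = P

variable {Ω : Type*} [MeasurableSpace Ω] {μ : Measure Ω} {X : Ω → Setoid ℕ}

theorem hasPEPPF_map (hX : Measurable X) {p : CompositionFun} :
    HasPEPPF (μ.map X) id p ↔ HasPEPPF μ X p := by
  refine forall₂_congr fun n s => ?_
  rw [show {ω : Setoid ℕ | restrict n (id ω) = s} = {π | restrict n π = s} from rfl,
    map_measureReal_apply hX (measurableSet_restrict n s)]
  rfl

theorem isExchangeable_map (hX : Measurable X) :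
    IsExchangeable (μ.map X) id ↔ IsExchangeable μ X := by
  refine forall₃_congr fun n σ s => ?_
  rw [show {ω : Setoid ℕ | restrict n (id ω) = s} = {π | restrict n π = s} from rfl,
    show {ω : Setoid ℕ | restrict n (id ω) = s.comap σ} = {π | restrict n π = s.comap σ} from rfl,
    Measure.map_apply hX (measurableSet_restrict n s),
    Measure.map_apply hX (measurableSet_restrict n _)]
  rfl

/-- The composition function that gives the probabilities of the values of the restrictions, and
is zero on compositions that are not realized by any partition. -/
noncomputable def sizeProb (μ : Measure Ω) (X : Ω → Setoid ℕ) : CompositionFun := fun n c =>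
  open scoped Classical in
  if h : ∃ s : Setoid (Fin n), clusterSizes s = c then μ.real {ω | restrict n (X ω) = h.choose}
  else 0

theorem hasPEPPF_sizeProb (h : ∀ (n : ℕ) (s s' : Setoid (Fin n)),
    clusterSizes s' = clusterSizes s →
      μ.real {ω | restrict n (X ω) = s'} = μ.real {ω | restrict n (X ω) = s}) :
    HasPEPPF μ X (sizeProb μ X) := by
  intro n s
  have hs : ∃ t : Setoid (Fin n), clusterSizes t = clusterSizes s := ⟨s, rfl⟩
  rw [sizeProb, dif_pos hs]
  exact h n _ _ hs.choose_spec.symm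

theorem HasPEPPF.sizeProb {p : CompositionFun} (h : HasPEPPF μ X p) :
    HasPEPPF μ X (sizeProb μ X) :=
  hasPEPPF_sizeProb fun n s s' hs => by rw [h, h, hs]

/-- On restrictions that contain `b` and `b + 1` the exchange is an involution, so the preimage of a
single value is again a single value. -/
theorem isSwapInvariant_of_finSwap {P : Measure (Setoid ℕ)} [IsFiniteMeasure P]
    (h : ∀ (N : ℕ) (b b' : Fin N) (_ : (b' : ℕ) = b + 1) (s : Setoid (Fin N)),
      P {π | restrict N π = finSwap b b' s} = P {π | restrict N π = s}) :
    IsSwapInvariant P := by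
  intro b
  refine ext_of_restrict (b + 2) fun N hN s => ?_
  rw [Measure.map_apply (measurable_adjSwap b) (measurableSet_restrict N s),
    ← h N ⟨b, by omega⟩ ⟨b + 1, by omega⟩ rfl s]
  congr 1
  ext π
  change restrict N (adjSwap b π) = s ↔ restrict N π = _
  rw [restrict_adjSwap (by omega)]
  constructor
  · rintro rfl
    rw [finSwap_finSwap rfl]
  · intro h
    rw [h, finSwap_finSwap rfl]

theorem HasPEPPF.isSwapInvariant {P : Measure (Setoid ℕ)} [IsFiniteMeasure P]
    {p : CompositionFun} (h : HasPEPPF P id p) : IsSwapInvariant P := by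
  refine isSwapInvariant_of_finSwap fun N b b' hb s => ?_
  rw [← measureReal_eq_measureReal_iff]
  exact (h N _).trans ((congrArg _ (clusterSizes_finSwap hb s)).trans (h N s).symm)

theorem IsExchangeable.isSwapInvariant {P : Measure (Setoid ℕ)} [IsFiniteMeasure P]
    (h : IsExchangeable P id) : IsSwapInvariant P := by
  refine isSwapInvariant_of_finSwap fun N b b' hb s => ?_
  rw [finSwap]
  split_ifs
  · rfl
  · exact h N _ s

/-- Partitions with equal cluster sizes differ by a permutation of the positions. -/
theorem IsExchangeable.hasPEPPF (h : IsExchangeable μ X) : HasPEPPF μ X (sizeProb μ X) := by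
  refine hasPEPPF_sizeProb fun n s s' hs => ?_
  obtain ⟨σ, rfl, -⟩ := exists_comap_of_clusterSizes_eq hs
  exact congrArg ENNReal.toReal (h n σ s)

/-- Adding a fixed point in front is harmless: its cluster comes first before and after the
permutation, and all other clusters have the same least elements as in the partition without the new
point. -/
theorem preservesOrder_decomposeFin {m : ℕ} {σ : Equiv.Perm (Fin m)}
    {t : Setoid (Fin (m + 1))} (h : PreservesOrder σ (t.comap Fin.succ)) :
    PreservesOrder (Equiv.Perm.decomposeFin.symm (0, σ)) t := by
  have h0 : Equiv.Perm.decomposeFin.symm (0, σ) 0 = 0 := by simp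
  have hs : ∀ i : Fin m, Equiv.Perm.decomposeFin.symm (0, σ) i.succ = (σ i).succ := by simp
  intro i j i' j' hi hj hij hi' hj' hii hjj
  have hne : ∀ (i : Fin m) (i' : Fin (m + 1)),
      IsFirst (t.comap (Equiv.Perm.decomposeFin.symm (0, σ))) i.succ →
      t i' (Equiv.Perm.decomposeFin.symm (0, σ) i.succ) → i' ≠ 0 := by
    rintro i i' hi hii rfl
    refine hi 0 (Fin.succ_pos i) ?_
    change t _ _
    rwa [h0]
  have hf : ∀ i : Fin m, IsFirst (t.comap (Equiv.Perm.decomposeFin.symm (0, σ))) i.succ →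
      IsFirst ((t.comap Fin.succ).comap σ) i := by
    intro i hi l hl hli
    refine hi l.succ (Fin.succ_lt_succ_iff.2 hl) ?_
    change t _ _
    rw [hs, hs]
    exact hli
  have hf' : ∀ i : Fin m, IsFirst t i.succ → IsFirst (t.comap Fin.succ) i :=
    fun i hi l hl hli => hi l.succ (Fin.succ_lt_succ_iff.2 hl) hli
  obtain ⟨j, rfl⟩ := Fin.exists_succ_eq.2 ((Fin.zero_le i).trans_lt hij).ne'
  obtain ⟨j', rfl⟩ := Fin.exists_succ_eq.2 (hne j j' hj hjj)
  rcases Fin.eq_zero_or_eq_succ i with rfl | ⟨i, rfl⟩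
  · have : i' = 0 := by
      by_contra h1
      refine hi' 0 (Fin.pos_of_ne_zero h1) ?_
      rw [h0] at hii
      exact t.symm hii
    rw [this]
    exact Fin.succ_pos j'
  · obtain ⟨i', rfl⟩ := Fin.exists_succ_eq.2 (hne i i' hi hii)
    rw [hs] at hii hjj
    exact Fin.succ_lt_succ_iff.2 (h i j i' j' (hf i hi) (hf j hj) (Fin.succ_lt_succ_iff.1 hij)
      (hf' i' hi') (hf' j' hj') hii hjj)

theorem restrict_shift_one (m : ℕ) (π : Setoid ℕ) :
    restrict m (shift 1 π) = (restrict (m + 1) π).comap Fin.succ := rfl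

/-- The probability of a value of the shifted restriction is a sum over its extensions by one
element in front. A permutation relating two values with the same sizes, extended by a fixed point,
is a size-preserving bijection between the two sets of extensions. -/
theorem HasPEPPF.shift_one {P : Measure (Setoid ℕ)} [IsFiniteMeasure P] {p : CompositionFun}
    (h : HasPEPPF P id p) : HasPEPPF P (shift 1) (RandomPartition.sizeProb P (shift 1)) := by
  classical
  refine hasPEPPF_sizeProb fun m s s' hs => ?_
  obtain ⟨σ, rfl, hσ⟩ := exists_comap_of_clusterSizes_eq hs
  clear hs
  have : Fintype (Setoid (Fin (m + 1))) := Fintype.ofFinite _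
  have key : ∀ s : Setoid (Fin m), P.real {π | restrict m (shift 1 π) = s} =
      ∑ t ∈ Finset.univ.filter (fun t : Setoid (Fin (m + 1)) => t.comap Fin.succ = s),
        p (m + 1) (clusterSizes t) := by
    intro s
    have h1 := measure_restrict_mem P (m + 1)
      (Finset.univ.filter (fun t : Setoid (Fin (m + 1)) => t.comap Fin.succ = s))
    simp only [Finset.mem_filter, Finset.mem_univ, true_and, ← restrict_shift_one] at h1
    rw [Measure.real, h1, ENNReal.toReal_sum (fun _ _ => measure_ne_top _ _)]
    exact Finset.sum_congr rfl fun t _ => h (m + 1) t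
  rw [key, key]
  set τ : Equiv.Perm (Fin (m + 1)) := Equiv.Perm.decomposeFin.symm (0, σ) with hτ
  have hs : ∀ i : Fin m, τ i.succ = (σ i).succ := by simp [hτ]
  have hs' : ∀ i : Fin m, τ.symm i.succ = (σ.symm i).succ := by
    intro i
    rw [Equiv.symm_apply_eq, hs, Equiv.apply_symm_apply]
  symm
  refine Finset.sum_bij' (fun t _ => t.comap τ) (fun t _ => t.comap τ.symm) ?_ ?_ ?_ ?_ ?_
  · intro t ht
    simp only [Finset.mem_filter, Finset.mem_univ, true_and] at ht ⊢
    subst ht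
    ext x y
    change t _ _ ↔ t _ _
    rw [hs, hs]
  · intro t ht
    simp only [Finset.mem_filter, Finset.mem_univ, true_and] at ht ⊢
    ext x y
    have := Setoid.ext_iff.1 ht (σ.symm x) (σ.symm y)
    change t _ _ ↔ s _ _ at this
    change t _ _ ↔ s _ _
    rw [hs', hs', this, Equiv.apply_symm_apply, Equiv.apply_symm_apply]
  · intro t _
    ext x y
    change t _ _ ↔ t _ _
    simp
  · intro t _
    ext x y
    change t _ _ ↔ t _ _
    simp
  · intro t ht
    simp only [Finset.mem_filter, Finset.mem_univ, true_and] at ht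
    subst ht
    rw [clusterSizes_comap (preservesOrder_decomposeFin hσ)]

theorem shift_zero : shift 0 = id := by
  funext π
  ext i j
  exact Iff.rfl

theorem shift_shift (m n : ℕ) (π : Setoid ℕ) : shift m (shift n π) = shift (m + n) π := by
  ext i j
  change π (i + m + n) (j + m + n) ↔ π (i + (m + n)) (j + (m + n))
  rw [add_assoc, add_assoc]

theorem HasPEPPF.shift {P : Measure (Setoid ℕ)} [IsFiniteMeasure P] {p : CompositionFun}
    (h : HasPEPPF P id p) (n : ℕ) : HasPEPPF P (shift n) (RandomPartition.sizeProb P (shift n)) := by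
  induction n with
  | zero => rw [shift_zero]; exact h.sizeProb
  | succ n ih =>
    rw [← hasPEPPF_map (measurable_shift n)] at ih
    have h1 := ih.shift_one
    rw [← hasPEPPF_map (measurable_shift 1), Measure.map_map (measurable_shift 1)
      (measurable_shift n)] at h1
    rw [show RandomPartition.shift 1 ∘ RandomPartition.shift n = RandomPartition.shift (n + 1) from
      funext fun π => by rw [Function.comp_apply, shift_shift, add_comm],
      hasPEPPF_map (measurable_shift _)] at h1
    exact h1.sizeProb

/-- A window of length `m` starting after `n` can be carried to the first `m` positions by a
permutation of `m + n` positions. -/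
theorem map_shift_eq_of_isExchangeable {P : Measure (Setoid ℕ)} [IsFiniteMeasure P]
    (h : IsExchangeable P id) (n : ℕ) : P.map (shift n) = P := by
  classical
  refine (ext_of_restrict 0 fun m _ s => ?_).symm
  have : Fintype (Setoid (Fin (m + n))) := Fintype.ofFinite _
  -- Rotation by `n`: the first `m` positions move up by `n`, the last `n` ones move to the front.
  let σ : Equiv.Perm (Fin (m + n)) :=
    { toFun := fun i => if h : (i : ℕ) < m then ⟨i + n, by omega⟩ else ⟨i - m, by omega⟩
      invFun := fun i => if h : (i : ℕ) < n then ⟨i + m, by omega⟩ else ⟨i - n, by omega⟩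
      left_inv := fun i => by
        ext
        by_cases h : (i : ℕ) < m
        · simp [h]
        · simp only [h, dif_neg, not_false_eq_true]
          rw [dif_pos (by omega)]
          simp only
          omega
      right_inv := fun i => by
        ext
        by_cases h : (i : ℕ) < n
        · simp [h]
        · simp only [h, dif_neg, not_false_eq_true]
          rw [dif_pos (by omega)]
          simp only
          omega }
  have hσ : ∀ i : Fin m, σ (Fin.castAdd n i) = Fin.addNat i n := fun i => Fin.ext (by simp [σ])
  have hσ' : ∀ i : Fin m, σ.symm (Fin.addNat i n) = Fin.castAdd n i := fun i => by
    rw [Equiv.symm_apply_eq, hσ]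
  have key : ∀ f : Fin m → Fin (m + n),
      P {π | (restrict (m + n) π).comap f = s} =
        ∑ t ∈ Finset.univ.filter (fun t : Setoid (Fin (m + n)) => t.comap f = s),
          P {π | restrict (m + n) π = t} := by
    intro f
    simpa using measure_restrict_mem P (m + n)
      (Finset.univ.filter (fun t : Setoid (Fin (m + n)) => t.comap f = s))
  rw [Measure.map_apply (measurable_shift n) (measurableSet_restrict m s)]
  refine (key (Fin.castAdd n)).trans (Eq.trans ?_ (key fun i => Fin.addNat i n).symm)
  refine Finset.sum_bij' (fun t _ => t.comap σ.symm) (fun t _ => t.comap σ) ?_ ?_ ?_ ?_ ?_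
  · intro t ht
    simp only [Finset.mem_filter, Finset.mem_univ, true_and] at ht ⊢
    subst ht
    ext x y
    change t _ _ ↔ t _ _
    rw [hσ', hσ']
  · intro t ht
    simp only [Finset.mem_filter, Finset.mem_univ, true_and] at ht ⊢
    subst ht
    ext x y
    change t _ _ ↔ t _ _
    rw [hσ, hσ]
  · intro t _
    ext x y
    change t _ _ ↔ t _ _
    simp
  · intro t _
    ext x y
    change t _ _ ↔ t _ _
    simp
  · intro t _
    exact (h _ σ.symm t).symm

end PEPPF

/-! ### Exchangeability of the positions that join old clusters -/

section Positions

/-- The partition lies in `E`, and the clusters of the `i a` contain the `b a`. -/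
def posEvent {ι : Type*} (E : Set (Setoid ℕ)) (i b : ι → ℕ) : Set (Setoid ℕ) :=
  E ∩ {π | ∀ a, π (i a) (b a)}

/-- The event `E` is not affected by exchanges of neighbours from position `n` on. -/
def SwapStable (n : ℕ) (E : Set (Setoid ℕ)) : Prop :=
  ∀ b, n ≤ b → ∀ π, adjSwap b π ∈ E ↔ π ∈ E

theorem measurableSet_posEvent {ι : Type*} [Finite ι] {E : Set (Setoid ℕ)} (hE : MeasurableSet E)
    (i b : ι → ℕ) : MeasurableSet (posEvent E i b) := by
  have : posEvent E i b = E ∩ ⋂ a, {π | π (i a) (b a)} := by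
    ext; simp [posEvent]
  rw [this]
  exact hE.inter (MeasurableSet.iInter fun a => measurableSet_rel _ _)

/-- Seen from an earlier element `i`, the conditional exchange acts like an unconditional one: when
it is suppressed, `c` and `c + 1` both start new clusters, so neither is related to `i` and both
sides fail there. This is why the exception in the symmetry does no harm. -/
theorem adjSwap_rel {n c i b : ℕ} (hc : n ≤ c) (hi : i < n) (π : Setoid ℕ) :
    adjSwap c π i b ↔ π i (Equiv.swap c (c + 1) b) := by
  by_cases h : IsFirstAfter π 0 c ∧ IsFirstAfter π 0 (c + 1)
  · rw [adjSwap, if_pos h]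
    by_cases h1 : b = c
    · subst h1
      rw [Equiv.swap_apply_left]
      exact iff_of_false (h.1.2 i zero_le (by omega)) (h.2.2 i zero_le (by omega))
    by_cases h2 : b = c + 1
    · subst h2
      rw [Equiv.swap_apply_right]
      exact iff_of_false (h.2.2 i zero_le (by omega)) (h.1.2 i zero_le (by omega))
    rw [Equiv.swap_apply_of_ne_of_ne h1 h2]
  · rw [adjSwap, if_neg h]
    change π _ _ ↔ _
    rw [Equiv.swap_apply_of_ne_of_ne (by omega) (by omega)]

theorem adjSwap_rel_of_lt {c i j : ℕ} (hi : i < c) (hj : j < c) (π : Setoid ℕ) :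
    adjSwap c π i j ↔ π i j := by
  rw [adjSwap_rel le_rfl hi, Equiv.swap_apply_of_ne_of_ne (by omega) (by omega)]

variable {P : Measure (Setoid ℕ)} {n : ℕ} {E : Set (Setoid ℕ)}

theorem measure_posEvent_adjSwap {ι : Type*} [Finite ι] (hP : IsSwapInvariant P)
    (hE : MeasurableSet E) (hEn : SwapStable n E) {i : ι → ℕ} (hi : ∀ a, i a < n) (b : ι → ℕ)
    {c : ℕ} (hc : n ≤ c) :
    P (posEvent E i (Equiv.swap c (c + 1) ∘ b)) = P (posEvent E i b) := by
  conv_rhs => rw [← hP c, Measure.map_apply (measurable_adjSwap c) (measurableSet_posEvent hE i b)]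
  congr 1
  ext π
  refine and_congr (hEn c hc π).symm (forall_congr' fun a => ?_)
  exact (adjSwap_rel hc (hi a) π).symm

/-- Transpositions of distant positions are products of exchanges of neighbours, all of them beyond
`n`. -/
theorem measure_posEvent_swap {ι : Type*} [Finite ι] (hP : IsSwapInvariant P)
    (hE : MeasurableSet E) (hEn : SwapStable n E) {i : ι → ℕ} (hi : ∀ a, i a < n)
    {c d : ℕ} (hc : n ≤ c) (hd : n ≤ d) (b : ι → ℕ) :
    P (posEvent E i (Equiv.swap c d ∘ b)) = P (posEvent E i b) := by
  wlog hcd : c ≤ d generalizing c d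
  · rw [Equiv.swap_comm]
    exact this hd hc (by omega)
  obtain ⟨k, rfl⟩ := Nat.exists_eq_add_of_le hcd
  clear hcd hd
  induction k generalizing b with
  | zero => simp
  | succ k ih =>
    by_cases hk : k = 0
    · subst hk
      exact measure_posEvent_adjSwap hP hE hEn hi b hc
    -- The longer transposition is the conjugate of the shorter one by an exchange of neighbours.
    have : Equiv.swap c (c + (k + 1)) = Equiv.swap (c + k) (c + k + 1) *
        Equiv.swap c (c + k) * Equiv.swap (c + k) (c + k + 1) := by
      rw [Equiv.swap_mul_swap_mul_swap (by omega) (by omega), Equiv.swap_comm]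
      rfl
    rw [this, Equiv.Perm.coe_mul, Equiv.Perm.coe_mul, Function.comp_assoc, Function.comp_assoc,
      measure_posEvent_adjSwap hP hE hEn hi _ (by omega), ih,
      measure_posEvent_adjSwap hP hE hEn hi _ (by omega)]

/-- The targets are moved to their new places one at a time by transpositions. -/
theorem measure_posEvent_eq {ι : Type*} [Finite ι] (hP : IsSwapInvariant P)
    (hE : MeasurableSet E) (hEn : SwapStable n E) {i : ι → ℕ} (hi : ∀ a, i a < n)
    {b b' : ι → ℕ} (hb : Function.Injective b) (hb' : Function.Injective b')
    (hnb : ∀ a, n ≤ b a) (hnb' : ∀ a, n ≤ b' a) :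
    P (posEvent E i b) = P (posEvent E i b') := by
  classical
  have := Fintype.ofFinite ι
  -- `S` collects the indices already in place; injectivity of `β` and `b'` ensures that the next
  -- transposition does not displace them.
  have key : ∀ S : Finset ι, ∃ β : ι → ℕ, Function.Injective β ∧ (∀ a, n ≤ β a) ∧
      (∀ a ∈ S, β a = b' a) ∧ P (posEvent E i b) = P (posEvent E i β) := by
    intro S
    induction S using Finset.induction_on with
    | empty => exact ⟨b, hb, hnb, by simp, rfl⟩
    | insert x S hx ih =>
      obtain ⟨β, h1, h2, h3, h4⟩ := ih
      refine ⟨Equiv.swap (β x) (b' x) ∘ β, (Equiv.injective _).comp h1, ?_, ?_, ?_⟩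
      · intro a
        simp only [Function.comp_apply, Equiv.swap_apply_def]
        split_ifs
        exacts [hnb' x, h2 x, h2 a]
      · intro a ha
        rcases Finset.mem_insert.1 ha with rfl | ha'
        · simp
        · have hax : a ≠ x := by rintro rfl; exact hx ha'
          rw [Function.comp_apply, Equiv.swap_apply_of_ne_of_ne (h1.ne hax)
            (by rw [h3 a ha']; exact hb'.ne hax), h3 a ha']
      · rw [h4, measure_posEvent_swap hP hE hEn hi (h2 x) (hnb' x)]
  obtain ⟨β, -, -, h3, h4⟩ := key Finset.univ
  rw [h4, show β = b' from funext fun a => h3 a (Finset.mem_univ a)]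

end Positions

/-! ### A law of large numbers from constant first and second moments -/

section SecondMoment

/-- The proportion of the events `A 0, …, A (N - 1)` that happen. -/
noncomputable def avg {α : Type*} (A : ℕ → Set α) (N : ℕ) (x : α) : ℝ :=
  (∑ a ∈ Finset.range N, (A a).indicator (fun _ => (1 : ℝ)) x) / N

theorem avg_nonneg {α : Type*} (A : ℕ → Set α) (N : ℕ) (x : α) : 0 ≤ avg A N x :=
  div_nonneg (Finset.sum_nonneg fun _ _ => Set.indicator_nonneg (fun _ _ => zero_le_one) _)
    (Nat.cast_nonneg _)

theorem avg_le_one {α : Type*} (A : ℕ → Set α) (N : ℕ) (x : α) : avg A N x ≤ 1 := by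
  refine div_le_one_of_le₀ ?_ (Nat.cast_nonneg _)
  calc _ ≤ ∑ a ∈ Finset.range N, (1 : ℝ) :=
        Finset.sum_le_sum fun a _ => Set.indicator_le_self' (fun _ _ => zero_le_one) x
    _ = N := by simp

variable {α : Type*} [MeasurableSpace α] {μ : Measure α} [IsFiniteMeasure μ] {A : ℕ → Set α}
  {c₁ c₂ : ℝ}

theorem measurable_avg (hA : ∀ a, MeasurableSet (A a)) (N : ℕ) : Measurable (avg A N) :=
  (Finset.measurable_sum _ fun a _ => measurable_const.indicator (hA a)).div_const _

theorem integrable_avg (hA : ∀ a, MeasurableSet (A a)) (N : ℕ) : Integrable (avg A N) μ :=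
  Integrable.of_bound (measurable_avg hA N).aestronglyMeasurable 1
    (ae_of_all _ fun x => by
      rw [Real.norm_of_nonneg (avg_nonneg A N x)]; exact avg_le_one A N x)

/-- Each of the `N` events in the first average meets itself exactly once in the second one, because
`N ≤ M`; the other `M - 1` pairs contribute `c₂`. -/
theorem integral_avg_mul_avg (hA : ∀ a, MeasurableSet (A a)) (h₁ : ∀ a, μ.real (A a) = c₁)
    (h₂ : ∀ a b, a ≠ b → μ.real (A a ∩ A b) = c₂) {N M : ℕ} (hN : 0 < N) (hNM : N ≤ M) :
    ∫ x, avg A N x * avg A M x ∂μ = c₁ / M + c₂ * (M - 1) / M := by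
  have hNR : (N : ℝ) ≠ 0 := by positivity
  have hMR : (M : ℝ) ≠ 0 := by have : 0 < M := by omega
                               positivity
  have h : ∀ x, avg A N x * avg A M x = (∑ a ∈ Finset.range N, ∑ b ∈ Finset.range M,
      (A a ∩ A b).indicator (fun _ => (1 : ℝ)) x) / (N * M) := by
    intro x
    rw [avg, avg, div_mul_div_comm, Finset.sum_mul_sum]
    congr 1
    refine Finset.sum_congr rfl fun a _ => Finset.sum_congr rfl fun b _ => ?_
    by_cases h1 : x ∈ A a <;> by_cases h2 : x ∈ A b <;> simp [h1, h2]
  simp only [h]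
  rw [integral_div, integral_finsetSum]
  · have hin : ∀ a ∈ Finset.range N, ∫ x, ∑ b ∈ Finset.range M,
        (A a ∩ A b).indicator (fun _ => (1 : ℝ)) x ∂μ = c₁ + (M - 1) * c₂ := by
      intro a ha
      have haM : a ∈ Finset.range M := Finset.mem_range.2 ((Finset.mem_range.1 ha).trans_le hNM)
      rw [integral_finsetSum]
      · simp only [integral_indicator_const _ ((hA _).inter (hA _)), smul_eq_mul, mul_one]
        rw [← Finset.add_sum_erase _ _ haM, Set.inter_self, h₁,
          Finset.sum_congr rfl fun b hb => h₂ a b (Finset.ne_of_mem_erase hb).symm]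
        rw [Finset.sum_const, Finset.card_erase_of_mem haM, Finset.card_range, nsmul_eq_mul,
          Nat.cast_sub (by omega), Nat.cast_one]
      · exact fun b _ => (integrable_const _).indicator ((hA _).inter (hA _))
    rw [Finset.sum_congr rfl hin, Finset.sum_const, Finset.card_range, nsmul_eq_mul]
    field_simp
  · exact fun a _ => integrable_finsetSum _ fun b _ =>
      (integrable_const _).indicator ((hA _).inter (hA _))

theorem integrable_avg_mul (hA : ∀ a, MeasurableSet (A a)) (N M : ℕ) :
    Integrable (fun x => avg A N x * avg A M x) μ :=
  Integrable.of_bound ((measurable_avg hA N).mul (measurable_avg hA M)).aestronglyMeasurable 1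
    (ae_of_all _ fun x => by
      rw [Real.norm_of_nonneg (mul_nonneg (avg_nonneg A N x) (avg_nonneg A M x))]
      exact mul_le_one₀ (avg_le_one A N x) (avg_nonneg A M x) (avg_le_one A M x))

/-- The integral equals `(c₁ - c₂) * (1 / N - 1 / M)`. The bound does not involve `M`, so it
survives the limit `M → ∞`. -/
theorem integral_avg_sub_sq_le (hA : ∀ a, MeasurableSet (A a)) (h₁ : ∀ a, μ.real (A a) = c₁)
    (h₂ : ∀ a b, a ≠ b → μ.real (A a ∩ A b) = c₂) {N M : ℕ} (hN : 0 < N) (hNM : N ≤ M) :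
    ∫ x, (avg A N x - avg A M x) ^ 2 ∂μ ≤ c₁ / N := by
  have hNR : (0 : ℝ) < N := by positivity
  have hMR : (0 : ℝ) < M := by have : 0 < M := by omega
                               positivity
  have h : ∀ x, (avg A N x - avg A M x) ^ 2 =
      avg A N x * avg A N x - 2 * (avg A N x * avg A M x) + avg A M x * avg A M x := fun x => by
    ring
  simp only [h]
  rw [integral_add, integral_sub, integral_const_mul, integral_avg_mul_avg hA h₁ h₂ hN le_rfl,
    integral_avg_mul_avg hA h₁ h₂ hN hNM, integral_avg_mul_avg hA h₁ h₂ (hN.trans_le hNM) le_rfl]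
  · have hc1 : 0 ≤ c₁ := h₁ 0 ▸ measureReal_nonneg
    have hc2 : 0 ≤ c₂ := h₂ 0 1 (by norm_num) ▸ measureReal_nonneg
    have hc12 : c₂ ≤ c₁ := by
      rw [← h₁ 0, ← h₂ 0 1 (by norm_num)]
      exact measureReal_mono Set.inter_subset_left
    have hle : (1 : ℝ) / M ≤ 1 / N :=
      one_div_le_one_div_of_le hNR (by exact_mod_cast hNM)
    have : c₁ / N + c₂ * (N - 1) / N - 2 * (c₁ / M + c₂ * (M - 1) / M) +
        (c₁ / M + c₂ * (M - 1) / M) = (c₁ - c₂) * (1 / N - 1 / M) := by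
      field_simp
      ring
    rw [this, div_eq_mul_one_div c₁]
    have : (0 : ℝ) ≤ 1 / M := by positivity
    have h3 : (0 : ℝ) ≤ 1 / N := by positivity
    nlinarith [mul_nonneg (sub_nonneg.2 hc12) this, mul_nonneg hc2 h3]
  · exact integrable_avg_mul hA _ _
  · exact (integrable_avg_mul hA _ _).const_mul _
  · exact (integrable_avg_mul hA _ _).sub ((integrable_avg_mul hA _ _).const_mul _)
  · exact integrable_avg_mul hA _ _

/-- Along fourth powers the mean absolute increments are of order `1 / k ^ 2`, so their sum has
finite integral. -/
theorem ae_summable_abs_sub (hA : ∀ a, MeasurableSet (A a)) (h₁ : ∀ a, μ.real (A a) = c₁)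
    (h₂ : ∀ a b, a ≠ b → μ.real (A a ∩ A b) = c₂) :
    ∀ᵐ x ∂μ, Summable fun k : ℕ => |avg A ((k + 1) ^ 4) x - avg A ((k + 2) ^ 4) x| := by
  have hint : ∀ N M, Integrable (fun x => |avg A N x - avg A M x|) μ := fun N M =>
    ((integrable_avg hA N).sub (integrable_avg hA M)).abs
  have hbound : ∀ k : ℕ, ∫ x, |avg A ((k + 1) ^ 4) x - avg A ((k + 2) ^ 4) x| ∂μ ≤
      (c₁ + μ.real Set.univ) * (1 / ((k + 1 : ℕ) : ℝ) ^ 2) := by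
    intro k
    -- In place of the Cauchy–Schwarz inequality, `|d| ≤ r * d ^ 2 + 1 / r` is used; with this `r`
    -- both terms have order `1 / r`, since the mean of `d ^ 2` is at most `c₁ / r ^ 2`.
    set r : ℝ := ((k + 1 : ℕ) : ℝ) ^ 2 with hr
    have hr0 : 0 < r := by positivity
    have hsq := integral_avg_sub_sq_le hA h₁ h₂ (N := (k + 1) ^ 4) (M := (k + 2) ^ 4)
      (by positivity) (by gcongr; omega)
    have hle : ∀ x, |avg A ((k + 1) ^ 4) x - avg A ((k + 2) ^ 4) x| ≤
        r * (avg A ((k + 1) ^ 4) x - avg A ((k + 2) ^ 4) x) ^ 2 + 1 / r := by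
      intro x
      set d := avg A ((k + 1) ^ 4) x - avg A ((k + 2) ^ 4) x
      rw [← sq_abs d]
      have : 0 ≤ r * (|d| - 1 / (2 * r)) ^ 2 := by positivity
      have h3 : r * (|d| - 1 / (2 * r)) ^ 2 = r * |d| ^ 2 - |d| + 1 / r / 4 := by
        field_simp
        ring
      have h4 : 0 < 1 / r := by positivity
      linarith
    have hsqint : Integrable (fun x => (avg A ((k + 1) ^ 4) x - avg A ((k + 2) ^ 4) x) ^ 2) μ := by
      have h : ∀ x, (avg A ((k + 1) ^ 4) x - avg A ((k + 2) ^ 4) x) ^ 2 =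
        avg A ((k + 1) ^ 4) x * avg A ((k + 1) ^ 4) x -
          2 * (avg A ((k + 1) ^ 4) x * avg A ((k + 2) ^ 4) x) +
          avg A ((k + 2) ^ 4) x * avg A ((k + 2) ^ 4) x := fun x => by ring
      simp only [h]
      exact ((integrable_avg_mul hA _ _).sub ((integrable_avg_mul hA _ _).const_mul _)).add
        (integrable_avg_mul hA _ _)
    calc ∫ x, |avg A ((k + 1) ^ 4) x - avg A ((k + 2) ^ 4) x| ∂μ
        ≤ ∫ x, (r * (avg A ((k + 1) ^ 4) x - avg A ((k + 2) ^ 4) x) ^ 2 + 1 / r) ∂μ :=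
          integral_mono (hint _ _) ((hsqint.const_mul _).add (integrable_const _)) hle
      _ = r * ∫ x, (avg A ((k + 1) ^ 4) x - avg A ((k + 2) ^ 4) x) ^ 2 ∂μ +
            μ.real Set.univ * (1 / r) := by
          rw [integral_add (hsqint.const_mul _) (integrable_const _), integral_const_mul,
            integral_const, smul_eq_mul]
      _ ≤ r * (c₁ / ((k + 1) ^ 4 : ℕ)) + μ.real Set.univ * (1 / r) := by gcongr
      _ = _ := by
          have : (((k + 1) ^ 4 : ℕ) : ℝ) = r * r := by rw [hr]; push_cast; ring
          rw [this]
          field_simp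
  have hsum : Summable fun k : ℕ => (c₁ + μ.real Set.univ) * (1 / ((k + 1 : ℕ) : ℝ) ^ 2) :=
    ((summable_nat_add_iff 1).2 (Real.summable_one_div_nat_pow.2 one_lt_two)).mul_left _
  have hfin : ∫⁻ x, ∑' k : ℕ, ENNReal.ofReal |avg A ((k + 1) ^ 4) x - avg A ((k + 2) ^ 4) x| ∂μ
      ≠ ⊤ := by
    rw [lintegral_tsum fun k =>
      (hint _ _).aestronglyMeasurable.aemeasurable.ennreal_ofReal]
    refine ne_top_of_le_ne_top (b := ∑' k : ℕ, ENNReal.ofReal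
      ((c₁ + μ.real Set.univ) * (1 / ((k + 1 : ℕ) : ℝ) ^ 2))) ?_ (ENNReal.tsum_le_tsum fun k => ?_)
    · exact hsum.tsum_ofReal_ne_top
    · rw [← ofReal_integral_eq_lintegral_ofReal (hint _ _) (ae_of_all _ fun x => abs_nonneg _)]
      exact ENNReal.ofReal_le_ofReal (hbound k)
  filter_upwards [ae_lt_top' (AEMeasurable.tsum fun k =>
    (hint _ _).aestronglyMeasurable.aemeasurable.ennreal_ofReal) hfin] with x hx
  have := ENNReal.summable_toReal hx.ne
  simpa using this

/-- Convergence along fourth powers extends to all `N`, because the counts are monotone and the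
ratio of successive fourth powers tends to one. -/
theorem ae_exists_tendsto_avg (hA : ∀ a, MeasurableSet (A a)) (h₁ : ∀ a, μ.real (A a) = c₁)
    (h₂ : ∀ a b, a ≠ b → μ.real (A a ∩ A b) = c₂) :
    ∀ᵐ x ∂μ, ∃ l, Tendsto (fun N => avg A N x) atTop (𝓝 l) := by
  filter_upwards [ae_summable_abs_sub hA h₁ h₂] with x hx
  have hc : CauchySeq fun k : ℕ => avg A ((k + 1) ^ 4) x := by
    refine cauchySeq_of_summable_dist ?_
    simpa [Real.dist_eq, add_assoc] using hx
  obtain ⟨l, hl⟩ := cauchySeq_tendsto_of_complete hc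
  refine ⟨l, tendsto_div_of_monotone_of_exists_subseq_tendsto_div _ l ?_ ?_⟩
  · refine monotone_nat_of_le_succ fun N => ?_
    rw [Finset.sum_range_succ]
    exact le_add_of_nonneg_right (Set.indicator_nonneg (fun _ _ => zero_le_one) _)
  · intro a ha
    refine ⟨fun k => (k + 1) ^ 4, ?_, ?_, hl⟩
    · have h1 : Tendsto (fun k : ℕ => ((1 : ℝ) + 1 / ((k : ℝ) + 1)) ^ 4) atTop (𝓝 ((1 + 0) ^ 4)) :=
        (tendsto_const_nhds.add tendsto_one_div_add_atTop_nhds_zero_nat).pow 4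
      rw [add_zero, one_pow] at h1
      filter_upwards [h1.eventually_lt_const ha] with k hk
      have hk0 : (0 : ℝ) < (k : ℝ) + 1 := by positivity
      have : (((k + 1 + 1) ^ 4 : ℕ) : ℝ) = (1 + 1 / ((k : ℝ) + 1)) ^ 4 * (((k + 1) ^ 4 : ℕ) : ℝ) := by
        push_cast
        rw [← mul_pow]
        congr 1
        field_simp
      rw [this]
      gcongr
    · exact (tendsto_pow_atTop (by norm_num)).comp (tendsto_add_atTop_nat 1)

theorem integral_avg_sub_lim_sq_le (hA : ∀ a, MeasurableSet (A a)) (h₁ : ∀ a, μ.real (A a) = c₁)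
    (h₂ : ∀ a b, a ≠ b → μ.real (A a ∩ A b) = c₂) {Z : α → ℝ}
    (hZ : ∀ᵐ x ∂μ, Tendsto (fun N => avg A N x) atTop (𝓝 (Z x))) {N : ℕ} (hN : 0 < N) :
    ∫ x, (avg A N x - Z x) ^ 2 ∂μ ≤ c₁ / N := by
  have hlim : Tendsto (fun M => ∫ x, (avg A N x - avg A M x) ^ 2 ∂μ) atTop
      (𝓝 (∫ x, (avg A N x - Z x) ^ 2 ∂μ)) := by
    refine tendsto_integral_of_dominated_convergence (fun _ => 1) (fun M => ?_)
      (integrable_const _) (fun M => ae_of_all _ fun x => ?_) ?_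
    · exact (((measurable_avg hA N).sub (measurable_avg hA M)).pow_const 2).aestronglyMeasurable
    · rw [Real.norm_of_nonneg (sq_nonneg _), sq_le_one_iff_abs_le_one, abs_le]
      constructor <;> linarith [avg_nonneg A N x, avg_le_one A N x, avg_nonneg A M x,
        avg_le_one A M x]
    · filter_upwards [hZ] with x hx
      exact (tendsto_const_nhds.sub hx).pow 2
  refine le_of_tendsto hlim ?_
  filter_upwards [eventually_ge_atTop N] with M hM
  exact integral_avg_sub_sq_le hA h₁ h₂ hN hM

end SecondMoment

/-! ### Limiting relative frequencies of sets of positions -/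

section Frequencies

theorem relFreq_eq_sum (C : Set ℕ) (N : ℕ) :
    relFreq C N = (∑ m ∈ Finset.range N, C.indicator (fun _ => (1 : ℝ)) m) / N := by
  classical
  have : C ∩ Set.Iio N = ((Finset.range N).filter (· ∈ C) : Finset ℕ) := by
    ext m; simp [and_comm]
  rw [relFreq, this, Set.ncard_coe_finset, Finset.card_filter]
  push_cast
  congr 1

theorem relFreq_nonneg (C : Set ℕ) (N : ℕ) : 0 ≤ relFreq C N := by
  unfold relFreq; positivity

theorem relFreq_le_one (C : Set ℕ) (N : ℕ) : relFreq C N ≤ 1 := by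
  refine div_le_one_of_le₀ ?_ (Nat.cast_nonneg _)
  have := Set.ncard_le_ncard (Set.inter_subset_right (s := C) (t := Set.Iio N)) (Set.finite_Iio N)
  rw [Set.ncard_Iio_nat] at this
  exact_mod_cast this

theorem freq_nonneg (C : Set ℕ) : 0 ≤ freq C :=
  le_limsup_of_frequently_le (Frequently.of_forall fun N => relFreq_nonneg C N)
    (isBoundedUnder_of ⟨1, fun N => relFreq_le_one C N⟩)

theorem freq_le_one (C : Set ℕ) : freq C ≤ 1 :=
  limsup_le_of_le ((isBoundedUnder_of ⟨0, fun N => relFreq_nonneg C N⟩ :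
    IsBoundedUnder (· ≥ ·) atTop (relFreq C)).isCoboundedUnder_le)
    (Eventually.of_forall fun N => relFreq_le_one C N)

theorem freq_eq_of_tendsto {C : Set ℕ} {l : ℝ} (h : Tendsto (relFreq C) atTop (𝓝 l)) :
    freq C = l := h.limsup_eq

/-- Dropping the first `n` positions changes the relative frequencies by a quantity of order `n /
N`. -/
theorem tendsto_relFreq_shift (C : Set ℕ) (n : ℕ) {l : ℝ} :
    Tendsto (relFreq {m | m + n ∈ C}) atTop (𝓝 l) ↔ Tendsto (relFreq C) atTop (𝓝 l) := by
  have hdiff : Tendsto (fun N => relFreq C (N + n) - relFreq {m | m + n ∈ C} N) atTop (𝓝 0) := by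
    have hC : ∀ N : ℕ, 0 < N → relFreq C (N + n) - relFreq {m | m + n ∈ C} N =
        (∑ m ∈ Finset.range n, C.indicator (fun _ => (1 : ℝ)) m) / ((N + n : ℕ) : ℝ) -
          relFreq {m | m + n ∈ C} N * (n / ((N + n : ℕ) : ℝ)) := by
      intro N hN
      have hN' : (0 : ℝ) < N := by positivity
      have hNn : (0 : ℝ) < ((N + n : ℕ) : ℝ) := by positivity
      rw [relFreq_eq_sum, relFreq_eq_sum, add_comm N n, Finset.sum_range_add]
      have : ∑ x ∈ Finset.range N, C.indicator (fun _ => (1 : ℝ)) (n + x) =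
          ∑ m ∈ Finset.range N, {m | m + n ∈ C}.indicator (fun _ => (1 : ℝ)) m :=
        Finset.sum_congr rfl fun x _ => by
          simp only [add_comm n x]; rfl
      rw [this]
      rw [add_comm N n] at hNn
      field_simp
      push_cast
      ring
    have h1 : Tendsto (fun N : ℕ => ((N + n : ℕ) : ℝ)) atTop atTop :=
      tendsto_natCast_atTop_atTop.comp (tendsto_add_atTop_nat n)
    have h2 : Tendsto (fun N : ℕ => (∑ m ∈ Finset.range n, C.indicator (fun _ => (1 : ℝ)) m) /
        ((N + n : ℕ) : ℝ)) atTop (𝓝 0) := tendsto_const_nhds.div_atTop h1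
    have h3 : Tendsto (fun N : ℕ => relFreq {m | m + n ∈ C} N * (n / ((N + n : ℕ) : ℝ))) atTop
        (𝓝 0) := by
      refine squeeze_zero (fun N => mul_nonneg (relFreq_nonneg _ _) (by positivity))
        (fun N => mul_le_of_le_one_left (by positivity) (relFreq_le_one _ _)) ?_
      exact tendsto_const_nhds.div_atTop h1
    have h4 := h2.sub h3
    rw [sub_zero] at h4
    refine h4.congr' ?_
    filter_upwards [eventually_gt_atTop 0] with N hN
    exact (hC N hN).symm
  rw [← tendsto_add_atTop_iff_nat (f := relFreq C) n]
  constructor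
  · intro h
    simpa using h.add hdiff
  · intro h
    simpa using h.sub hdiff

/-- The count in a window is a difference of two initial counts. Windows with distinct `k` are
disjoint, which will supply distinct target positions. -/
theorem tendsto_window {C : Set ℕ} {l : ℝ} (h : Tendsto (relFreq C) atTop (𝓝 l)) (k : ℕ) :
    Tendsto (fun N : ℕ => (∑ c ∈ Finset.range N, C.indicator (fun _ => (1 : ℝ)) (k * N + c)) / N)
      atTop (𝓝 l) := by
  have h1 : Tendsto (fun N : ℕ => ((k : ℝ) + 1) * relFreq C (k * N + N) - k * relFreq C (k * N))
      atTop (𝓝 (((k : ℝ) + 1) * l - k * l)) := by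
    have ha : Tendsto (fun N : ℕ => k * N + N) atTop atTop :=
      tendsto_atTop_mono (fun N => Nat.le_add_left N _) tendsto_id
    refine ((h.comp ha).const_mul _).sub ?_
    rcases Nat.eq_zero_or_pos k with rfl | hk
    · simp
    · exact (h.comp (tendsto_id.const_mul_atTop' hk)).const_mul _
  rw [show ((k : ℝ) + 1) * l - k * l = l by ring] at h1
  refine h1.congr' ?_
  filter_upwards [eventually_gt_atTop 0] with N hN
  have hN' : (0 : ℝ) < N := by positivity
  rw [relFreq_eq_sum, relFreq_eq_sum, Finset.sum_range_add]
  rcases Nat.eq_zero_or_pos k with rfl | hk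
  · simp
  · have : (0 : ℝ) < k := by positivity
    push_cast
    field_simp
    ring

/-- All clusters have limiting frequencies. -/
def Regular (π : Setoid ℕ) : Prop :=
  ∀ i, Tendsto (relFreq {m | π i m}) atTop (𝓝 (freq {m | π i m}))

theorem measurable_freq {α : Type*} [MeasurableSpace α] {C : α → Set ℕ}
    (hC : ∀ m, MeasurableSet {x | m ∈ C x}) : Measurable fun x => freq (C x) := by
  refine Measurable.limsup fun N => ?_
  simp only [relFreq_eq_sum]
  refine (Finset.measurable_sum _ fun m _ => ?_).div_const _
  have : (fun x => (C x).indicator (fun _ => (1 : ℝ)) m) =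
      {x | m ∈ C x}.indicator (fun _ => (1 : ℝ)) := by
    rfl
  rw [this]
  exact measurable_const.indicator (hC m)

theorem measurable_freq_class (i : ℕ) : Measurable fun π : Setoid ℕ => freq {m | π i m} :=
  measurable_freq fun m => measurableSet_rel i m

end Frequencies

/-! ### Existence of the frequencies and the moment formula -/

section Moments

variable {P : Measure (Setoid ℕ)} {n : ℕ} {E : Set (Setoid ℕ)}

theorem swapStable_of_restrict (h : ∀ π π' : Setoid ℕ,
    (∀ i j, i < n → j < n → (π i j ↔ π' i j)) → π ∈ E → π' ∈ E) : SwapStable n E := by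
  intro b hb π
  have key : ∀ i j, i < n → j < n → (adjSwap b π i j ↔ π i j) := fun i j hi hj =>
    adjSwap_rel_of_lt (hi.trans_le hb) (hj.trans_le hb) π
  exact ⟨h _ _ key, h _ _ fun i j hi hj => (key i j hi hj).symm⟩

theorem measureReal_restrict_rel (hP : IsSwapInvariant P) (hE : MeasurableSet E)
    (hEn : SwapStable n E) {i : ℕ} (hi : i < n) (a : ℕ) :
    (P.restrict E).real {π | π i (a + n)} = P.real (E ∩ {π | π i n}) := by
  rw [measureReal_restrict_apply (measurableSet_rel _ _), Set.inter_comm]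
  have := measure_posEvent_eq (ι := Unit) hP hE hEn (i := fun _ => i) (fun _ => hi)
    (b := fun _ => a + n) (b' := fun _ => n) (Function.injective_of_subsingleton _)
    (Function.injective_of_subsingleton _) (fun _ => by simp) (fun _ => le_rfl)
  simpa [posEvent, Measure.real] using congrArg ENNReal.toReal this

theorem measureReal_restrict_rel_inter (hP : IsSwapInvariant P) (hE : MeasurableSet E)
    (hEn : SwapStable n E) {i : ℕ} (hi : i < n) {a b : ℕ} (hab : a ≠ b) :
    (P.restrict E).real ({π | π i (a + n)} ∩ {π | π i (b + n)}) =
      P.real (E ∩ {π | π i n ∧ π i (n + 1)}) := by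
  rw [measureReal_restrict_apply ((measurableSet_rel _ _).inter (measurableSet_rel _ _)),
    Set.inter_comm]
  have := measure_posEvent_eq (ι := Fin 2) hP hE hEn (i := fun _ => i) (fun _ => hi)
    (b := ![a + n, b + n]) (b' := ![n, n + 1])
    (by rw [← List.nodup_ofFn]; simp [hab])
    (by rw [← List.nodup_ofFn]; simp)
    (by rw [Fin.forall_fin_two]; simp)
    (by rw [Fin.forall_fin_two]; simp)
  simp only [posEvent, Fin.forall_fin_two] at this
  exact congrArg ENNReal.toReal this

theorem avg_class (π : Setoid ℕ) (i n N : ℕ) :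
    avg (fun a => {π : Setoid ℕ | π i (a + n)}) N π = relFreq {m | m + n ∈ {m | π i m}} N := by
  rw [relFreq_eq_sum, avg]
  rfl

variable [IsProbabilityMeasure P]

/-- For fixed `i` the positions beyond `i` join the cluster of `i` exchangeably, so the second
moment argument applies with the trivial event. -/
theorem ae_regular (hP : IsSwapInvariant P) : ∀ᵐ π ∂P, Regular π := by
  rw [show (∀ᵐ π ∂P, Regular π) ↔ _ from ae_all_iff]
  intro i
  have hE : SwapStable (i + 1) (Set.univ : Set (Setoid ℕ)) := fun _ _ _ => by simp
  have := ae_exists_tendsto_avg (μ := P.restrict Set.univ)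
    (A := fun a => {π : Setoid ℕ | π i (a + (i + 1))}) (fun a => measurableSet_rel _ _)
    (measureReal_restrict_rel hP MeasurableSet.univ hE (Nat.lt_succ_self i))
    (fun a b hab => measureReal_restrict_rel_inter hP MeasurableSet.univ hE
      (Nat.lt_succ_self i) hab)
  rw [Measure.restrict_univ] at this
  filter_upwards [this] with π hπ
  obtain ⟨l, hl⟩ := hπ
  simp only [avg_class] at hl
  rw [show (fun N => relFreq {m | m + (i + 1) ∈ {m | π i m}} N) =
    relFreq {m | m + (i + 1) ∈ {m | π i m}} from rfl, tendsto_relFreq_shift] at hl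
  rwa [freq_eq_of_tendsto hl]

theorem setIntegral_sq_le (hP : IsSwapInvariant P) (hE : MeasurableSet E)
    (hEn : SwapStable n E) {i : ℕ} (hi : i < n) {N : ℕ} (hN : 0 < N) :
    ∫ π in E, (relFreq {m | m + n ∈ {m | π i m}} N - freq {m | π i m}) ^ 2 ∂P ≤
      P.real E / N := by
  have hle := integral_avg_sub_lim_sq_le (μ := P.restrict E)
    (A := fun a => {π : Setoid ℕ | π i (a + n)}) (fun a => measurableSet_rel _ _)
    (measureReal_restrict_rel hP hE hEn hi)
    (fun a b hab => measureReal_restrict_rel_inter hP hE hEn hi hab)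
    (Z := fun π => freq {m | π i m}) ?_ hN
  · simp only [avg_class] at hle
    refine hle.trans ?_
    exact div_le_div_of_nonneg_right (measureReal_mono Set.inter_subset_left) (Nat.cast_nonneg _)
  · filter_upwards [ae_restrict_of_ae (ae_regular hP)] with π hπ
    simp only [avg_class]
    exact (tendsto_relFreq_shift _ n).2 (hπ i)

/-- The left side does not depend on the targets, so it equals its average over targets chosen from
disjoint long windows. This average is the integral of a product of window frequencies, which
converge to the cluster frequencies. -/
theorem measureReal_posEvent (hP : IsSwapInvariant P) (hE : MeasurableSet E)
    (hEn : SwapStable n E) {ι : Type*} [Fintype ι] {i b : ι → ℕ} (hi : ∀ a, i a < n)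
    (hb : Function.Injective b) (hnb : ∀ a, n ≤ b a) :
    P.real (posEvent E i b) = ∫ π in E, ∏ a, freq {m | π (i a) m} ∂P := by
  classical
  -- The window of `a` starts at `e a * N`. Distinct values make the windows disjoint, and the
  -- summand one puts them all beyond `n` once `N ≥ n`.
  let e : ι → ℕ := fun a => (Fintype.equivFin ι a : ℕ) + 1
  have he : Function.Injective e := fun x y hxy => by
    exact (Fintype.equivFin ι).injective (Fin.ext (by simpa [e] using hxy))
  let W : ℕ → Setoid ℕ → ℝ := fun N π =>
    ∏ a, (∑ c ∈ Finset.range N, {m | π (i a) m}.indicator (fun _ => (1 : ℝ)) (e a * N + c)) / N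
  have hind : ∀ (π : Setoid ℕ) (i m : ℕ), {m | π i m}.indicator (fun _ => (1 : ℝ)) m =
      {π : Setoid ℕ | π i m}.indicator (fun _ => (1 : ℝ)) π := fun _ _ _ => rfl
  let G : ℕ → (ι → ℕ) → Set (Setoid ℕ) := fun N c => {π | ∀ a, π (i a) (e a * N + c a)}
  have hW : ∀ N, n ≤ N → 0 < N → ∫ π in E, W N π ∂P = P.real (posEvent E i b) := by
    intro N hnN hN
    have h1 : ∀ π, W N π = (∑ c ∈ Fintype.piFinset (fun _ : ι => Finset.range N),
        (G N c).indicator (fun _ => (1 : ℝ)) π) /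
          (N : ℝ) ^ Fintype.card ι := by
      intro π
      simp only [W]
      rw [Finset.prod_div_distrib, Finset.prod_univ_sum, Finset.prod_const, Finset.card_univ]
      congr 1
      refine Finset.sum_congr rfl fun c _ => ?_
      by_cases hc : ∀ a, π (i a) (e a * N + c a)
      · rw [Set.indicator_of_mem (show π ∈ G N c from hc)]
        refine Finset.prod_eq_one fun a _ => ?_
        exact Set.indicator_of_mem (show e a * N + c a ∈ {m | π (i a) m} from hc a) _
      · rw [Set.indicator_of_notMem (show π ∉ G N c from hc)]
        push Not at hc
        obtain ⟨a, ha⟩ := hc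
        refine Finset.prod_eq_zero (Finset.mem_univ a) ?_
        exact Set.indicator_of_notMem (show e a * N + c a ∉ {m | π (i a) m} from ha) _
    have hmeas : ∀ c : ι → ℕ, MeasurableSet (G N c) := by
      intro c
      have : G N c =
          ⋂ a, {π : Setoid ℕ | π (i a) (e a * N + c a)} := by ext; simp [G]
      rw [this]
      exact MeasurableSet.iInter fun a => measurableSet_rel _ _
    have hterm : ∀ c ∈ Fintype.piFinset (fun _ : ι => Finset.range N),
        ∫ π in E, (G N c).indicator (fun _ => (1 : ℝ)) π ∂P =
          P.real (posEvent E i b) := by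
      intro c hc
      rw [Fintype.mem_piFinset] at hc
      rw [integral_indicator_const _ (hmeas c), smul_eq_mul, mul_one,
        measureReal_restrict_apply (hmeas c), Set.inter_comm]
      refine congrArg ENNReal.toReal (measure_posEvent_eq hP hE hEn hi
        (b := fun a => e a * N + c a) ?_ hb (fun a => ?_) hnb)
      · intro x y hxy
        have hx := Finset.mem_range.1 (hc x)
        have hy := Finset.mem_range.1 (hc y)
        have h2 : (e x * N + c x) / N = (e y * N + c y) / N := congrArg (· / N) hxy
        rw [mul_comm, Nat.mul_add_div hN, mul_comm, Nat.mul_add_div hN, Nat.div_eq_of_lt hx,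
          Nat.div_eq_of_lt hy] at h2
        exact he h2
      · have : 1 * N ≤ e a * N := Nat.mul_le_mul_right _ (by simp [e])
        omega
    simp only [h1]
    rw [integral_div, integral_finsetSum, Finset.sum_congr rfl hterm, Finset.sum_const,
      Fintype.card_piFinset, Finset.prod_const, Finset.card_range, Finset.card_univ, nsmul_eq_mul]
    · have : (N : ℝ) ≠ 0 := by positivity
      push_cast
      field_simp
    · exact fun c _ => (integrable_const _).indicator (hmeas c)
  have hlim : Tendsto (fun N => ∫ π in E, W N π ∂P) atTop
      (𝓝 (∫ π in E, ∏ a, freq {m | π (i a) m} ∂P)) := by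
    refine tendsto_integral_of_dominated_convergence (fun _ => 1) (fun N => ?_)
      (integrable_const _) (fun N => ae_of_all _ fun π => ?_) ?_
    · refine (Finset.measurable_prod _ fun a _ => (Finset.measurable_sum _ fun c _ => ?_).div_const
        _).aestronglyMeasurable
      simp only [hind]
      exact measurable_const.indicator (measurableSet_rel _ _)
    · have h0 : ∀ a, 0 ≤ (∑ c ∈ Finset.range N,
          {m | π (i a) m}.indicator (fun _ => (1 : ℝ)) (e a * N + c)) / N := fun a =>
        div_nonneg (Finset.sum_nonneg fun _ _ => Set.indicator_nonneg (fun _ _ => zero_le_one) _)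
          (Nat.cast_nonneg _)
      rw [Real.norm_of_nonneg (Finset.prod_nonneg fun a _ => h0 a)]
      refine Finset.prod_le_one (fun a _ => h0 a) fun a _ => ?_
      refine div_le_one_of_le₀ ?_ (Nat.cast_nonneg _)
      calc _ ≤ ∑ c ∈ Finset.range N, (1 : ℝ) :=
            Finset.sum_le_sum fun c _ => Set.indicator_le_self' (fun _ _ => zero_le_one) _
        _ = N := by simp
    · filter_upwards [ae_restrict_of_ae (ae_regular hP)] with π hπ
      exact tendsto_finsetProd _ fun a _ => tendsto_window (hπ (i a)) (e a)
  refine tendsto_nhds_unique (tendsto_const_nhds.congr' ?_) hlim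
  filter_upwards [eventually_ge_atTop n, eventually_gt_atTop 0] with N h1 h2
  exact (hW N h1 h2).symm

end Moments

/-! ### Ranked sequences and sequences with the same positive terms -/

section Ranked

/-- The sequences `x` and `y` have the same positive terms, with multiplicities. -/
def SameCounts (x y : ℕ → ℝ) : Prop :=
  ∀ t, 0 < t → {j | t ≤ x j}.encard = {j | t ≤ y j}.encard

theorem SameCounts.symm {x y : ℕ → ℝ} (h : SameCounts x y) : SameCounts y x :=
  fun t ht => (h t ht).symm

theorem SameCounts.trans {x y z : ℕ → ℝ} (h : SameCounts x y) (h' : SameCounts y z) :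
    SameCounts x z := fun t ht => (h t ht).trans (h' t ht)

/-- By the layer cake formula for counting measure, a power sum is an integral over positive levels
of the number of terms above the level. -/
theorem SameCounts.tsum_ofReal_pow {x y : ℕ → ℝ} (h : SameCounts x y) (hx : ∀ j, 0 ≤ x j)
    (hy : ∀ j, 0 ≤ y j) {r : ℕ} (hr : r ≠ 0) :
    ∑' j, ENNReal.ofReal (x j ^ r) = ∑' j, ENNReal.ofReal (y j ^ r) := by
  have key : ∀ z : ℕ → ℝ, (∀ j, 0 ≤ z j) → ∑' j, ENNReal.ofReal (z j ^ r) =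
      ENNReal.ofReal r * ∫⁻ t in Set.Ioi (0 : ℝ), ({j | t ≤ z j}.encard : ENNReal) *
        ENNReal.ofReal (t ^ ((r : ℝ) - 1)) := by
    intro z hz
    have := lintegral_rpow_eq_lintegral_meas_le_mul Measure.count (f := z) (ae_of_all _ hz)
      (measurable_of_countable z).aemeasurable (p := r) (by positivity)
    simp only [Real.rpow_natCast, lintegral_count] at this
    rw [this]
    congr 1
    refine lintegral_congr fun t => ?_
    rw [Measure.count_apply (Set.to_countable _).measurableSet]
  rw [key x hx, key y hy]
  congr 1
  refine setLIntegral_congr_fun measurableSet_Ioi fun t ht => ?_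
  simp only [h t ht]

theorem SameCounts.hasSum_pow {x y : ℕ → ℝ} (h : SameCounts x y) (hx : ∀ j, 0 ≤ x j)
    (hy : ∀ j, 0 ≤ y j) {r : ℕ} (hr : r ≠ 0) {s : ℝ} (hs : HasSum (fun j => x j ^ r) s) :
    HasSum (fun j => y j ^ r) s := by
  have h1 : ∑' j, ENNReal.ofReal (y j ^ r) = ENNReal.ofReal s := by
    rw [← h.tsum_ofReal_pow hx hy hr,
      ← ENNReal.ofReal_tsum_of_nonneg (fun j => pow_nonneg (hx j) r) hs.summable, hs.tsum_eq]
  have h2 := ENNReal.hasSum_toReal (f := fun j => ENNReal.ofReal (y j ^ r))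
    (h1 ▸ ENNReal.ofReal_ne_top)
  have hs0 : 0 ≤ s := hs.nonneg fun j => pow_nonneg (hx j) r
  rw [← ENNReal.tsum_toReal_eq (fun _ => ENNReal.ofReal_ne_top), h1,
    ENNReal.toReal_ofReal hs0] at h2
  simpa only [ENNReal.toReal_ofReal (pow_nonneg (hy _) r)] using h2

theorem SameCounts.hasSum {x y : ℕ → ℝ} (h : SameCounts x y) (hx : ∀ j, 0 ≤ x j)
    (hy : ∀ j, 0 ≤ y j) {s : ℝ} (hs : HasSum x s) : HasSum y s := by
  have := h.hasSum_pow hx hy one_ne_zero (s := s) (by simpa using hs)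
  simpa using this

theorem SameCounts.ranked_eq {x y : ℕ → ℝ} (h : SameCounts x y) (hx : ∀ j, 0 ≤ x j)
    (hy : ∀ j, 0 ≤ y j) : ranked x = ranked y := by
  funext j
  unfold ranked
  congr 1
  ext t
  refine and_congr_right fun ht => ?_
  rcases ht.eq_or_lt with rfl | ht
  · have : ∀ z : ℕ → ℝ, (∀ j, 0 ≤ z j) → {j | 0 ≤ z j} = Set.univ := fun z hz =>
      Set.eq_univ_of_forall hz
    rw [this x hx, this y hy]
  · rw [h t ht]

theorem finite_le_of_summable {x : ℕ → ℝ} (hs : Summable x) {t : ℝ} (ht : 0 < t) :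
    {j | t ≤ x j}.Finite := by
  have := (hs.tendsto_cofinite_zero).eventually (gt_mem_nhds ht)
  simpa [Filter.eventually_cofinite] using this

theorem zero_mem_ranked {x : ℕ → ℝ} (hx : ∀ j, 0 ≤ x j) (j : ℕ) :
    (0 : ℝ) ∈ {t : ℝ | 0 ≤ t ∧ (j : ℕ∞) < {i | t ≤ x i}.encard} := by
  refine ⟨le_rfl, ?_⟩
  rw [show {i | 0 ≤ x i} = Set.univ from Set.eq_univ_of_forall hx, Set.encard_univ,
    ENat.card_eq_top_of_infinite]
  exact ENat.natCast_lt_top j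

theorem bddAbove_ranked {x : ℕ → ℝ} {B : ℝ} (hB : ∀ j, x j ≤ B) (j : ℕ) :
    BddAbove {t : ℝ | 0 ≤ t ∧ (j : ℕ∞) < {i | t ≤ x i}.encard} := by
  refine ⟨B, fun t ht => ?_⟩
  obtain ⟨i, hi⟩ := Set.encard_pos.1 (zero_le.trans_lt ht.2)
  exact le_trans hi (hB i)

theorem ranked_nonneg {x : ℕ → ℝ} (j : ℕ) : 0 ≤ ranked x j :=
  Real.sSup_nonneg fun _ ht => ht.1

/-- Summability leaves only finitely many terms above `t / 2`, so the supremum behaves like a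
maximum at positive levels. -/
theorem le_ranked_iff {x : ℕ → ℝ} (hx : ∀ j, 0 ≤ x j) (hs : Summable x) {t : ℝ} (ht : 0 < t)
    (j : ℕ) : t ≤ ranked x j ↔ (j : ℕ∞) < {i | t ≤ x i}.encard := by
  have hbdd := bddAbove_ranked (x := x) (fun i => hs.le_tsum i fun k _ => hx k) j
  refine ⟨fun h => ?_, fun h => le_csSup hbdd ⟨ht.le, h⟩⟩
  -- just below `t` the level sets do not change
  have hfin : {i | t / 2 ≤ x i}.Finite := finite_le_of_summable hs (by positivity)
  obtain ⟨u, hut, hu⟩ : ∃ u, u < t ∧ ∀ i, u ≤ x i → t ≤ x i := by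
    have hev : ∀ᶠ u in 𝓝[<] t, ∀ i ∈ {i | t / 2 ≤ x i}, u ≤ x i → t ≤ x i := by
      rw [Filter.eventually_all_finite hfin]
      intro i _
      by_cases hi : t ≤ x i
      · exact Eventually.of_forall fun _ _ => hi
      · filter_upwards [nhdsWithin_le_nhds (lt_mem_nhds (not_le.1 hi))] with u hu hu'
        exact absurd hu' (not_le.2 hu)
    obtain ⟨u, ⟨hu, hu2⟩, hu3⟩ := ((hev.and (nhdsWithin_le_nhds
      (lt_mem_nhds (half_lt_self ht)))).and self_mem_nhdsWithin).exists
    exact ⟨u, hu3, fun i hi => hu i (hu2.le.trans hi) hi⟩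
  obtain ⟨v, ⟨-, hv⟩, huv⟩ := exists_lt_of_lt_csSup ⟨0, zero_mem_ranked hx j⟩ (hut.trans_le h)
  exact hv.trans_le (Set.encard_le_encard fun i hi => hu i (huv.le.trans hi))

theorem sameCounts_ranked {x : ℕ → ℝ} (hx : ∀ j, 0 ≤ x j) (hs : Summable x) :
    SameCounts (ranked x) x := by
  intro t ht
  simp only [le_ranked_iff hx hs ht]
  obtain ⟨c, hc⟩ := (finite_le_of_summable hs ht).exists_encard_eq_coe
  rw [hc]
  have : {j : ℕ | (j : ℕ∞) < (c : ℕ∞)} = Set.Iio c := by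
    ext; simp
  rw [this, ← Set.Finite.cast_ncard_eq (Set.finite_Iio c), Set.ncard_Iio_nat]

theorem SameCounts.summable {x y : ℕ → ℝ} (h : SameCounts x y) (hx : ∀ j, 0 ≤ x j)
    (hy : ∀ j, 0 ≤ y j) (hs : Summable x) : Summable y :=
  (h.hasSum hx hy hs.hasSum).summable

theorem ranked_ranked {x : ℕ → ℝ} (hx : ∀ j, 0 ≤ x j) (hs : Summable x) :
    ranked (ranked x) = ranked x :=
  (sameCounts_ranked hx hs).ranked_eq ranked_nonneg hx

theorem lt_encard_iff {s : Set ℕ} {j : ℕ} :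
    (j : ℕ∞) < s.encard ↔ ∃ S : Finset ℕ, S.card = j + 1 ∧ (S : Set ℕ) ⊆ s := by
  rw [← ENat.add_one_le_iff (ENat.natCast_ne_top j)]
  constructor
  · intro h
    obtain ⟨S, hS, hc⟩ := Set.exists_subset_encard_eq (k := ((j + 1 : ℕ) : ℕ∞))
      (by exact_mod_cast h)
    have hfin : S.Finite := Set.finite_of_encard_eq_coe hc
    refine ⟨hfin.toFinset, ?_, by simpa using hS⟩
    rw [hfin.encard_eq_coe_toFinset_card] at hc
    exact_mod_cast hc
  · rintro ⟨S, hc, hS⟩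
    have := Set.encard_le_encard hS
    rw [Set.encard_coe_eq_coe_finsetCard, hc] at this
    exact_mod_cast this

/-- Exceeding `t` is witnessed by a rational level and a set of `j + 1` indices, for which there are
countably many choices. -/
theorem measurable_ranked {α : Type*} [MeasurableSpace α] {y : α → ℕ → ℝ} (hy : Measurable y)
    (h0 : ∀ a j, 0 ≤ y a j) {B : ℝ} (hB : ∀ a j, y a j ≤ B) :
    Measurable fun a => ranked (y a) := by
  refine measurable_pi_lambda _ fun j => measurable_of_Ioi fun t => ?_
  have : (fun a => ranked (y a) j) ⁻¹' Set.Ioi t = ⋃ q : ℚ, ⋃ S : Finset ℕ,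
      {a | (t < q ∧ (0 : ℝ) ≤ q ∧ S.card = j + 1) ∧ ∀ i ∈ S, (q : ℝ) ≤ y a i} := by
    ext a
    simp only [Set.mem_preimage, Set.mem_Ioi, Set.mem_iUnion, Set.mem_ofPred_eq]
    constructor
    · intro h
      obtain ⟨v, ⟨hv0, hv⟩, htv⟩ := exists_lt_of_lt_csSup ⟨0, zero_mem_ranked (h0 a) j⟩ h
      obtain ⟨S, hS, hSv⟩ := lt_encard_iff.1 hv
      rcases hv0.eq_or_lt with rfl | hv0
      · exact ⟨0, S, by simp [htv, hS], fun i hi => by simpa using hSv hi⟩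
      · obtain ⟨q, hq1, hq2⟩ := exists_rat_btwn (max_lt htv hv0)
        exact ⟨q, S, ⟨(le_max_left _ _).trans_lt hq1, ((le_max_right _ _).trans_lt hq1).le, hS⟩,
          fun i hi => hq2.le.trans (hSv hi)⟩
    · rintro ⟨q, S, ⟨htq, hq0, hS⟩, hqS⟩
      exact htq.trans_le (le_csSup (bddAbove_ranked (hB a) j)
        ⟨hq0, lt_encard_iff.2 ⟨S, hS, fun i hi => hqS i hi⟩⟩)
  rw [this]
  refine MeasurableSet.iUnion fun q => MeasurableSet.iUnion fun S => ?_
  have h1 : {a | ∀ i ∈ S, (q : ℝ) ≤ y a i} = ⋂ i ∈ S, {a | (q : ℝ) ≤ y a i} := by ext; simp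
  have h2 : MeasurableSet {a | ∀ i ∈ S, (q : ℝ) ≤ y a i} := by
    rw [h1]
    exact Finset.measurableSet_biInter _ fun i _ =>
      measurableSet_le measurable_const ((measurable_pi_apply i).comp hy)
  exact (MeasurableSet.const _).inter h2

end Ranked

/-! ### Clusters in order of appearance and their frequencies -/

section Clusters

/-- The number of clusters that appear in `{n + 1, …, i}`. -/
noncomputable def rank (π : Setoid ℕ) (n i : ℕ) : ℕ := {l | l < i ∧ IsFirstAfter π n l}.ncard

theorem finite_rank (π : Setoid ℕ) (n i : ℕ) : {l | l < i ∧ IsFirstAfter π n l}.Finite :=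
  (Set.finite_Iio i).subset fun _ hl => hl.1

theorem rank_lt {π : Setoid ℕ} {n i i' : ℕ} (hi : IsFirstAfter π n i) (h : i < i') :
    rank π n i < rank π n i' :=
  Set.ncard_lt_ncard ⟨fun _ hl => ⟨hl.1.trans h, hl.2⟩, fun hs => lt_irrefl i (hs ⟨h, hi⟩).1⟩
    (finite_rank π n i')

theorem rank_injOn {π : Setoid ℕ} {n i i' : ℕ} (hi : IsFirstAfter π n i)
    (hi' : IsFirstAfter π n i') (h : rank π n i = rank π n i') : i = i' := by
  rcases lt_trichotomy i i' with hlt | heq | hgt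
  · exact absurd h (rank_lt hi hlt).ne
  · exact heq
  · exact absurd h (rank_lt hi' hgt).ne'

theorem rank_zero (π : Setoid ℕ) (n : ℕ) : rank π n 0 = 0 := by
  simp [rank]

theorem rank_succ_of_isFirstAfter {π : Setoid ℕ} {n i : ℕ} (hi : IsFirstAfter π n i) :
    rank π n (i + 1) = rank π n i + 1 := by
  have : {l | l < i + 1 ∧ IsFirstAfter π n l} = insert i {l | l < i ∧ IsFirstAfter π n l} := by
    ext l
    simp only [Set.mem_insert_iff, Set.mem_ofPred_eq]
    constructor
    · rintro ⟨h1, h2⟩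
      rcases (Nat.lt_succ_iff.1 h1).eq_or_lt with h | h
      exacts [Or.inl h, Or.inr ⟨h, h2⟩]
    · rintro (rfl | ⟨h1, h2⟩)
      exacts [⟨Nat.lt_succ_self _, hi⟩, ⟨by omega, h2⟩]
  rw [rank, this, Set.ncard_insert_of_notMem (fun h => lt_irrefl i h.1) (finite_rank π n i)]
  rfl

theorem rank_succ_of_not {π : Setoid ℕ} {n i : ℕ} (hi : ¬ IsFirstAfter π n i) :
    rank π n (i + 1) = rank π n i := by
  have : {l | l < i + 1 ∧ IsFirstAfter π n l} = {l | l < i ∧ IsFirstAfter π n l} := by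
    ext l
    simp only [Set.mem_ofPred_eq]
    constructor
    · rintro ⟨h1, h2⟩
      rcases (Nat.lt_succ_iff.1 h1).eq_or_lt with h | h
      exacts [absurd (h ▸ h2) hi, ⟨h, h2⟩]
    · rintro ⟨h1, h2⟩
      exact ⟨by omega, h2⟩
  rw [rank, this]
  rfl

theorem cluster_rank {π : Setoid ℕ} {n i : ℕ} (hi : IsFirstAfter π n i) :
    cluster π n (rank π n i) = {m | π i m} := by
  ext m
  constructor
  · rintro ⟨i', hi', hr, hm⟩
    rwa [← rank_injOn hi' hi hr]
  · intro hm
    exact ⟨i, hi, rfl, hm⟩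

theorem cluster_eq_empty {π : Setoid ℕ} {n j : ℕ} (h : ∀ i, IsFirstAfter π n i → rank π n i ≠ j) :
    cluster π n j = ∅ := by
  refine Set.eq_empty_of_forall_notMem ?_
  rintro m ⟨i, hi, hr, -⟩
  exact h i hi hr

theorem freq_eq_zero_of_finite {C : Set ℕ} (hC : C.Finite) : freq C = 0 := by
  refine freq_eq_of_tendsto ?_
  refine squeeze_zero (fun N => relFreq_nonneg C N) (g := fun N : ℕ => (C.ncard : ℝ) / N)
    (fun N => ?_) (tendsto_const_div_atTop_nhds_zero_nat _)
  unfold relFreq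
  gcongr
  exact Set.inter_subset_left

theorem appearanceFreq_rank {π : Setoid ℕ} {n i : ℕ} (hi : IsFirstAfter π n i) :
    appearanceFreq π n (rank π n i) = freq {m | π i m} := by
  rw [appearanceFreq, cluster_rank hi]

theorem appearanceFreq_eq_zero {π : Setoid ℕ} {n j : ℕ}
    (h : ∀ i, IsFirstAfter π n i → rank π n i ≠ j) : appearanceFreq π n j = 0 := by
  rw [appearanceFreq, cluster_eq_empty h, freq_eq_zero_of_finite Set.finite_empty]

theorem appearanceFreq_nonneg (π : Setoid ℕ) (n j : ℕ) : 0 ≤ appearanceFreq π n j := freq_nonneg _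

theorem appearanceFreq_le_one (π : Setoid ℕ) (n j : ℕ) : appearanceFreq π n j ≤ 1 := freq_le_one _

theorem exists_isFirstAfter (π : Setoid ℕ) {n i : ℕ} (hi : n ≤ i) :
    ∃ j, IsFirstAfter π n j ∧ π j i ∧ j ≤ i := by
  induction i using Nat.strong_induction_on with
  | _ i ih =>
    by_cases h : IsFirstAfter π n i
    · exact ⟨i, h, π.refl i, le_rfl⟩
    · unfold IsFirstAfter at h
      push Not at h
      obtain ⟨l, hl, hli, hl'⟩ := h hi
      obtain ⟨j, hj, hjl, hle⟩ := ih l hli hl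
      exact ⟨j, hj, π.trans hjl hl', by omega⟩

theorem isFirstAfter_unique {π : Setoid ℕ} {n i j : ℕ} (hi : IsFirstAfter π n i)
    (hj : IsFirstAfter π n j) (h : π i j) : i = j := by
  rcases lt_trichotomy i j with hlt | heq | hgt
  · exact absurd h (hj.2 i hi.1 hlt)
  · exact heq
  · exact absurd (π.symm h) (hi.2 j hj.1 hgt)

theorem class_eq {π : Setoid ℕ} {i j : ℕ} (h : π i j) : {m | π i m} = {m | π j m} :=
  Set.ext fun _ => ⟨fun hm => π.trans (π.symm h) hm, fun hm => π.trans h hm⟩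

/-- The frequency of the cluster of `i` if `i` is its least element, and zero otherwise. -/
noncomputable def firstFreq (π : Setoid ℕ) (i : ℕ) : ℝ :=
  {i | IsFirstAfter π 0 i}.indicator (fun i => freq {m | π i m}) i

theorem firstFreq_of_isFirst {π : Setoid ℕ} {i : ℕ} (hi : IsFirstAfter π 0 i) :
    firstFreq π i = freq {m | π i m} :=
  Set.indicator_of_mem (show i ∈ {i | IsFirstAfter π 0 i} from hi) _

theorem firstFreq_of_not {π : Setoid ℕ} {i : ℕ} (hi : ¬ IsFirstAfter π 0 i) :
    firstFreq π i = 0 :=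
  Set.indicator_of_notMem (show i ∉ {i | IsFirstAfter π 0 i} from hi) _

theorem firstFreq_nonneg (π : Setoid ℕ) (i : ℕ) : 0 ≤ firstFreq π i :=
  Set.indicator_nonneg (fun _ _ => freq_nonneg _) _

/-- A cluster with positive frequency is infinite, so it appears after `n` as well, whatever `n` is.
Clusters that are missed are finite and contribute only zeros. -/
theorem sameCounts_appearanceFreq (π : Setoid ℕ) (n : ℕ) :
    SameCounts (appearanceFreq π n) (firstFreq π) := by
  intro t ht
  have h1 : {j | t ≤ appearanceFreq π n j} =
      rank π n '' {i | IsFirstAfter π n i ∧ t ≤ freq {m | π i m}} := by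
    ext j
    simp only [Set.mem_image, Set.mem_ofPred_eq]
    constructor
    · intro hj
      by_contra hcon
      push Not at hcon
      rw [appearanceFreq_eq_zero] at hj
      · exact absurd hj (not_le.2 ht)
      · intro i hi hr
        refine hcon i ⟨hi, ?_⟩ hr
        rwa [← appearanceFreq_rank hi, hr]
    · rintro ⟨i, ⟨hi, hti⟩, rfl⟩
      rwa [appearanceFreq_rank hi]
  -- `φ` passes from the first element of a cluster after `n` to its overall least element.
  choose! φ hφ hφr _ using fun i => exists_isFirstAfter π (zero_le (a := i))
  have h2 : {i | t ≤ firstFreq π i} = φ '' {i | IsFirstAfter π n i ∧ t ≤ freq {m | π i m}} := by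
    ext i
    simp only [Set.mem_image, Set.mem_ofPred_eq]
    constructor
    · intro hi
      have hif : IsFirstAfter π 0 i := by
        by_contra hcon
        rw [firstFreq_of_not hcon] at hi
        exact absurd hi (not_le.2 ht)
      rw [firstFreq_of_isFirst hif] at hi
      have hinf : {m | π i m}.Infinite := fun hfin => by
        rw [freq_eq_zero_of_finite hfin] at hi
        exact absurd hi (not_le.2 ht)
      obtain ⟨m, hm, hnm⟩ := hinf.exists_gt n
      obtain ⟨j, hj, hjm, -⟩ := exists_isFirstAfter π hnm.le
      have hij : π i j := π.trans hm (π.symm hjm)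
      exact ⟨j, ⟨hj, by rwa [← class_eq hij]⟩,
        isFirstAfter_unique (hφ j) hif (π.trans (hφr j) (π.symm hij))⟩
    · rintro ⟨j, ⟨_, htj⟩, rfl⟩
      rwa [firstFreq_of_isFirst (hφ j), class_eq (hφr j)]
  rw [h1, h2, Set.InjOn.encard_image fun i hi j hj h => rank_injOn hi.1 hj.1 h,
    Set.InjOn.encard_image]
  intro i hi j hj h
  have hij := hφr i
  rw [h] at hij
  exact isFirstAfter_unique hi.1 hj.1 (π.trans (π.symm hij) (hφr j))

/-- Distinct clusters are disjoint, so their relative frequencies sum to at most one at each `N`.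
Genuine limits are needed to add them up, since upper limits are only subadditive. -/
theorem Regular.sum_freq_le_one {π : Setoid ℕ} (hπ : Regular π) (S : Finset ℕ)
    (hS : ∀ i ∈ S, ∀ j ∈ S, i ≠ j → ¬ π i j) : ∑ i ∈ S, freq {m | π i m} ≤ 1 := by
  have hlim : Tendsto (fun N => ∑ i ∈ S, relFreq {m | π i m} N) atTop
      (𝓝 (∑ i ∈ S, freq {m | π i m})) := tendsto_finsetSum _ fun i _ => hπ i
  refine le_of_tendsto' hlim fun N => ?_
  simp only [relFreq_eq_sum]
  rw [← Finset.sum_div, Finset.sum_comm]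
  refine div_le_one_of_le₀ ?_ (Nat.cast_nonneg _)
  calc _ ≤ ∑ m ∈ Finset.range N, (1 : ℝ) := by
        refine Finset.sum_le_sum fun m _ => ?_
        by_cases h : ∃ i ∈ S, π i m
        · obtain ⟨i, hi, him⟩ := h
          rw [Finset.sum_eq_single_of_mem i hi]
          · exact Set.indicator_le_self' (fun _ _ => zero_le_one) _
          · intro j hj hji
            exact Set.indicator_of_notMem (s := {m | π j m})
              (fun hjm => hS j hj i hi hji (π.trans hjm (π.symm him))) _
        · rw [Finset.sum_eq_zero]
          · exact zero_le_one
          · intro i hi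
            exact Set.indicator_of_notMem (s := {m | π i m}) (fun him => h ⟨i, hi, him⟩) _
    _ = N := by simp

theorem Regular.sum_firstFreq_le_one {π : Setoid ℕ} (hπ : Regular π) (S : Finset ℕ) :
    ∑ i ∈ S, firstFreq π i ≤ 1 := by
  classical
  rw [← Finset.sum_filter_add_sum_filter_not S (IsFirstAfter π 0),
    Finset.sum_congr rfl fun i hi => firstFreq_of_isFirst (Finset.mem_filter.1 hi).2,
    Finset.sum_eq_zero (s := S.filter fun i => ¬ IsFirstAfter π 0 i)
      fun i hi => firstFreq_of_not (Finset.mem_filter.1 hi).2, add_zero]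
  exact hπ.sum_freq_le_one _ fun i hi j hj hij h => hij
    (isFirstAfter_unique (Finset.mem_filter.1 hi).2 (Finset.mem_filter.1 hj).2 h)

theorem Regular.summable_firstFreq {π : Setoid ℕ} (hπ : Regular π) : Summable (firstFreq π) :=
  summable_of_sum_le (firstFreq_nonneg π) hπ.sum_firstFreq_le_one

theorem Regular.summable_appearanceFreq {π : Setoid ℕ} (hπ : Regular π) (n : ℕ) :
    Summable (appearanceFreq π n) :=
  (sameCounts_appearanceFreq π n).symm.summable (firstFreq_nonneg π)
    (appearanceFreq_nonneg π n) hπ.summable_firstFreq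

theorem Regular.sameCounts_rankedFreq {π : Setoid ℕ} (hπ : Regular π) (n : ℕ) :
    SameCounts (rankedFreq π) (appearanceFreq π n) :=
  (sameCounts_ranked (appearanceFreq_nonneg π 0) (hπ.summable_appearanceFreq 0)).trans
    ((sameCounts_appearanceFreq π 0).trans (sameCounts_appearanceFreq π n).symm)

theorem Regular.sameCounts_rankedFreq_firstFreq {π : Setoid ℕ} (hπ : Regular π) :
    SameCounts (rankedFreq π) (firstFreq π) :=
  (hπ.sameCounts_rankedFreq 0).trans (sameCounts_appearanceFreq π 0)

theorem rankedFreq_nonneg (π : Setoid ℕ) (j : ℕ) : 0 ≤ rankedFreq π j := ranked_nonneg j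

theorem isFirstAfter_shift (π : Setoid ℕ) (n i : ℕ) :
    IsFirstAfter (shift n π) 0 i ↔ IsFirstAfter π n (i + n) := by
  constructor
  · rintro ⟨-, h⟩
    refine ⟨by omega, fun l hl hli h' => h (l - n) zero_le (by omega) ?_⟩
    change π (l - n + n) (i + n)
    rwa [Nat.sub_add_cancel hl]
  · rintro ⟨-, h⟩
    exact ⟨zero_le, fun l _ hli h' => h (l + n) (by omega) (by omega) h'⟩

theorem rank_shift (π : Setoid ℕ) (n i : ℕ) : rank (shift n π) 0 i = rank π n (i + n) := by
  have : {l | l < i + n ∧ IsFirstAfter π n l} =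
      (· + n) '' {l | l < i ∧ IsFirstAfter (shift n π) 0 l} := by
    ext l
    simp only [Set.mem_image, Set.mem_ofPred_eq, isFirstAfter_shift]
    constructor
    · rintro ⟨h1, h2⟩
      have := h2.1
      exact ⟨l - n, ⟨by omega, by rwa [Nat.sub_add_cancel this]⟩, by omega⟩
    · rintro ⟨l, ⟨h1, h2⟩, rfl⟩
      exact ⟨by omega, h2⟩
  rw [rank, rank, this, Set.ncard_image_of_injective _ (add_left_injective n)]

/-- The clusters correspond in the same order, and their limiting frequencies ignore the finitely
many dropped positions. -/
theorem Regular.appearanceFreq_shift {π : Setoid ℕ} (hπ : Regular π) (n j : ℕ) :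
    appearanceFreq (shift n π) 0 j = appearanceFreq π n j := by
  by_cases h : ∃ i, IsFirstAfter π n i ∧ rank π n i = j
  · obtain ⟨i, hi, rfl⟩ := h
    obtain ⟨i, rfl⟩ := Nat.exists_eq_add_of_le' hi.1
    rw [appearanceFreq_rank hi, ← rank_shift, appearanceFreq_rank ((isFirstAfter_shift π n i).2 hi)]
    exact freq_eq_of_tendsto ((tendsto_relFreq_shift {m | π (i + n) m} n).2 (hπ (i + n)))
  · push Not at h
    rw [appearanceFreq_eq_zero h, appearanceFreq_eq_zero]
    intro i hi
    rw [rank_shift]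
    exact h _ ((isFirstAfter_shift π n i).1 hi)

theorem measurable_rank (n i : ℕ) : Measurable fun π : Setoid ℕ => rank π n i := by
  classical
  have : (fun π : Setoid ℕ => rank π n i) =
      fun π => ∑ l ∈ Finset.range i, if IsFirstAfter π n l then 1 else 0 := by
    funext π
    rw [← Finset.card_filter, ← Set.ncard_coe_finset, rank]
    congr 1
    ext l
    simp
  rw [this]
  exact Finset.measurable_sum _ fun l _ =>
    Measurable.ite (measurableSet_isFirstAfter n l) measurable_const measurable_const

theorem measurableSet_mem_cluster (n j m : ℕ) :
    MeasurableSet {π : Setoid ℕ | m ∈ cluster π n j} := by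
  have : {π : Setoid ℕ | m ∈ cluster π n j} = ⋃ i, ({π : Setoid ℕ | IsFirstAfter π n i} ∩
      ((fun π : Setoid ℕ => rank π n i) ⁻¹' {j} ∩ {π : Setoid ℕ | π i m})) := by
    ext π
    rw [Set.mem_iUnion]
    rfl
  rw [this]
  exact MeasurableSet.iUnion fun i => (measurableSet_isFirstAfter n i).inter
    ((measurable_rank n i (measurableSet_singleton j)).inter (measurableSet_rel i m))

theorem measurable_appearanceFreq (n : ℕ) : Measurable fun π : Setoid ℕ => appearanceFreq π n :=
  measurable_pi_lambda _ fun j => measurable_freq fun m => measurableSet_mem_cluster n j m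

theorem measurable_rankedFreq : Measurable rankedFreq :=
  measurable_ranked (measurable_appearanceFreq 0) (fun π j => appearanceFreq_nonneg π 0 j)
    (fun π j => appearanceFreq_le_one π 0 j)

end Clusters

/-! ### Convergence of the finite restrictions of shifted partitions -/

section UpperEvents

variable {m : ℕ}

/-- The elements of the non-trivial clusters of `s`. -/
abbrev NontrivialElem (s : Setoid (Fin m)) : Type := {a : Fin m // ∃ b, b ≠ a ∧ s a b}

/-- The non-trivial clusters of `s`. -/
abbrev NontrivialClass (s : Setoid (Fin m)) : Type :=
  {q : Quotient s // ∃ a : NontrivialElem s, Quotient.mk s a.1 = q}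

/-- The cluster of an element of a non-trivial cluster. -/
def NontrivialElem.class {s : Setoid (Fin m)} (a : NontrivialElem s) : NontrivialClass s :=
  ⟨Quotient.mk s a.1, a, rfl⟩

noncomputable instance (s : Setoid (Fin m)) : Fintype (NontrivialElem s) := Fintype.ofFinite _

noncomputable instance (s : Setoid (Fin m)) : Fintype (NontrivialClass s) := Fintype.ofFinite _

open scoped Classical in
/-- The number of elements of a non-trivial cluster. -/
noncomputable def classCard {s : Setoid (Fin m)} (q : NontrivialClass s) : ℕ :=
  (Finset.univ.filter fun a : NontrivialElem s => a.class = q).card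

theorem classCard_ne_zero {s : Setoid (Fin m)} (q : NontrivialClass s) : classCard q ≠ 0 := by
  classical
  obtain ⟨q, a, ha⟩ := q
  exact (Finset.card_pos.2 ⟨a, by simp [NontrivialElem.class, ha]⟩).ne'

/-- The probability that a random partition with frequencies `x` is coarser than `s`. -/
noncomputable def coarserProb (s : Setoid (Fin m)) (x : ℕ → ℝ) : ℝ :=
  ∏ q : NontrivialClass s, (∑' j, ENNReal.ofReal (x j ^ classCard q)).toReal

theorem measurable_coarserProb (s : Setoid (Fin m)) : Measurable (coarserProb s) :=
  Finset.measurable_prod _ fun _ _ => (Measurable.tsum fun j =>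
    ((measurable_pi_apply j).pow_const _).ennreal_ofReal).ennreal_toReal

theorem SameCounts.coarserProb_eq {x y : ℕ → ℝ} (h : SameCounts x y) (hx : ∀ j, 0 ≤ x j)
    (hy : ∀ j, 0 ≤ y j) (s : Setoid (Fin m)) : coarserProb s x = coarserProb s y :=
  Finset.prod_congr rfl fun q _ => by rw [h.tsum_ofReal_pow hx hy (classCard_ne_zero q)]

/-- The restriction to `{n + 1, …, n + m}` is coarser than `s`. -/
def coarserEvent (s : Setoid (Fin m)) (n : ℕ) : Set (Setoid ℕ) :=
  {π | s ≤ restrict m (shift n π)}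

/-- All elements in `{n + 1, …, n + m}` of non-trivial clusters of `s` lie in clusters that have
appeared before. -/
def oldEvent (s : Setoid (Fin m)) (n : ℕ) : Set (Setoid ℕ) :=
  {π | ∀ a : NontrivialElem s, ∃ i < n, π i (a.1 + n)}

/-- The element `a` is in none of the clusters of `{1, …, n}`. -/
def newEvent (n a : ℕ) : Set (Setoid ℕ) := {π | ∀ i < n, ¬ π i a}

theorem measurableSet_newEvent (n a : ℕ) : MeasurableSet (newEvent n a) := by
  have : newEvent n a = ⋂ i, {π : Setoid ℕ | i < n → ¬ π i a} := by ext; simp [newEvent]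
  rw [this]
  exact MeasurableSet.iInter fun i => (MeasurableSet.const _).imp (measurableSet_rel i a).compl

theorem measurableSet_oldEvent (s : Setoid (Fin m)) (n : ℕ) : MeasurableSet (oldEvent s n) := by
  have : oldEvent s n = ⋂ a : NontrivialElem s, (newEvent n (a.1 + n))ᶜ := by
    ext π
    simp [oldEvent, newEvent]
  rw [this]
  exact MeasurableSet.iInter fun a => (measurableSet_newEvent _ _).compl

/-- A cluster that is new after `n` has its least element at or beyond `n`, so its frequency is a
tail term of the summable `firstFreq`. -/
theorem Regular.tendsto_newEvent {π : Setoid ℕ} (hπ : Regular π) (a : ℕ) :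
    Tendsto (fun n => (newEvent n (a + n)).indicator (fun π => freq {m | π (a + n) m}) π) atTop
      (𝓝 0) := by
  have h0 := hπ.summable_firstFreq.tendsto_atTop_zero
  rw [Metric.tendsto_atTop] at h0 ⊢
  intro ε hε
  obtain ⟨N, hN⟩ := h0 ε hε
  refine ⟨N, fun n hn => ?_⟩
  by_cases h : π ∈ newEvent n (a + n)
  · rw [Set.indicator_of_mem h]
    obtain ⟨j, hj, hja, -⟩ := exists_isFirstAfter π (zero_le (a := a + n))
    have hjn : n ≤ j := by
      by_contra hcon
      exact h j (not_le.1 hcon) hja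
    rw [← class_eq hja, ← firstFreq_of_isFirst hj]
    exact hN j (hn.trans hjn)
  · rw [Set.indicator_of_notMem h, dist_self]
    exact hε

variable {P : Measure (Setoid ℕ)} [IsProbabilityMeasure P]

theorem measureReal_newEvent_inter (hP : IsSwapInvariant P) {n a b : ℕ} (hab : a < b) :
    P.real (newEvent n a ∩ {π | π a b}) = ∫ π in newEvent n a, freq {m | π a m} ∂P := by
  have hE : SwapStable (a + n + 1) (newEvent n a) := by
    refine swapStable_of_restrict fun π π' h hπ i hi => ?_
    rw [← h i a (by omega) (by omega)]
    exact hπ i hi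
  have hE' : SwapStable (a + 1) (newEvent n a) := by
    by_cases hn : n ≤ a
    · refine swapStable_of_restrict fun π π' h hπ i hi => ?_
      rw [← h i a (by omega) (by omega)]
      exact hπ i hi
    · have : newEvent n a = ∅ := Set.eq_empty_of_forall_notMem fun π hπ =>
        hπ a (not_le.1 hn) (π.refl a)
      rw [this]
      exact fun _ _ _ => Iff.rfl
  have := measureReal_posEvent hP (measurableSet_newEvent n a) hE' (ι := Unit) (i := fun _ => a)
    (b := fun _ => b) (fun _ => Nat.lt_succ_self a) (Function.injective_of_subsingleton _)
    (fun _ => hab)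
  simpa [posEvent] using this

theorem tendsto_measureReal_newEvent_inter (hP : IsSwapInvariant P) {a b : ℕ} (hab : a < b) :
    Tendsto (fun n => P.real (newEvent n (a + n) ∩ {π | π (a + n) (b + n)})) atTop (𝓝 0) := by
  have h : ∀ n, P.real (newEvent n (a + n) ∩ {π | π (a + n) (b + n)}) =
      ∫ π, (newEvent n (a + n)).indicator (fun π => freq {m | π (a + n) m}) π ∂P := fun n => by
    rw [measureReal_newEvent_inter hP (by omega), integral_indicator (measurableSet_newEvent _ _)]
  simp only [h]
  rw [← integral_zero (Setoid ℕ) ℝ (μ := P)]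
  refine tendsto_integral_of_dominated_convergence (fun _ => 1) (fun n => ?_)
    (integrable_const _) (fun n => ae_of_all _ fun π => ?_) ?_
  · exact ((measurable_freq_class (a + n)).indicator
      (measurableSet_newEvent _ _)).aestronglyMeasurable
  · rw [Real.norm_of_nonneg (Set.indicator_nonneg (fun _ _ => freq_nonneg _) _)]
    exact Set.indicator_le_self' (fun _ _ => freq_nonneg _) _ |>.trans (freq_le_one _)
  · filter_upwards [ae_regular hP] with π hπ
    exact hπ.tendsto_newEvent a

/-- If some element of a non-trivial cluster of `s` is not old, then it and a companion lie in one
new cluster. The smaller of the two is new and is joined by the larger, and there are finitely many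
such pairs. -/
theorem tendsto_coarserEvent_diff (hP : IsSwapInvariant P) (s : Setoid (Fin m)) :
    Tendsto (fun n => P.real (coarserEvent s n \ oldEvent s n)) atTop (𝓝 0) := by
  have hlim : Tendsto (fun n => ∑ p ∈ Finset.univ.filter (fun p : Fin m × Fin m => p.1 < p.2),
      P.real (newEvent n (p.1 + n) ∩ {π | π (p.1 + n) (p.2 + n)})) atTop (𝓝 0) := by
    rw [← Finset.sum_const_zero (s := Finset.univ.filter (fun p : Fin m × Fin m => p.1 < p.2))]
    exact tendsto_finsetSum _ fun p hp =>
      tendsto_measureReal_newEvent_inter hP (Fin.lt_def.1 (Finset.mem_filter.1 hp).2)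
  refine squeeze_zero (fun _ => measureReal_nonneg) (fun n => ?_) hlim
  refine (measureReal_mono ?_ (measure_ne_top _ _)).trans (measureReal_biUnion_finset_le _ _)
  rintro π ⟨h1, h2⟩
  simp only [oldEvent, Set.mem_ofPred_eq] at h2
  push Not at h2
  obtain ⟨⟨a, b, hba, hab⟩, ha⟩ := h2
  have hπ : π (a + n) (b + n) := h1 hab
  rw [Set.mem_iUnion₂]
  rcases lt_or_gt_of_ne hba with hlt | hlt
  · exact ⟨(b, a), by simpa using hlt, fun i hi hib => ha i hi (π.trans hib (π.symm hπ)), π.symm hπ⟩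
  · exact ⟨(a, b), by simpa using hlt, ha, hπ⟩

/-- Split according to the map `u` that sends each non-trivial cluster of `s` to the least element
of the old cluster containing it. Different clusters of `s` may go to the same place, so `u` ranges
over all maps, and the sum of the products given by the moment formula factorises. -/
theorem measureReal_coarserEvent_inter (hP : IsSwapInvariant P) (s : Setoid (Fin m)) (n : ℕ) :
    P.real (coarserEvent s n ∩ oldEvent s n) =
      ∫ π, ∏ q : NontrivialClass s, ∑ i ∈ Finset.range n, firstFreq π i ^ classCard q ∂P := by
  classical
  let E : (NontrivialClass s → ℕ) → Set (Setoid ℕ) := fun u => {π | ∀ q, IsFirstAfter π 0 (u q)}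
  let G : (NontrivialClass s → ℕ) → Set (Setoid ℕ) := fun u =>
    posEvent (E u) (fun a : NontrivialElem s => u a.class) (fun a => a.1 + n)
  have hE : ∀ u, MeasurableSet (E u) := fun u => by
    have : E u = ⋂ q, {π : Setoid ℕ | IsFirstAfter π 0 (u q)} := by ext; simp [E]
    rw [this]
    exact MeasurableSet.iInter fun q => measurableSet_isFirstAfter _ _
  have hunion : coarserEvent s n ∩ oldEvent s n =
      ⋃ u ∈ Fintype.piFinset fun _ : NontrivialClass s => Finset.range n, G u := by
    ext π
    rw [Set.mem_iUnion₂]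
    constructor
    · rintro ⟨h1, h2⟩
      choose a ha using fun q : NontrivialClass s => q.2
      choose φ hφ hφr hφle using fun i => exists_isFirstAfter π (zero_le (a := i))
      refine ⟨fun q => φ ((a q).1 + n), ?_, fun q => hφ _, fun b => ?_⟩
      · rw [Fintype.mem_piFinset]
        intro q
        obtain ⟨i, hi, hia⟩ := h2 (a q)
        rw [Finset.mem_range]
        refine lt_of_le_of_lt ?_ hi
        rw [← isFirstAfter_unique (hφ i) (hφ ((a q).1 + n))
          (π.trans (hφr i) (π.trans hia (π.symm (hφr _))))]
        exact hφle i
      · have hsb : s (a b.class).1 b.1 := Quotient.exact (ha b.class)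
        exact π.trans (hφr _) (h1 hsb)
    · rintro ⟨u, hu, -, hu2⟩
      rw [Fintype.mem_piFinset] at hu
      refine ⟨fun a b hab => ?_, fun a => ⟨_, Finset.mem_range.1 (hu a.class), hu2 a⟩⟩
      change π (a + n) (b + n)
      by_cases h : b = a
      · rw [h]
      · have h3 := hu2 ⟨a, b, h, hab⟩
        have h4 := hu2 ⟨b, a, Ne.symm h, s.symm hab⟩
        have h5 : NontrivialElem.class (⟨a, b, h, hab⟩ : NontrivialElem s) =
            NontrivialElem.class ⟨b, a, Ne.symm h, s.symm hab⟩ :=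
          Subtype.ext (Quotient.sound hab)
        simp only [h5] at h3
        exact π.trans (π.symm h3) h4
  have hdisj : ∀ u u', u ≠ u' → Disjoint (G u) (G u') := by
    intro u u' huu
    refine Set.disjoint_left.2 ?_
    rintro π ⟨h1, h2⟩ ⟨h1', h2'⟩
    refine huu (funext fun q => ?_)
    obtain ⟨a, ha⟩ := q.2
    have haq : a.class = q := Subtype.ext ha
    have h3 := h2 a
    have h4 := h2' a
    simp only [haq] at h3 h4
    exact isFirstAfter_unique (h1 q) (h1' q) (π.trans h3 (π.symm h4))
  rw [hunion, measureReal_biUnion_finset (fun u _ u' _ huu => hdisj u u' huu)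
    (fun u _ => measurableSet_posEvent (hE u) _ _)]
  have hterm : ∀ u ∈ Fintype.piFinset (fun _ : NontrivialClass s => Finset.range n),
      P.real (G u) = ∫ π, ∏ q, firstFreq π (u q) ^ classCard q ∂P := by
    intro u hu
    rw [Fintype.mem_piFinset] at hu
    have hun : ∀ q, u q < n := fun q => Finset.mem_range.1 (hu q)
    rw [measureReal_posEvent hP (hE u) (n := n) ?_ (fun a => hun _) ?_ (fun a => by omega),
      ← integral_indicator (hE u)]
    · refine integral_congr_ae (ae_of_all _ fun π => ?_)
      by_cases hπ : π ∈ E u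
      · simp only [Set.indicator_of_mem hπ]
        -- Grouping the elements by their clusters in `s` turns the product of frequencies into
        -- powers.
        rw [← Finset.prod_fiberwise (g := fun a : NontrivialElem s => a.class) Finset.univ]
        refine Finset.prod_congr rfl fun q _ => ?_
        rw [classCard, ← Finset.prod_const]
        refine Finset.prod_congr rfl fun a ha => ?_
        rw [(Finset.mem_filter.1 ha).2, firstFreq_of_isFirst (hπ q)]
      · simp only [Set.indicator_of_notMem hπ]
        simp only [E, Set.mem_ofPred_eq] at hπ
        push Not at hπ
        obtain ⟨q, hq⟩ := hπ
        symm
        refine Finset.prod_eq_zero (Finset.mem_univ q) ?_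
        rw [firstFreq_of_not hq, zero_pow (classCard_ne_zero q)]
    · refine swapStable_of_restrict fun π π' h hπ q => ⟨zero_le, fun l _ hl hlq => ?_⟩
      exact (hπ q).2 l zero_le hl ((h l (u q) (hl.trans (hun q)) (hun q)).2 hlq)
    · intro a b hab
      exact Subtype.ext (Fin.ext (by simpa using hab))
  rw [Finset.sum_congr rfl hterm, ← integral_finsetSum]
  · refine integral_congr_ae (ae_of_all _ fun π => ?_)
    simp only
    rw [Finset.prod_univ_sum]
  · intro u hu
    refine Integrable.of_bound (C := 1) ?_ (ae_of_all _ fun π => ?_)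
    · refine (Finset.measurable_prod _ fun q _ => Measurable.pow_const ?_ _).aestronglyMeasurable
      exact (measurable_freq_class (u q)).indicator (measurableSet_isFirstAfter 0 (u q))
    · have h0 : ∀ q, 0 ≤ firstFreq π (u q) ^ classCard q := fun q =>
        pow_nonneg (firstFreq_nonneg _ _) _
      rw [Real.norm_of_nonneg (Finset.prod_nonneg fun q _ => h0 q)]
      refine Finset.prod_le_one (fun q _ => h0 q) fun q _ => pow_le_one₀ (firstFreq_nonneg _ _) ?_
      exact Set.indicator_le_self' (fun _ _ => freq_nonneg _) _ |>.trans (freq_le_one _)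

theorem Regular.sum_firstFreq_pow_le_one {π : Setoid ℕ} (hπ : Regular π) (n : ℕ) {r : ℕ}
    (hr : r ≠ 0) : ∑ i ∈ Finset.range n, firstFreq π i ^ r ≤ 1 := by
  refine le_trans (Finset.sum_le_sum fun i _ => ?_) (hπ.sum_firstFreq_le_one (Finset.range n))
  refine pow_le_of_le_one (firstFreq_nonneg _ _) ?_ hr
  simpa using hπ.sum_firstFreq_le_one {i}

theorem tendsto_sum_pow {x : ℕ → ℝ} (hx : ∀ j, 0 ≤ x j) {r : ℕ}
    (h : ∀ n, ∑ i ∈ Finset.range n, x i ^ r ≤ 1) :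
    Tendsto (fun n => ∑ i ∈ Finset.range n, x i ^ r) atTop
      (𝓝 (∑' j, ENNReal.ofReal (x j ^ r)).toReal) := by
  have hs : Summable fun i => x i ^ r :=
    summable_of_sum_range_le (fun i => pow_nonneg (hx i) r) h
  rw [← ENNReal.ofReal_tsum_of_nonneg (fun i => pow_nonneg (hx i) r) hs,
    ENNReal.toReal_ofReal (tsum_nonneg fun i => pow_nonneg (hx i) r)]
  exact hs.hasSum.tendsto_sum_nat

/-- Singletons of `s` impose no condition and are left out of the product. This matters: first
powers of the frequencies need not sum to one, whereas all clusters counted here have at least two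
elements. -/
theorem tendsto_measureReal_coarserEvent (hP : IsSwapInvariant P) (s : Setoid (Fin m)) :
    Tendsto (fun n => P.real (coarserEvent s n)) atTop
      (𝓝 (∫ π, coarserProb s (rankedFreq π) ∂P)) := by
  have h1 : ∀ n, P.real (coarserEvent s n) = P.real (coarserEvent s n ∩ oldEvent s n) +
      P.real (coarserEvent s n \ oldEvent s n) := fun n =>
    (measureReal_inter_add_sdiff (measurableSet_oldEvent s n)).symm
  simp only [h1]
  rw [← add_zero (∫ π, coarserProb s (rankedFreq π) ∂P)]
  refine Tendsto.add ?_ (tendsto_coarserEvent_diff hP s)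
  simp only [measureReal_coarserEvent_inter hP]
  refine tendsto_integral_of_dominated_convergence (fun _ => 1) (fun n => ?_)
    (integrable_const _) (fun n => ?_) ?_
  · refine (Finset.measurable_prod _ fun q _ => Finset.measurable_sum _ fun i _ =>
      Measurable.pow_const ?_ _).aestronglyMeasurable
    exact (measurable_freq_class i).indicator (measurableSet_isFirstAfter 0 i)
  · filter_upwards [ae_regular hP] with π hπ
    have h0 : ∀ q : NontrivialClass s, 0 ≤ ∑ i ∈ Finset.range n, firstFreq π i ^ classCard q :=
      fun q => Finset.sum_nonneg fun i _ => pow_nonneg (firstFreq_nonneg _ _) _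
    rw [Real.norm_of_nonneg (Finset.prod_nonneg fun q _ => h0 q)]
    exact Finset.prod_le_one (fun q _ => h0 q) fun q _ =>
      hπ.sum_firstFreq_pow_le_one n (classCard_ne_zero q)
  · filter_upwards [ae_regular hP] with π hπ
    rw [hπ.sameCounts_rankedFreq_firstFreq.coarserProb_eq (rankedFreq_nonneg π)
      (firstFreq_nonneg π)]
    exact tendsto_finsetProd _ fun q _ => tendsto_sum_pow (firstFreq_nonneg π) fun n =>
      hπ.sum_firstFreq_pow_le_one n (classCard_ne_zero q)

theorem measureReal_coarserEvent_eq_sum (s : Setoid (Fin m)) (n : ℕ) [Fintype (Setoid (Fin m))]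
    [DecidablePred fun t : Setoid (Fin m) => s ≤ t] :
    P.real (coarserEvent s n) = ∑ t ∈ Finset.univ.filter (fun t : Setoid (Fin m) => s ≤ t),
      P.real {π | restrict m (shift n π) = t} := by
  have h := measure_restrict_mem (P.map (shift n)) m
    (Finset.univ.filter (fun t : Setoid (Fin m) => s ≤ t))
  rw [Measure.map_apply (measurable_shift n)] at h
  · have h' : coarserEvent s n = shift n ⁻¹' {π : Setoid ℕ | restrict m π ∈
        Finset.univ.filter (fun t : Setoid (Fin m) => s ≤ t)} := by
      ext π; simp [coarserEvent]
    rw [Measure.real, h', h, ENNReal.toReal_sum]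
    · refine Finset.sum_congr rfl fun t _ => ?_
      rw [Measure.map_apply (measurable_shift n) (measurableSet_restrict m t)]
      rfl
    · intro t _
      rw [Measure.map_apply (measurable_shift n) (measurableSet_restrict m t)]
      exact measure_ne_top _ _
  · exact measurableSet_restrict_mem m
      {t | t ∈ Finset.univ.filter (fun t : Setoid (Fin m) => s ≤ t)}

/-- Both laws give the same limits for coarsening events, and for the shift invariant `Q` the
sequence is constant. Single values are recovered by subtracting the strictly coarser ones. -/
theorem tendsto_measureReal_restrict_shift (hP : IsSwapInvariant P)
    {Q : Measure (Setoid ℕ)} [IsProbabilityMeasure Q] (hQ : IsExchangeable Q id)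
    (hPQ : P.map rankedFreq = Q.map rankedFreq) (s : Setoid (Fin m)) :
    Tendsto (fun n => P.real {π | restrict m (shift n π) = s}) atTop
      (𝓝 (Q.real {π | restrict m π = s})) := by
  classical
  have : Fintype (Setoid (Fin m)) := Fintype.ofFinite _
  have hint : ∀ s : Setoid (Fin m), ∫ π, coarserProb s (rankedFreq π) ∂P =
      ∫ π, coarserProb s (rankedFreq π) ∂Q := by
    intro s
    rw [← integral_map (φ := rankedFreq) measurable_rankedFreq.aemeasurable
      (measurable_coarserProb s).aestronglyMeasurable, hPQ,
      integral_map measurable_rankedFreq.aemeasurable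
      (measurable_coarserProb s).aestronglyMeasurable]
  have hQn : ∀ (n : ℕ) (t : Setoid (Fin m)), Q.real {π | restrict m (shift n π) = t} =
      Q.real {π | restrict m π = t} := by
    intro n t
    conv_rhs => rw [← map_shift_eq_of_isExchangeable hQ n,
      map_measureReal_apply (measurable_shift n) (measurableSet_restrict m t)]
    rfl
  have hlim : ∀ s : Setoid (Fin m), Tendsto (fun n =>
      ∑ t ∈ Finset.univ.filter (fun t : Setoid (Fin m) => s ≤ t),
        P.real {π | restrict m (shift n π) = t}) atTop
      (𝓝 (∑ t ∈ Finset.univ.filter (fun t : Setoid (Fin m) => s ≤ t),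
        Q.real {π | restrict m π = t})) := by
    intro s
    have h1 := tendsto_measureReal_coarserEvent hP s
    have h2 := tendsto_measureReal_coarserEvent hQ.isSwapInvariant s
    simp only [measureReal_coarserEvent_eq_sum, hQn] at h1 h2
    rw [hint s, ← tendsto_nhds_unique tendsto_const_nhds h2] at h1
    exact h1
  -- Induction from coarser to finer partitions: the terms strictly above `s` are already known to
  -- converge.
  induction s using WellFoundedGT.induction with
  | ind s ih =>
    have hsplit : ∀ f : Setoid (Fin m) → ℝ,
        f s = ∑ t ∈ Finset.univ.filter (fun t : Setoid (Fin m) => s ≤ t), f t -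
          ∑ t ∈ Finset.univ.filter (fun t : Setoid (Fin m) => s < t), f t := by
      intro f
      have : Finset.univ.filter (fun t : Setoid (Fin m) => s ≤ t) =
          insert s (Finset.univ.filter (fun t : Setoid (Fin m) => s < t)) := by
        ext t
        simp only [Finset.mem_filter, Finset.mem_univ, true_and, Finset.mem_insert]
        rw [le_iff_eq_or_lt, eq_comm]
      rw [this, Finset.sum_insert (by simp)]
      ring
    rw [hsplit fun t => Q.real {π | restrict m π = t}]
    refine Tendsto.congr
      (fun n => (hsplit fun t => P.real {π | restrict m (shift n π) = t}).symm) ?_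
    exact (hlim s).sub (tendsto_finsetSum _ fun t ht => ih t (Finset.mem_filter.1 ht).2)

theorem eq_of_map_rankedFreq_eq {Q R : Measure (Setoid ℕ)} [IsProbabilityMeasure Q]
    [IsProbabilityMeasure R] (hQ : IsExchangeable Q id) (hR : IsExchangeable R id)
    (h : Q.map rankedFreq = R.map rankedFreq) : Q = R := by
  refine ext_of_restrict 0 fun m _ s => ?_
  rw [← measureReal_eq_measureReal_iff]
  refine tendsto_nhds_unique ?_ (tendsto_measureReal_restrict_shift hQ.isSwapInvariant hR h s)
  refine tendsto_const_nhds.congr fun n => ?_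
  conv_lhs => rw [← map_shift_eq_of_isExchangeable hQ n,
    map_measureReal_apply (measurable_shift n) (measurableSet_restrict m s)]
  rfl

end UpperEvents

/-! ### The paintbox partition of a sequence of frequencies -/

section Paintbox

/-- The uniform distribution on the unit interval. -/
noncomputable def unif : Measure ℝ := volume.restrict (Set.Ico 0 1)

instance : IsProbabilityMeasure unif := ⟨by simp [unif]⟩

/-- The law of a sequence of independent uniform random variables. -/
noncomputable def unifSeq : Measure (ℕ → ℝ) := Measure.infinitePi fun _ => unif

instance : IsProbabilityMeasure unifSeq := by unfold unifSeq; infer_instance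

/-- The sequence `x` consists of non-negative numbers with sum at most one. -/
def IsSubProb (x : ℕ → ℝ) : Prop := (∀ j, 0 ≤ x j) ∧ ∀ n, ∑ j ∈ Finset.range n, x j ≤ 1

theorem measurableSet_isSubProb : MeasurableSet {x : ℕ → ℝ | IsSubProb x} := by
  have : {x : ℕ → ℝ | IsSubProb x} = (⋂ j, {x : ℕ → ℝ | 0 ≤ x j}) ∩
      ⋂ n, {x : ℕ → ℝ | ∑ j ∈ Finset.range n, x j ≤ 1} := by ext; simp [IsSubProb]
  rw [this]
  refine (MeasurableSet.iInter fun j => measurableSet_le measurable_const (measurable_pi_apply j)).inter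
    (MeasurableSet.iInter fun n => measurableSet_le
      (Finset.measurable_sum _ fun j _ => measurable_pi_apply j) measurable_const)

/-- The number `t` lies in the `k`-th one of the neighbouring intervals with lengths `x 0, x 1, …`. -/
def InInterval (x : ℕ → ℝ) (t : ℝ) (k : ℕ) : Prop :=
  ∑ j ∈ Finset.range k, x j ≤ t ∧ t < ∑ j ∈ Finset.range (k + 1), x j

open scoped Classical in
/-- The number of the interval that contains `t`, among neighbouring intervals with lengths
`x 0, x 1, …`. -/
noncomputable def colour (x : ℕ → ℝ) (t : ℝ) : Option ℕ :=
  if h : ∃ k, InInterval x t k then some (Nat.find h) else none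

theorem colour_eq_some_iff {x : ℕ → ℝ} {t : ℝ} {k : ℕ} :
    colour x t = some k ↔ InInterval x t k ∧ ∀ l < k, ¬ InInterval x t l := by
  classical
  unfold colour
  split_ifs with h
  · rw [Option.some_inj, Nat.find_eq_iff]
  · simp only [false_iff, not_and]
    exact fun hk => absurd ⟨k, hk⟩ h

/-- For nonnegative lengths the intervals are disjoint. The choice of the smallest index in `colour`
only serves to make it measurable in `x` without a sign condition. -/
theorem colour_eq_some_iff_of_nonneg {x : ℕ → ℝ} (hx : ∀ j, 0 ≤ x j) {t : ℝ} {k : ℕ} :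
    colour x t = some k ↔ InInterval x t k := by
  rw [colour_eq_some_iff, and_iff_left_iff_imp]
  intro hk l hl hlt
  have : ∑ j ∈ Finset.range (l + 1), x j ≤ ∑ j ∈ Finset.range k, x j :=
    Finset.sum_le_sum_of_subset_of_nonneg (Finset.range_subset_range.2 hl) fun j _ _ => hx j
  linarith [hk.1, hlt.2]

theorem measurableSet_colour (k : ℕ) :
    MeasurableSet {z : (ℕ → ℝ) × ℝ | colour z.1 z.2 = some k} := by
  have h : ∀ k, MeasurableSet {z : (ℕ → ℝ) × ℝ | InInterval z.1 z.2 k} := fun k => by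
    have hs : ∀ k, Measurable fun z : (ℕ → ℝ) × ℝ => ∑ j ∈ Finset.range k, z.1 j := fun k =>
      Finset.measurable_sum _ fun j _ => (measurable_pi_apply j).comp measurable_fst
    exact (measurableSet_le (hs k) measurable_snd).inter
      (measurableSet_lt measurable_snd (hs (k + 1)))
  have : {z : (ℕ → ℝ) × ℝ | colour z.1 z.2 = some k} = {z | InInterval z.1 z.2 k} ∩
      ⋂ l, {z | l < k → ¬ InInterval z.1 z.2 l} := by
    ext z
    simp only [colour_eq_some_iff, Set.mem_inter_iff, Set.mem_ofPred_eq, Set.mem_iInter]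
  rw [this]
  exact (h k).inter (MeasurableSet.iInter fun l => (MeasurableSet.const _).imp (h l).compl)

theorem measurableSet_colour_right (x : ℕ → ℝ) (k : ℕ) :
    MeasurableSet {t : ℝ | colour x t = some k} :=
  measurable_prodMk_left (x := x) (measurableSet_colour k)

theorem unif_colour {x : ℕ → ℝ} (hx : IsSubProb x) (k : ℕ) :
    unif.real {t : ℝ | colour x t = some k} = x k := by
  have h : {t : ℝ | colour x t = some k} =
      Set.Ico (∑ j ∈ Finset.range k, x j) (∑ j ∈ Finset.range (k + 1), x j) := by
    ext t
    exact colour_eq_some_iff_of_nonneg hx.1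
  have h0 : 0 ≤ ∑ j ∈ Finset.range k, x j := Finset.sum_nonneg fun j _ => hx.1 j
  have h1 := hx.2 (k + 1)
  rw [unif, measureReal_restrict_apply (measurableSet_colour_right x k), h,
    Set.inter_eq_left.2 (Set.Ico_subset_Ico h0 h1), Measure.real, Real.volume_Ico,
    Finset.sum_range_succ, add_sub_cancel_left, ENNReal.toReal_ofReal (hx.1 k)]

/-- The partition into the sets of positions with the same colour; positions without a colour are
singletons. -/
def paint (c : ℕ → Option ℕ) : Setoid ℕ where
  r i j := i = j ∨ (c i = c j ∧ c i ≠ none)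
  iseqv := by
    refine ⟨fun i => Or.inl rfl, ?_, ?_⟩
    · rintro i j (rfl | ⟨h, h'⟩)
      exacts [Or.inl rfl, Or.inr ⟨h.symm, h ▸ h'⟩]
    · rintro i j k (rfl | ⟨h, h'⟩) (rfl | ⟨g, g'⟩)
      exacts [Or.inl rfl, Or.inr ⟨g, g'⟩, Or.inr ⟨h, h'⟩, Or.inr ⟨h.trans g, h'⟩]

theorem paint_rel {c : ℕ → Option ℕ} {i j : ℕ} :
    paint c i j ↔ i = j ∨ (c i = c j ∧ c i ≠ none) := Iff.rfl

/-- The paintbox partition. -/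
noncomputable def paintbox (z : (ℕ → ℝ) × (ℕ → ℝ)) : Setoid ℕ := paint fun i => colour z.1 (z.2 i)

theorem measurableSet_colour_coord (k i : ℕ) :
    MeasurableSet {z : (ℕ → ℝ) × (ℕ → ℝ) | colour z.1 (z.2 i) = some k} := by
  have h : Measurable fun z : (ℕ → ℝ) × (ℕ → ℝ) => (z.1, z.2 i) := by fun_prop
  exact h (measurableSet_colour k)

theorem measurable_paintbox : Measurable paintbox := by
  refine measurable_of_rel fun i j => ?_
  have : {z | paintbox z i j} = {_z | i = j} ∪
      ⋃ k, ({z : (ℕ → ℝ) × (ℕ → ℝ) | colour z.1 (z.2 i) = some k} ∩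
        {z | colour z.1 (z.2 j) = some k}) := by
    ext z
    simp only [Set.mem_union, Set.mem_ofPred_eq, Set.mem_iUnion, Set.mem_inter_iff]
    refine or_congr Iff.rfl ⟨fun ⟨h1, h2⟩ => ?_, fun ⟨k, h1, h2⟩ => ?_⟩
    · obtain ⟨k, hk⟩ := Option.ne_none_iff_exists'.1 h2
      exact ⟨k, hk, Eq.trans (Eq.symm h1) hk⟩
    · exact ⟨h1.trans h2.symm, fun h => by simp [h1] at h⟩
  rw [this]
  exact (MeasurableSet.const _).union (MeasurableSet.iUnion fun k =>
    (measurableSet_colour_coord k i).inter (measurableSet_colour_coord k j))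

theorem map_unifSeq_comp {f : ℕ → ℕ} (hf : Function.Injective f) :
    unifSeq.map (fun u i => u (f i)) = unifSeq :=
  Measure.map_infinitePi_infinitePi_of_inj (P := fun _ : ℕ => unif) hf

/-- Permuting positions permutes independent, identically distributed sampling variables. -/
theorem isExchangeable_paintbox (L : Measure (ℕ → ℝ)) [IsProbabilityMeasure L] :
    IsExchangeable ((L.prod unifSeq).map paintbox) id := by
  rw [isExchangeable_map measurable_paintbox]
  intro n σ s
  let τ : Equiv.Perm ℕ := σ.viaFintypeEmbedding Fin.valEmbedding
  have hτ : ∀ i : Fin n, τ i = σ i := fun i =>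
    Equiv.Perm.viaFintypeEmbedding_apply_image σ Fin.valEmbedding i
  have hmp : MeasurePreserving (fun z : (ℕ → ℝ) × (ℕ → ℝ) => (z.1, fun i => z.2 (τ i)))
      (L.prod unifSeq) (L.prod unifSeq) :=
    (MeasurePreserving.id L).prod ⟨by fun_prop, map_unifSeq_comp τ.injective⟩
  refine (hmp.measure_preimage
    (measurable_paintbox (measurableSet_restrict n (s.comap σ))).nullMeasurableSet).symm.trans ?_
  congr 1
  ext z
  have hrel : ∀ i j : Fin n, paintbox (z.1, fun i => z.2 (τ i)) i j ↔
      paintbox z (σ i) (σ j) := by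
    intro i j
    have h := @Fin.ext_iff _ i j
    have h' := @Fin.ext_iff _ (σ i) (σ j)
    rw [σ.injective.eq_iff] at h'
    change (i : ℕ) = j ∨ (colour z.1 (z.2 (τ i)) = colour z.1 (z.2 (τ j)) ∧
      colour z.1 (z.2 (τ i)) ≠ none) ↔ (σ i : ℕ) = σ j ∨ _
    rw [hτ, hτ, ← h, ← h']
  change restrict n (paintbox (z.1, fun i => z.2 (τ i))) = _ ↔ restrict n (paintbox z) = s
  rw [Setoid.ext_iff, Setoid.ext_iff]
  constructor
  · intro h i j
    have := (hrel (σ.symm i) (σ.symm j)).symm.trans (h (σ.symm i) (σ.symm j))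
    change _ ↔ s (σ (σ.symm i)) (σ (σ.symm j)) at this
    simp only [Equiv.apply_symm_apply] at this
    exact this
  · intro h i j
    exact (hrel i j).trans (h (σ i) (σ j))

/-- The colour `k` has limiting relative frequency `x k`, for all `k`. -/
def HasFreqs (x : ℕ → ℝ) (c : ℕ → Option ℕ) : Prop :=
  ∀ k, Tendsto (relFreq {i | c i = some k}) atTop (𝓝 (x k))

/-- The strong law of large numbers for the indicators of the colour `k`. -/
theorem ae_hasFreqs {x : ℕ → ℝ} (hx : IsSubProb x) :
    ∀ᵐ u ∂unifSeq, HasFreqs x fun i => colour x (u i) := by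
  rw [show (∀ᵐ u ∂unifSeq, HasFreqs x fun i => colour x (u i)) ↔ _ from ae_all_iff]
  intro k
  set A : Set ℝ := {t | colour x t = some k} with hAdef
  have hA : MeasurableSet A := measurableSet_colour_right x k
  have hf : Measurable (A.indicator fun _ => (1 : ℝ)) := measurable_const.indicator hA
  have hmp : ∀ i, MeasurePreserving (Function.eval i) unifSeq unif := fun i =>
    measurePreserving_eval_infinitePi (fun _ : ℕ => unif) i
  have hind : iIndepFun (fun i (u : ℕ → ℝ) => A.indicator (fun _ => (1 : ℝ)) (u i)) unifSeq :=
    iIndepFun_infinitePi (P := fun _ : ℕ => unif) fun _ => hf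
  have hlaw := strong_law_ae_real (μ := unifSeq)
    (fun i (u : ℕ → ℝ) => A.indicator (fun _ => (1 : ℝ)) (u i)) ?_
    (fun i j hij => hind.indepFun hij) (fun i => ?_)
  · filter_upwards [hlaw] with u hu
    have h1 : ∫ u, A.indicator (fun _ => (1 : ℝ)) (u 0) ∂unifSeq = x k := by
      rw [← unif_colour hx k, ← integral_indicator_one hA, ← (hmp 0).map_eq,
        integral_map (hmp 0).measurable.aemeasurable
          (by exact (measurable_one.indicator hA).aestronglyMeasurable)]
      rfl
    rw [h1] at hu
    refine hu.congr fun N => ?_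
    rw [relFreq_eq_sum]
    rfl
  · exact Integrable.of_bound (hf.comp (measurable_pi_apply 0)).aestronglyMeasurable 1
      (ae_of_all _ fun u => by
        rw [Real.norm_of_nonneg (Set.indicator_nonneg (fun _ _ => zero_le_one) _)]
        exact Set.indicator_le_self' (fun _ _ => zero_le_one) _)
  · refine ⟨(hf.comp (measurable_pi_apply i)).aemeasurable,
      (hf.comp (measurable_pi_apply 0)).aemeasurable, ?_⟩
    have : ∀ i, unifSeq.map (fun u : ℕ → ℝ => A.indicator (fun _ => (1 : ℝ)) (u i)) =
        unif.map (A.indicator fun _ => (1 : ℝ)) := fun i => by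
      rw [← (hmp i).map_eq, Measure.map_map hf (hmp i).measurable]
      rfl
    rw [this, this]

theorem class_paint_of_some {c : ℕ → Option ℕ} {i k : ℕ} (h : c i = some k) :
    {m | paint c i m} = {m | c m = some k} := by
  ext m
  simp only [Set.mem_ofPred_eq, paint_rel]
  constructor
  · rintro (rfl | ⟨h1, -⟩)
    exacts [h, h1 ▸ h]
  · intro hm
    exact Or.inr ⟨h.trans hm.symm, by simp [h]⟩

theorem class_paint_of_none {c : ℕ → Option ℕ} {i : ℕ} (h : c i = none) :
    {m | paint c i m} = {i} := by
  ext m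
  simp only [Set.mem_ofPred_eq, paint_rel, h, ne_eq, not_true, and_false, or_false,
    Set.mem_singleton_iff, eq_comm]

theorem HasFreqs.exists_eq_some {x : ℕ → ℝ} {c : ℕ → Option ℕ} (h : HasFreqs x c) {k : ℕ}
    (hk : 0 < x k) : ∃ i, c i = some k := by
  by_contra hcon
  push Not at hcon
  have h1 : {i | c i = some k} = ∅ := Set.eq_empty_of_forall_notMem hcon
  have h2 := freq_eq_of_tendsto (h k)
  rw [h1, freq_eq_zero_of_finite Set.finite_empty] at h2
  exact hk.ne h2

theorem HasFreqs.freq_eq {x : ℕ → ℝ} {c : ℕ → Option ℕ} (h : HasFreqs x c) {i k : ℕ}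
    (hk : c i = some k) : freq {m | paint c i m} = x k := by
  rw [class_paint_of_some hk]
  exact freq_eq_of_tendsto (h k)

/-- A colour with positive frequency occurs, and its first occurrence is the least element of a
cluster with that frequency. Uncoloured positions are singletons with frequency zero. -/
theorem HasFreqs.sameCounts {x : ℕ → ℝ} {c : ℕ → Option ℕ} (h : HasFreqs x c) :
    SameCounts (firstFreq (paint c)) x := by
  intro t ht
  have h1 : ∀ k, t ≤ x k → ∃ i, c i = some k ∧ IsFirstAfter (paint c) 0 i := by
    intro k hk
    obtain ⟨i, hi⟩ := h.exists_eq_some (ht.trans_le hk)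
    obtain ⟨j, hj, hji, -⟩ := exists_isFirstAfter (paint c) (zero_le (a := i))
    have : j ∈ {m | paint c i m} := (paint c).symm hji
    rw [class_paint_of_some hi] at this
    exact ⟨j, this, hj⟩
  choose! φ hφ hφ1 using h1
  have h2 : {i | t ≤ firstFreq (paint c) i} = φ '' {k | t ≤ x k} := by
    ext i
    simp only [Set.mem_image, Set.mem_ofPred_eq]
    constructor
    · intro hi
      have hif : IsFirstAfter (paint c) 0 i := by
        by_contra hcon
        rw [firstFreq_of_not hcon] at hi
        exact absurd hi (not_le.2 ht)
      rw [firstFreq_of_isFirst hif] at hi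
      rcases hc : c i with _ | k
      · rw [class_paint_of_none hc, freq_eq_zero_of_finite (Set.finite_singleton i)] at hi
        exact absurd hi (not_le.2 ht)
      · rw [h.freq_eq hc] at hi
        exact ⟨k, hi, isFirstAfter_unique (hφ1 k hi) hif
          (Or.inr ⟨(hφ k hi).trans hc.symm, by simp [hφ k hi]⟩)⟩
    · rintro ⟨k, hk, rfl⟩
      rwa [firstFreq_of_isFirst (hφ1 k hk), h.freq_eq (hφ k hk)]
  rw [h2, Set.InjOn.encard_image]
  intro k hk l hl hkl
  have := hφ k hk
  rw [hkl, hφ l hl] at this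
  exact (Option.some_inj.1 this).symm

theorem HasFreqs.rankedFreq_eq {x : ℕ → ℝ} (hx : ∀ j, 0 ≤ x j) {c : ℕ → Option ℕ}
    (h : HasFreqs x c) : rankedFreq (paint c) = ranked x :=
  ((sameCounts_appearanceFreq (paint c) 0).trans h.sameCounts).ranked_eq
    (appearanceFreq_nonneg _ 0) hx

theorem measurableSet_hasFreqs :
    MeasurableSet {z : (ℕ → ℝ) × (ℕ → ℝ) | HasFreqs z.1 fun i => colour z.1 (z.2 i)} := by
  have : {z : (ℕ → ℝ) × (ℕ → ℝ) | HasFreqs z.1 fun i => colour z.1 (z.2 i)} =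
      ⋂ k, {z | Tendsto (fun N => relFreq {i | colour z.1 (z.2 i) = some k} N) atTop
        (𝓝 (z.1 k))} := by
    ext z; simp [HasFreqs]
  rw [this]
  refine MeasurableSet.iInter fun k => ?_
  refine measurableSet_tendsto_fun (fun N => ?_) (by fun_prop)
  simp only [relFreq_eq_sum]
  refine (Finset.measurable_sum _ fun m _ => ?_).div_const _
  exact measurable_const.indicator (measurableSet_colour_coord k m)

theorem ae_hasFreqs_prod {L : Measure (ℕ → ℝ)} [IsProbabilityMeasure L]
    (hL : ∀ᵐ x ∂L, IsSubProb x) :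
    ∀ᵐ z ∂L.prod unifSeq, HasFreqs z.1 fun i => colour z.1 (z.2 i) := by
  rw [Measure.ae_prod_iff_ae_ae measurableSet_hasFreqs]
  filter_upwards [hL] with x hx
  exact ae_hasFreqs hx

/-- The law of the paintbox partition given by the random sequence `y`. -/
noncomputable def paintboxLaw {α : Type*} [MeasurableSpace α] (P : Measure α) (y : α → ℕ → ℝ) :
    Measure (Setoid ℕ) :=
  ((P.map y).prod unifSeq).map paintbox

/-- On the product of `P` with the sampling variables the two ranked sequences agree almost surely:
ranking the paintbox frequencies gives back the ranked terms of `y`, which are those of the original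
partition. -/
theorem map_rankedFreq_paintboxLaw {P : Measure (Setoid ℕ)} [IsProbabilityMeasure P]
    {y : Setoid ℕ → ℕ → ℝ} (hy : Measurable y) (hsub : ∀ᵐ π ∂P, IsSubProb (y π))
    (hr : ∀ᵐ π ∂P, SameCounts (rankedFreq π) (y π)) (hreg : ∀ᵐ π ∂P, Regular π) :
    (paintboxLaw P y).map rankedFreq = P.map rankedFreq := by
  have : IsProbabilityMeasure (P.map y) := Measure.isProbabilityMeasure_map hy.aemeasurable
  have hL : ∀ᵐ x ∂P.map y, IsSubProb x :=
    (ae_map_iff hy.aemeasurable measurableSet_isSubProb).2 hsub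
  have hmp : MeasurePreserving (Prod.map y id) (P.prod unifSeq) ((P.map y).prod unifSeq) :=
    (hy.measurePreserving P).prod (MeasurePreserving.id unifSeq)
  have h1 := hmp.quasiMeasurePreserving.ae (ae_hasFreqs_prod hL)
  have h2 : ∀ᵐ z ∂P.prod unifSeq, rankedFreq (paintbox (Prod.map y id z)) = rankedFreq z.1 := by
    filter_upwards [h1, Measure.quasiMeasurePreserving_fst.ae hsub,
      Measure.quasiMeasurePreserving_fst.ae hr,
      Measure.quasiMeasurePreserving_fst.ae hreg] with z hz1 hz2 hz3 hz4
    rw [paintbox, hz1.rankedFreq_eq hz2.1, ← hz3.ranked_eq (rankedFreq_nonneg _) hz2.1,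
      rankedFreq, ranked_ranked (appearanceFreq_nonneg _ 0) (hz4.summable_appearanceFreq 0)]
  rw [paintboxLaw, Measure.map_map measurable_rankedFreq measurable_paintbox, ← hmp.map_eq,
    Measure.map_map (measurable_rankedFreq.comp measurable_paintbox) hmp.measurable,
    Measure.map_congr
      (show (rankedFreq ∘ paintbox) ∘ Prod.map y id =ᵐ[P.prod unifSeq] rankedFreq ∘ Prod.fst from h2),
    ← Measure.map_map measurable_rankedFreq measurable_fst]
  congr 1
  exact Measure.map_fst_prod.trans (by simp)

end Paintbox

/-! ### Approximating frequencies by functions of finitely many positions -/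

section Approximation

/-- The `j`-th cluster to appear has least element `i`. -/
def startEvent (j i : ℕ) : Set (Setoid ℕ) := {π | IsFirstAfter π 0 i ∧ rank π 0 i = j}

/-- At most `j` clusters appear among the first `M` elements. -/
def lateEvent (j M : ℕ) : Set (Setoid ℕ) := {π | ∀ i < M, π ∉ startEvent j i}

theorem measurableSet_startEvent (j i : ℕ) : MeasurableSet (startEvent j i) :=
  (measurableSet_isFirstAfter 0 i).inter (measurable_rank 0 i (measurableSet_singleton j))

theorem measurableSet_lateEvent (j M : ℕ) : MeasurableSet (lateEvent j M) := by
  have : lateEvent j M = ⋂ i, {π | i < M → π ∉ startEvent j i} := by ext; simp [lateEvent]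
  rw [this]
  exact MeasurableSet.iInter fun i =>
    (MeasurableSet.const _).imp (measurableSet_startEvent j i).compl

theorem isFirstAfter_congr {π π' : Setoid ℕ} {n : ℕ}
    (h : ∀ i j, i < n → j < n → (π i j ↔ π' i j)) {i : ℕ} (hi : i < n) :
    IsFirstAfter π 0 i ↔ IsFirstAfter π' 0 i := by
  refine and_congr_right fun _ => forall_congr' fun l => forall_congr' fun _ =>
    forall_congr' fun hl => not_congr (h l i (hl.trans hi) hi)

theorem startEvent_congr {π π' : Setoid ℕ} {n : ℕ}
    (h : ∀ i j, i < n → j < n → (π i j ↔ π' i j)) {i : ℕ} (hi : i < n) (j : ℕ) :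
    π ∈ startEvent j i ↔ π' ∈ startEvent j i := by
  have : {l | l < i ∧ IsFirstAfter π 0 l} = {l | l < i ∧ IsFirstAfter π' 0 l} := by
    ext l
    exact and_congr_right fun hl => isFirstAfter_congr h (hl.trans hi)
  refine and_congr (isFirstAfter_congr h hi) ?_
  rw [rank, rank, this]

theorem lateEvent_congr {π π' : Setoid ℕ} {n : ℕ}
    (h : ∀ i j, i < n → j < n → (π i j ↔ π' i j)) (j : ℕ) (hπ : π ∈ lateEvent j n) :
    π' ∈ lateEvent j n :=
  fun i hi h' => hπ i hi ((startEvent_congr h hi j).2 h')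

theorem rank_le_of_lateEvent {π : Setoid ℕ} {j M : ℕ} (h : π ∈ lateEvent j M) :
    rank π 0 M ≤ j := by
  induction M with
  | zero => simp [rank_zero]
  | succ M ih =>
    have hM : rank π 0 M ≤ j := ih fun i hi => h i (hi.trans (Nat.lt_succ_self M))
    by_cases hf : IsFirstAfter π 0 M
    · rw [rank_succ_of_isFirstAfter hf]
      exact Nat.lt_of_le_of_ne hM fun hr => h M (Nat.lt_succ_self M) ⟨hf, hr⟩
    · rwa [rank_succ_of_not hf]

theorem startEvent_unique {π : Setoid ℕ} {j i i' : ℕ} (h : π ∈ startEvent j i)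
    (h' : π ∈ startEvent j i') : i = i' :=
  rank_injOn h.1 h'.1 (h.2.trans h'.2.symm)

theorem appearanceFreq_of_startEvent {π : Setoid ℕ} {j i : ℕ} (h : π ∈ startEvent j i) :
    appearanceFreq π 0 j = freq {m | π i m} := by
  rw [← h.2, appearanceFreq_rank h.1]

/-- The `j`-th cluster, if it exists at all, starts at or beyond `M`, so it is none of the clusters
in the sum. -/
theorem Regular.appearanceFreq_add_sum_le_one {π : Setoid ℕ} (hπ : Regular π) {j M : ℕ}
    (h : π ∈ lateEvent j M) :
    appearanceFreq π 0 j + ∑ i ∈ Finset.range M, firstFreq π i ≤ 1 := by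
  by_cases hj : ∃ i, π ∈ startEvent j i
  · obtain ⟨i, hi⟩ := hj
    have hiM : i ∉ Finset.range M := fun hiM => h i (Finset.mem_range.1 hiM) hi
    rw [appearanceFreq_of_startEvent hi, ← firstFreq_of_isFirst hi.1, ← Finset.sum_insert hiM]
    exact hπ.sum_firstFreq_le_one _
  · push Not at hj
    rw [appearanceFreq_eq_zero fun i hi hr => hj i ⟨hi, hr⟩, zero_add]
    exact hπ.sum_firstFreq_le_one _

variable {P : Measure (Setoid ℕ)} [IsProbabilityMeasure P]

theorem integrable_of_mem_unit {α : Type*} [MeasurableSpace α] {μ : Measure α} [IsFiniteMeasure μ]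
    {f : α → ℝ} (hf : Measurable f) (h0 : ∀ a, 0 ≤ f a) (h1 : ∀ a, f a ≤ 1) : Integrable f μ :=
  Integrable.of_bound hf.aestronglyMeasurable 1 (ae_of_all _ fun a => by
    rw [Real.norm_of_nonneg (h0 a)]; exact h1 a)

theorem measurable_appearanceFreq_apply (n j : ℕ) :
    Measurable fun π : Setoid ℕ => appearanceFreq π n j :=
  (measurable_pi_apply j).comp (measurable_appearanceFreq n)

theorem measurable_firstFreq (i : ℕ) : Measurable fun π : Setoid ℕ => firstFreq π i :=
  (measurable_freq_class i).indicator (measurableSet_isFirstAfter 0 i)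

theorem firstFreq_le_one (π : Setoid ℕ) (i : ℕ) : firstFreq π i ≤ 1 :=
  (Set.indicator_le_self' (fun _ _ => freq_nonneg _) _).trans (freq_le_one _)

/-- By the moment formula, position `M` fails to join any present cluster with conditional
probability one minus the sum of their frequencies, which leaves at least the frequency of the
missing `j`-th cluster. -/
theorem integral_lateEvent_le (hP : IsSwapInvariant P) (j M : ℕ) :
    ∫ π in lateEvent j M, appearanceFreq π 0 j ∂P ≤
      P.real (lateEvent j M ∩ {π | IsFirstAfter π 0 M}) := by
  have hlate := measurableSet_lateEvent j M
  have hstable : ∀ i < M, SwapStable M (lateEvent j M ∩ {π | IsFirstAfter π 0 i}) := fun i hi =>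
    swapStable_of_restrict fun π π' h hπ =>
      ⟨lateEvent_congr h j hπ.1, (isFirstAfter_congr h hi).1 hπ.2⟩
  have hold : ∀ i ∈ Finset.range M,
      P.real (lateEvent j M ∩ {π | IsFirstAfter π 0 i} ∩ {π | π i M}) =
        ∫ π in lateEvent j M, firstFreq π i ∂P := by
    intro i hi
    have := measureReal_posEvent hP (hlate.inter (measurableSet_isFirstAfter 0 i))
      (hstable i (Finset.mem_range.1 hi)) (ι := Unit) (i := fun _ => i) (b := fun _ => M)
      (fun _ => Finset.mem_range.1 hi) (Function.injective_of_subsingleton _) (fun _ => le_rfl)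
    simp only [posEvent, forall_const, Finset.univ_unique, Finset.prod_singleton] at this
    rw [this, ← setIntegral_indicator (measurableSet_isFirstAfter 0 i)]
    rfl
  have hsplit : lateEvent j M \ {π | IsFirstAfter π 0 M} =
      ⋃ i ∈ Finset.range M, lateEvent j M ∩ {π | IsFirstAfter π 0 i} ∩ {π | π i M} := by
    ext π
    simp only [Set.mem_sdiff, Set.mem_iUnion, Finset.mem_range, Set.mem_inter_iff, Set.mem_ofPred_eq]
    constructor
    · rintro ⟨h1, h2⟩
      obtain ⟨i, hi, hiM, hle⟩ := exists_isFirstAfter π (zero_le (a := M))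
      refine ⟨i, lt_of_le_of_ne hle ?_, ⟨h1, hi⟩, hiM⟩
      rintro rfl
      exact h2 hi
    · rintro ⟨i, hi, ⟨h1, h2⟩, hiM⟩
      exact ⟨h1, fun hM => hM.2 i zero_le hi hiM⟩
  have hsum : P.real (lateEvent j M \ {π | IsFirstAfter π 0 M}) =
      ∫ π in lateEvent j M, ∑ i ∈ Finset.range M, firstFreq π i ∂P := by
    rw [hsplit, measureReal_biUnion_finset, Finset.sum_congr rfl hold, integral_finsetSum]
    · exact fun i _ => integrable_of_mem_unit (measurable_firstFreq i)
        (fun π => firstFreq_nonneg π i) (fun π => firstFreq_le_one π i)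
    · intro i _ i' _ hii
      exact Set.disjoint_left.2 fun π h h' => hii
        (isFirstAfter_unique h.1.2 h'.1.2 (π.trans h.2 (π.symm h'.2)))
    · exact fun i _ => (hlate.inter (measurableSet_isFirstAfter 0 i)).inter (measurableSet_rel i M)
  have hadd := measureReal_inter_add_sdiff (μ := P) (s := lateEvent j M)
    (measurableSet_isFirstAfter 0 M)
  rw [hsum] at hadd
  have hint1 : Integrable (fun π => appearanceFreq π 0 j) (P.restrict (lateEvent j M)) :=
    integrable_of_mem_unit (measurable_appearanceFreq_apply 0 j)
      (fun π => appearanceFreq_nonneg π 0 j) (fun π => appearanceFreq_le_one π 0 j)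
  have hint2 : Integrable (fun π => ∑ i ∈ Finset.range M, firstFreq π i)
      (P.restrict (lateEvent j M)) :=
    integrable_finsetSum _ fun i _ => integrable_of_mem_unit (measurable_firstFreq i)
      (fun π => firstFreq_nonneg π i) (fun π => firstFreq_le_one π i)
  have hle : ∫ π in lateEvent j M, (appearanceFreq π 0 j + ∑ i ∈ Finset.range M, firstFreq π i) ∂P
      ≤ ∫ _ in lateEvent j M, (1 : ℝ) ∂P := by
    refine integral_mono_ae (hint1.add hint2) (integrable_const _) ?_
    filter_upwards [ae_restrict_of_ae (ae_regular hP), ae_restrict_mem hlate] with π hπ h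
    exact hπ.appearanceFreq_add_sum_le_one h
  rw [integral_add hint1 hint2, integral_const, smul_eq_mul, mul_one,
    measureReal_restrict_apply_univ] at hle
  linarith

/-- As long as the `j`-th cluster has not started, a new cluster has one of the ranks `0, …, j`, and
distinct starts have distinct ranks. -/
theorem card_lateEvent_le (π : Setoid ℕ) (j M : ℕ) :
    ∑ a ∈ Finset.range M, (lateEvent j a ∩ {π | IsFirstAfter π 0 a}).indicator
      (fun _ => (1 : ℝ)) π ≤ j + 1 := by
  classical
  have h1 : ∑ a ∈ Finset.range M, (lateEvent j a ∩ {π | IsFirstAfter π 0 a}).indicator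
      (fun _ => (1 : ℝ)) π = ((Finset.range M).filter fun a =>
        π ∈ lateEvent j a ∩ {π | IsFirstAfter π 0 a}).card := by
    rw [Finset.card_filter]
    push_cast
    exact Finset.sum_congr rfl fun a _ => by rw [Set.indicator_apply]
  have h2 : ((Finset.range M).filter fun a =>
      π ∈ lateEvent j a ∩ {π | IsFirstAfter π 0 a}).card ≤ (Finset.range (j + 1)).card := by
    refine Finset.card_le_card_of_injOn (rank π 0) ?_ ?_
    · intro a ha
      simp only [Finset.coe_range, Set.mem_Iio]
      exact Nat.lt_succ_of_le (rank_le_of_lateEvent (Finset.mem_filter.1 ha).2.1)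
    · intro a ha b hb hab
      exact rank_injOn (Finset.mem_filter.1 ha).2.2 (Finset.mem_filter.1 hb).2.2 hab
  rw [Finset.card_range] at h2
  rw [h1]
  exact_mod_cast h2

/-- The late events decrease, so the integral at `M` is at most its average over all earlier times.
Those integrals are bounded by probabilities of new starts, whose total is at most `j + 1`. The
bound depends on `P` in no way. -/
theorem integral_lateEvent_le_div (hP : IsSwapInvariant P) (j : ℕ) {M : ℕ} (hM : 0 < M) :
    ∫ π in lateEvent j M, appearanceFreq π 0 j ∂P ≤ (j + 1) / M := by
  have hMR : (0 : ℝ) < M := by positivity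
  have hint : ∀ s, IntegrableOn (fun π => appearanceFreq π 0 j) s P := fun s =>
    integrable_of_mem_unit (measurable_appearanceFreq_apply 0 j)
      (fun π => appearanceFreq_nonneg π 0 j) (fun π => appearanceFreq_le_one π 0 j)
  have hms : ∀ a, MeasurableSet (lateEvent j a ∩ {π | IsFirstAfter π 0 a}) := fun a =>
    (measurableSet_lateEvent j a).inter (measurableSet_isFirstAfter 0 a)
  rw [le_div_iff₀ hMR, mul_comm]
  calc (M : ℝ) * ∫ π in lateEvent j M, appearanceFreq π 0 j ∂P
      = ∑ a ∈ Finset.range M, ∫ π in lateEvent j M, appearanceFreq π 0 j ∂P := by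
        rw [Finset.sum_const, Finset.card_range, nsmul_eq_mul]
    _ ≤ ∑ a ∈ Finset.range M, P.real (lateEvent j a ∩ {π | IsFirstAfter π 0 a}) := by
        refine Finset.sum_le_sum fun a ha => ?_
        refine le_trans (setIntegral_mono_set (hint _)
          (ae_of_all _ fun π => appearanceFreq_nonneg π 0 j) (Eventually.of_forall ?_))
          (integral_lateEvent_le hP j a)
        exact fun π hπ i hi => hπ i (hi.trans (Finset.mem_range.1 ha))
    _ = ∫ π, ∑ a ∈ Finset.range M, (lateEvent j a ∩ {π | IsFirstAfter π 0 a}).indicator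
          (fun _ => (1 : ℝ)) π ∂P := by
        rw [integral_finsetSum _ fun a _ => (integrable_const _).indicator (hms a)]
        refine Finset.sum_congr rfl fun a _ => ?_
        rw [integral_indicator_const _ (hms a), smul_eq_mul, mul_one]
    _ ≤ ∫ _, ((j : ℝ) + 1) ∂P :=
        integral_mono (integrable_finsetSum _ fun a _ => (integrable_const _).indicator (hms a))
          (integrable_const _) fun π => card_lateEvent_le π j M
    _ = j + 1 := by simp

/-- An approximation of the frequency of the `j`-th cluster to appear that only depends on the
first `M + M ^ 2` elements. -/
noncomputable def approxFreq (M : ℕ) (π : Setoid ℕ) (j : ℕ) : ℝ :=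
  ∑ i ∈ Finset.range M, (startEvent j i).indicator
    (fun π => relFreq {m | m + M ∈ {m | π i m}} (M ^ 2)) π

theorem measurable_relFreq_class (i M N : ℕ) :
    Measurable fun π : Setoid ℕ => relFreq {m | m + M ∈ {m | π i m}} N := by
  simp only [relFreq_eq_sum]
  refine (Finset.measurable_sum _ fun m _ => ?_).div_const _
  exact measurable_const.indicator (measurableSet_rel i (m + M))

theorem measurable_approxFreq (M j : ℕ) : Measurable fun π => approxFreq M π j :=
  Finset.measurable_sum _ fun i _ =>
    (measurable_relFreq_class i M _).indicator (measurableSet_startEvent j i)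

theorem approxFreq_of_late {M j : ℕ} {π : Setoid ℕ} (h : π ∈ lateEvent j M) :
    approxFreq M π j = 0 :=
  Finset.sum_eq_zero fun i hi => Set.indicator_of_notMem (h i (Finset.mem_range.1 hi)) _

theorem approxFreq_of_start {M j i : ℕ} {π : Setoid ℕ} (hi : i < M) (h : π ∈ startEvent j i) :
    approxFreq M π j = relFreq {m | m + M ∈ {m | π i m}} (M ^ 2) := by
  rw [approxFreq, Finset.sum_eq_single_of_mem i (Finset.mem_range.2 hi), Set.indicator_of_mem h]
  intro i' _ hne
  exact Set.indicator_of_notMem (fun h' => hne (startEvent_unique h' h)) _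

theorem abs_approxFreq_sub_eq (M j : ℕ) (π : Setoid ℕ) :
    |approxFreq M π j - appearanceFreq π 0 j| =
      (lateEvent j M).indicator (fun π => appearanceFreq π 0 j) π +
        ∑ i ∈ Finset.range M, (startEvent j i).indicator (fun π =>
          |relFreq {m | m + M ∈ {m | π i m}} (M ^ 2) - freq {m | π i m}|) π := by
  by_cases h : π ∈ lateEvent j M
  · rw [approxFreq_of_late h, Set.indicator_of_mem h, Finset.sum_eq_zero fun i hi =>
      Set.indicator_of_notMem (h i (Finset.mem_range.1 hi)) _, zero_sub, abs_neg, add_zero,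
      abs_of_nonneg (appearanceFreq_nonneg π 0 j)]
  · rw [Set.indicator_of_notMem h, zero_add]
    simp only [lateEvent, Set.mem_ofPred_eq] at h
    push Not at h
    obtain ⟨i, hi, hπ⟩ := h
    rw [approxFreq_of_start hi hπ, appearanceFreq_of_startEvent hπ,
      Finset.sum_eq_single_of_mem i (Finset.mem_range.2 hi), Set.indicator_of_mem hπ]
    intro i' _ hne
    exact Set.indicator_of_notMem (fun h' => hne (startEvent_unique h' hπ)) _

/-- The late event costs `(j + 1) / M`. If the cluster has started, a sample of `M ^ 2` further
positions has mean square error at most `1 / M ^ 2`, and `|d| ≤ M * d ^ 2 + 1 / M` turns this into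
`2 / M`. -/
theorem integral_abs_approxFreq_sub_le (hP : IsSwapInvariant P) (j : ℕ) {M : ℕ} (hM : 0 < M) :
    ∫ π, |approxFreq M π j - appearanceFreq π 0 j| ∂P ≤ (j + 3) / M := by
  have hMR : (0 : ℝ) < M := by positivity
  have hdint : ∀ i s, IntegrableOn (fun π : Setoid ℕ =>
      |relFreq {m | m + M ∈ {m | π i m}} (M ^ 2) - freq {m | π i m}|) s P := fun i s => by
    refine integrable_of_mem_unit ((measurable_relFreq_class i M _).sub
      (measurable_freq_class i)).abs (fun π => abs_nonneg _) fun π => ?_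
    rw [abs_le]
    constructor <;> linarith [relFreq_nonneg {m | m + M ∈ {m | π i m}} (M ^ 2),
      relFreq_le_one {m | m + M ∈ {m | π i m}} (M ^ 2), freq_nonneg {m | π i m},
      freq_le_one {m | π i m}]
  have hdint2 : ∀ i s, IntegrableOn (fun π : Setoid ℕ =>
      (relFreq {m | m + M ∈ {m | π i m}} (M ^ 2) - freq {m | π i m}) ^ 2) s P := fun i s => by
    refine integrable_of_mem_unit (((measurable_relFreq_class i M _).sub
      (measurable_freq_class i)).pow_const 2) (fun π => sq_nonneg _) fun π => ?_
    rw [sq_le_one_iff_abs_le_one, abs_le]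
    constructor <;> linarith [relFreq_nonneg {m | m + M ∈ {m | π i m}} (M ^ 2),
      relFreq_le_one {m | m + M ∈ {m | π i m}} (M ^ 2), freq_nonneg {m | π i m},
      freq_le_one {m | π i m}]
  have hterm : ∀ i ∈ Finset.range M, ∫ π in startEvent j i,
      |relFreq {m | m + M ∈ {m | π i m}} (M ^ 2) - freq {m | π i m}| ∂P ≤
        P.real (startEvent j i) * (2 / M) := by
    intro i hi
    have hiM := Finset.mem_range.1 hi
    have hsq := setIntegral_sq_le hP (measurableSet_startEvent j i) (n := M)
      (swapStable_of_restrict fun π π' h hπ => (startEvent_congr h hiM j).1 hπ) hiM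
      (N := M ^ 2) (by positivity)
    calc ∫ π in startEvent j i,
          |relFreq {m | m + M ∈ {m | π i m}} (M ^ 2) - freq {m | π i m}| ∂P
        ≤ ∫ π in startEvent j i, (M *
          (relFreq {m | m + M ∈ {m | π i m}} (M ^ 2) - freq {m | π i m}) ^ 2 + 1 / M) ∂P := by
          refine integral_mono (hdint i _) (((hdint2 i _).const_mul _).add (integrable_const _))
            fun π => ?_
          simp only
          set d := relFreq {m | m + M ∈ {m | π i m}} (M ^ 2) - freq {m | π i m}
          rw [← sq_abs d]
          have h1 : 0 ≤ (M : ℝ) * (|d| - 1 / (2 * M)) ^ 2 := by positivity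
          have h2 : (M : ℝ) * (|d| - 1 / (2 * M)) ^ 2 = M * |d| ^ 2 - |d| + 1 / M / 4 := by
            field_simp
            ring
          have h3 : (0 : ℝ) < 1 / M := by positivity
          linarith
      _ = M * ∫ π in startEvent j i,
            (relFreq {m | m + M ∈ {m | π i m}} (M ^ 2) - freq {m | π i m}) ^ 2 ∂P +
            P.real (startEvent j i) * (1 / M) := by
          rw [integral_add ((hdint2 i _).const_mul _) (integrable_const _), integral_const_mul,
            integral_const, smul_eq_mul, measureReal_restrict_apply_univ]
      _ ≤ M * (P.real (startEvent j i) / (M ^ 2 : ℕ)) + P.real (startEvent j i) * (1 / M) := by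
          gcongr
      _ = P.real (startEvent j i) * (2 / M) := by
          push_cast
          field_simp
          ring
  have hsum : ∑ i ∈ Finset.range M, P.real (startEvent j i) ≤ 1 := by
    rw [← measureReal_biUnion_finset (fun i _ i' _ hne => Set.disjoint_left.2 fun π h h' =>
      hne (startEvent_unique h h')) fun i _ => measurableSet_startEvent j i]
    exact measureReal_le_one
  simp only [abs_approxFreq_sub_eq]
  rw [integral_add, integral_indicator (measurableSet_lateEvent j M), integral_finsetSum]
  · simp only [integral_indicator (measurableSet_startEvent j _)]
    calc _ ≤ ((j : ℝ) + 1) / M + ∑ i ∈ Finset.range M, P.real (startEvent j i) * (2 / M) :=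
          add_le_add (integral_lateEvent_le_div hP j hM) (Finset.sum_le_sum hterm)
      _ ≤ ((j : ℝ) + 1) / M + 1 * (2 / M) := by
          rw [← Finset.sum_mul]
          gcongr
      _ = (j + 3) / M := by ring
  · exact fun i _ => (integrable_indicator_iff (measurableSet_startEvent j i)).2 (hdint i _)
  · exact (integrable_indicator_iff (measurableSet_lateEvent j M)).2
      (integrable_of_mem_unit (measurable_appearanceFreq_apply 0 j)
        (fun π => appearanceFreq_nonneg π 0 j) (fun π => appearanceFreq_le_one π 0 j))
  · exact integrable_finsetSum _ fun i _ =>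
      (integrable_indicator_iff (measurableSet_startEvent j i)).2 (hdint i _)

theorem approxFreq_congr {M : ℕ} {π π' : Setoid ℕ}
    (h : restrict (M + M ^ 2) π = restrict (M + M ^ 2) π') (j : ℕ) :
    approxFreq M π j = approxFreq M π' j := by
  have hrel : ∀ i l, i < M + M ^ 2 → l < M + M ^ 2 → (π i l ↔ π' i l) := fun i l hi hl =>
    Setoid.ext_iff.1 h ⟨i, hi⟩ ⟨l, hl⟩
  refine Finset.sum_congr rfl fun i hi => ?_
  have hiM := Finset.mem_range.1 hi
  have hs := startEvent_congr hrel (i := i) (by omega) j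
  have hfreq : relFreq {m | m + M ∈ {m | π i m}} (M ^ 2) =
      relFreq {m | m + M ∈ {m | π' i m}} (M ^ 2) := by
    unfold relFreq
    congr 3
    ext m
    simp only [Set.mem_inter_iff, Set.mem_ofPred_eq, Set.mem_Iio]
    exact and_congr_left fun hm => hrel i (m + M) (by omega) (by omega)
  by_cases hπ : π ∈ startEvent j i
  · rw [Set.indicator_of_mem hπ, Set.indicator_of_mem (hs.1 hπ), hfreq]
  · rw [Set.indicator_of_notMem hπ, Set.indicator_of_notMem fun h' => hπ (hs.2 h')]

theorem integral_comp_restrict (N : ℕ) [Fintype (Setoid (Fin N))] (h : Setoid (Fin N) → ℝ) :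
    ∫ π, h (restrict N π) ∂P = ∑ s, P.real {π | restrict N π = s} * h s := by
  classical
  have h1 : ∀ π, h (restrict N π) =
      ∑ s, {π : Setoid ℕ | restrict N π = s}.indicator (fun _ => h s) π := by
    intro π
    rw [Finset.sum_eq_single_of_mem (restrict N π) (Finset.mem_univ _)]
    · rw [Set.indicator_of_mem (s := {π' : Setoid ℕ | restrict N π' = restrict N π}) rfl]
    · intro s _ hs
      exact Set.indicator_of_notMem (s := {π : Setoid ℕ | restrict N π = s})
        (fun h' => hs (Eq.symm h')) _
  simp only [h1]
  rw [integral_finsetSum _ fun s _ => (integrable_const _).indicator (measurableSet_restrict N s)]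
  refine Finset.sum_congr rfl fun s _ => ?_
  rw [integral_indicator_const _ (measurableSet_restrict N s), smul_eq_mul]

end Approximation

/-! ### Convergence of the frequencies in order of appearance -/

section FiniteDimensional

variable {P : Measure (Setoid ℕ)} [IsProbabilityMeasure P]

theorem integrable_approxFreq (M j : ℕ) : Integrable (fun π => approxFreq M π j) P :=
  integrable_finsetSum _ fun i _ => (integrable_indicator_iff (measurableSet_startEvent j i)).2 <|
    integrable_of_mem_unit (measurable_relFreq_class i M _) (fun _ => relFreq_nonneg _ _)
      fun _ => relFreq_le_one _ _

theorem integrable_comp_of_lipschitz {α E : Type*} [MeasurableSpace α] {μ : Measure α}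
    [IsFiniteMeasure μ] [PseudoEMetricSpace E] [MeasurableSpace E] [OpensMeasurableSpace E]
    [Inhabited E] {f : E → ℝ} {K : NNReal} (hf : LipschitzWith K f) {B : ℝ}
    (hB : ∀ x y, dist (f x) (f y) ≤ B) {g : α → E} (hg : Measurable g) :
    Integrable (fun a => f (g a)) μ := by
  refine Integrable.of_bound (C := B + ‖f default‖)
    (hf.continuous.measurable.comp hg).aestronglyMeasurable (.of_forall fun a => ?_)
  have h1 := hB (g a) default
  rw [dist_eq_norm] at h1
  linarith [norm_le_norm_sub_add (f (g a)) (f default)]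

theorem dist_integral_comp_approxFreq_le (hP : IsSwapInvariant P) (J : Finset ℕ)
    {f : (J → ℝ) → ℝ} {K : NNReal} (hf : LipschitzWith K f) {B : ℝ}
    (hB : ∀ x y, dist (f x) (f y) ≤ B) {M : ℕ} (hM : 0 < M) :
    dist (∫ π, f (fun j => approxFreq M π j) ∂P) (∫ π, f (fun j => appearanceFreq π 0 j) ∂P) ≤
      K * (∑ j : J, ((j : ℕ) + 3 : ℝ)) / M := by
  have hm1 : Measurable fun (π : Setoid ℕ) (j : J) => approxFreq M π j :=
    measurable_pi_lambda _ fun j => measurable_approxFreq M j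
  have hm2 : Measurable fun (π : Setoid ℕ) (j : J) => appearanceFreq π 0 j :=
    measurable_pi_lambda _ fun j => measurable_appearanceFreq_apply 0 j
  have hi1 := integrable_comp_of_lipschitz (μ := P) hf hB hm1
  have hi2 := integrable_comp_of_lipschitz (μ := P) hf hB hm2
  have hd : ∀ j : J, Integrable (fun π => |approxFreq M π j - appearanceFreq π 0 j|) P := fun j =>
    ((integrable_approxFreq M j).sub (integrable_of_mem_unit (measurable_appearanceFreq_apply 0 j)
      (fun π => appearanceFreq_nonneg π 0 j) (fun π => appearanceFreq_le_one π 0 j))).abs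
  rw [dist_eq_norm, ← integral_sub hi1 hi2]
  calc _ ≤ ∫ π, ‖f (fun j => approxFreq M π j) - f (fun j => appearanceFreq π 0 j)‖ ∂P :=
        norm_integral_le_integral_norm _
    _ ≤ ∫ π, K * ∑ j : J, |approxFreq M π j - appearanceFreq π 0 j| ∂P := by
        refine integral_mono (hi1.sub hi2).norm
          ((integrable_finsetSum (Finset.univ : Finset J) fun j _ => hd j).const_mul _) fun π => ?_
        simp only
        rw [← dist_eq_norm]
        refine (hf.dist_le_mul _ _).trans (mul_le_mul_of_nonneg_left ?_ K.2)
        refine (dist_pi_le_iff (Finset.sum_nonneg fun j _ => abs_nonneg _)).2 fun j => ?_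
        rw [Real.dist_eq]
        exact Finset.single_le_sum
          (f := fun j : J => |approxFreq M π j - appearanceFreq π 0 j|)
          (fun j _ => abs_nonneg _) (Finset.mem_univ j)
    _ ≤ _ := by
        rw [integral_const_mul, integral_finsetSum (Finset.univ : Finset J) fun j _ => hd j, mul_div_assoc,
          Finset.sum_div]
        exact mul_le_mul_of_nonneg_left
          (Finset.sum_le_sum fun j _ => integral_abs_approxFreq_sub_le hP j hM) K.2

/-- All shifted laws and `Q` are swap invariant, so the approximation error is small uniformly in
`n`. For fixed `M` the approximations converge because they depend on a finite restriction only. -/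
theorem tendsto_integral_appearanceFreq_shift (hP : ∀ n, IsSwapInvariant (P.map (shift n)))
    {Q : Measure (Setoid ℕ)} [IsProbabilityMeasure Q] (hQ : IsExchangeable Q id)
    (hPQ : P.map rankedFreq = Q.map rankedFreq) (J : Finset ℕ)
    {f : (J → ℝ) → ℝ} {K : NNReal} (hf : LipschitzWith K f) {B : ℝ}
    (hB : ∀ x y, dist (f x) (f y) ≤ B) :
    Tendsto (fun n => ∫ π, f (fun j => appearanceFreq π 0 j) ∂(P.map (shift n))) atTop
      (𝓝 (∫ π, f (fun j => appearanceFreq π 0 j) ∂Q)) := by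
  classical
  have hprob : ∀ n, IsProbabilityMeasure (P.map (shift n)) := fun n =>
    Measure.isProbabilityMeasure_map (measurable_shift n).aemeasurable
  have hP0 : IsSwapInvariant P := by
    have := hP 0
    rwa [shift_zero, Measure.map_id] at this
  have happrox : ∀ M, Tendsto (fun n => ∫ π, f (fun j => approxFreq M π j) ∂(P.map (shift n)))
      atTop (𝓝 (∫ π, f (fun j => approxFreq M π j) ∂Q)) := by
    intro M
    have : Fintype (Setoid (Fin (M + M ^ 2))) := Fintype.ofFinite _
    -- The approximation factors through the restriction; the value zero is never taken at an actual
    -- restriction.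
    let e : Setoid (Fin (M + M ^ 2)) → ℝ := fun s =>
      if h : ∃ π, restrict (M + M ^ 2) π = s then f (fun j => approxFreq M h.choose j) else 0
    have he : ∀ π, f (fun j => approxFreq M π j) = e (restrict (M + M ^ 2) π) := by
      intro π
      have hex : ∃ π', restrict (M + M ^ 2) π' = restrict (M + M ^ 2) π := ⟨π, rfl⟩
      simp only [e, dif_pos hex]
      exact congrArg f (funext fun j => approxFreq_congr hex.choose_spec.symm j)
    simp only [he, integral_comp_restrict]
    refine tendsto_finsetSum _ fun s _ => Tendsto.mul_const _ ?_
    refine (tendsto_measureReal_restrict_shift hP0 hQ hPQ s).congr fun n => ?_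
    rw [map_measureReal_apply (measurable_shift n) (measurableSet_restrict _ s)]
    rfl
  rw [Metric.tendsto_atTop]
  intro ε hε
  set A : ℝ := K * ∑ j : J, ((j : ℕ) + 3 : ℝ) with hA
  -- This makes both approximation errors smaller than `ε / 3`; the maximum with zero gives `M > 0`.
  obtain ⟨M, hM⟩ := exists_nat_gt (max 0 (3 * A / ε))
  have hMR : (0 : ℝ) < M := (le_max_left _ _).trans_lt hM
  have hM0 : 0 < M := by exact_mod_cast hMR
  have hAM : A / M < ε / 3 := by
    have h2 := (le_max_right _ _).trans_lt hM
    rw [div_lt_iff₀ hε] at h2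
    rw [div_lt_iff₀ hMR]
    linarith
  obtain ⟨N, hN⟩ := Metric.tendsto_atTop.1 (happrox M) (ε / 3) (by positivity)
  refine ⟨N, fun n hn => ?_⟩
  have h1 := dist_integral_comp_approxFreq_le (hP n) J hf hB hM0
  have h2 := dist_integral_comp_approxFreq_le hQ.isSwapInvariant J hf hB hM0
  have h3 := hN n hn
  rw [dist_comm] at h1
  rw [← hA] at h1 h2
  have h4 := dist_triangle4 (∫ π, f (fun j => appearanceFreq π 0 j) ∂(P.map (shift n)))
    (∫ π, f (fun j => approxFreq M π j) ∂(P.map (shift n)))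
    (∫ π, f (fun j => approxFreq M π j) ∂Q) (∫ π, f (fun j => appearanceFreq π 0 j) ∂Q)
  linarith

theorem tendstoInDistribution_appearanceFreq {Ω Ω' : Type*} [MeasurableSpace Ω]
    [MeasurableSpace Ω'] {μ : Measure Ω} [IsProbabilityMeasure μ] {ν : Measure Ω'}
    [IsProbabilityMeasure ν] {X : Ω → Setoid ℕ} (hX : Measurable X) {X' : Ω' → Setoid ℕ}
    (hX' : Measurable X') (hP : ∀ n, IsSwapInvariant ((μ.map X).map (shift n)))
    (hQ : IsExchangeable (ν.map X') id)
    (hPQ : (μ.map X).map rankedFreq = (ν.map X').map rankedFreq) (J : Finset ℕ) :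
    TendstoInDistribution (fun (n : ℕ) (ω : Ω) (j : J) => appearanceFreq (X ω) n j) atTop
      (fun (ω : Ω') (j : J) => appearanceFreq (X' ω) 0 j) (fun _ => μ) ν := by
  have : IsProbabilityMeasure (μ.map X) := Measure.isProbabilityMeasure_map hX.aemeasurable
  have : IsProbabilityMeasure (ν.map X') := Measure.isProbabilityMeasure_map hX'.aemeasurable
  have hm : ∀ n, Measurable fun (π : Setoid ℕ) (j : J) => appearanceFreq π n j := fun n =>
    measurable_pi_lambda _ fun j => measurable_appearanceFreq_apply n j
  have hP0 : IsSwapInvariant (μ.map X) := by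
    have := hP 0
    rwa [shift_zero, Measure.map_id] at this
  refine ⟨fun n => ((hm n).comp hX).aemeasurable, ((hm 0).comp hX').aemeasurable, ?_⟩
  refine tendsto_iff_forall_lipschitz_integral_tendsto.2 ?_
  rintro f ⟨B, hB⟩ ⟨K, hf⟩
  have hfm := hf.continuous.measurable
  convert tendsto_integral_appearanceFreq_shift hP hQ hPQ J hf hB using 1
  · ext n
    simp only [ProbabilityMeasure.coe_mk]
    have hmap : μ.map (fun ω (j : J) => appearanceFreq (X ω) n j) =
        (μ.map X).map fun π (j : J) => appearanceFreq π n j := (Measure.map_map (hm n) hX).symm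
    rw [hmap, integral_map (hm n).aemeasurable hfm.aestronglyMeasurable,
      integral_map (f := fun π => f fun j : J => appearanceFreq π 0 j)
        (measurable_shift n).aemeasurable (hfm.comp (hm 0)).aestronglyMeasurable]
    refine integral_congr_ae ?_
    filter_upwards [ae_regular hP0] with π hπ
    simp only [hπ.appearanceFreq_shift]
  · simp only [ProbabilityMeasure.coe_mk]
    have hmap : ν.map (fun ω (j : J) => appearanceFreq (X' ω) 0 j) =
        (ν.map X').map fun π (j : J) => appearanceFreq π 0 j := (Measure.map_map (hm 0) hX').symm
    rw [hmap, integral_map (hm 0).aemeasurable hfm.aestronglyMeasurable]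

end FiniteDimensional

/-! ### Order of appearance in a sequence of colours -/

section AppearanceOrder

variable {c : ℕ → Option ℕ}

/-- All colours before time `t` belong to `S`. -/
def AllBefore (c : ℕ → Option ℕ) (S : Finset ℕ) (t : ℕ) : Prop :=
  ∀ r < t, ∃ l ∈ S, c r = some l

/-- The first colour outside of `S` is `m`. -/
def FirstNew (c : ℕ → Option ℕ) (S : Finset ℕ) (m : ℕ) : Prop :=
  m ∉ S ∧ ∃ s, c s = some m ∧ AllBefore c S s

theorem FirstNew.unique {S : Finset ℕ} {m m' : ℕ} (h : FirstNew c S m) (h' : FirstNew c S m') :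
    m = m' := by
  obtain ⟨hm, s, hs, hb⟩ := h
  obtain ⟨hm', s', hs', hb'⟩ := h'
  rcases lt_trichotomy s s' with hlt | rfl | hgt
  · obtain ⟨l, hl, hcl⟩ := hb' s hlt
    rw [hs, Option.some_inj] at hcl
    exact absurd (hcl ▸ hl) hm
  · exact Option.some_inj.1 (hs.symm.trans hs')
  · obtain ⟨l, hl, hcl⟩ := hb s' hgt
    rw [hs', Option.some_inj] at hcl
    exact absurd (hcl ▸ hl) hm'

theorem exists_firstNew (hc : ∀ t, c t ≠ none) {S : Finset ℕ} {m t : ℕ} (hm : m ∉ S)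
    (ht : c t = some m) : ∃ m', FirstNew c S m' := by
  classical
  have hex : ∃ t, ∃ m, m ∉ S ∧ c t = some m := ⟨t, m, hm, ht⟩
  obtain ⟨m', hm', hs⟩ := Nat.find_spec hex
  refine ⟨m', hm', _, hs, fun r hr => ?_⟩
  obtain ⟨l, hl⟩ := Option.ne_none_iff_exists'.1 (hc r)
  refine ⟨l, ?_, hl⟩
  by_contra hlS
  exact Nat.find_min hex hr ⟨l, hlS, hl⟩

open scoped Classical in
/-- The first colour outside of `S`, or an arbitrary number outside of `S` if there is no such
colour. -/
noncomputable def nextColour (c : ℕ → Option ℕ) (S : Finset ℕ) : ℕ :=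
  if h : ∃ m, FirstNew c S m then h.choose else (Infinite.exists_notMem_finset S).choose

theorem FirstNew.nextColour_eq {S : Finset ℕ} {m : ℕ} (h : FirstNew c S m) :
    nextColour c S = m := by
  have hex : ∃ m, FirstNew c S m := ⟨m, h⟩
  rw [nextColour, dif_pos hex]
  exact hex.choose_spec.unique h

theorem nextColour_of_not {S : Finset ℕ} (h : ¬ ∃ m, FirstNew c S m) :
    nextColour c S = (Infinite.exists_notMem_finset S).choose := by
  rw [nextColour, dif_neg h]

theorem nextColour_notMem (S : Finset ℕ) : nextColour c S ∉ S := by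
  by_cases h : ∃ m, FirstNew c S m
  · rw [h.choose_spec.nextColour_eq]
    exact h.choose_spec.1
  · rw [nextColour_of_not h]
    exact (Infinite.exists_notMem_finset S).choose_spec

/-- The set of the first `n` colours in order of appearance. -/
noncomputable def usedColours (c : ℕ → Option ℕ) : ℕ → Finset ℕ
  | 0 => ∅
  | n + 1 => insert (nextColour c (usedColours c n)) (usedColours c n)

/-- The colours in order of appearance; arbitrary other numbers follow if there are only finitely
many colours. -/
noncomputable def appearanceOrder (c : ℕ → Option ℕ) (n : ℕ) : ℕ := nextColour c (usedColours c n)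

theorem usedColours_eq_image (n : ℕ) :
    usedColours c n = (Finset.range n).image (appearanceOrder c) := by
  induction n with
  | zero => rfl
  | succ n ih =>
    rw [usedColours, Finset.range_add_one, Finset.image_insert, ← ih]
    rfl

theorem appearanceOrder_injective : Function.Injective (appearanceOrder c) := by
  have h : ∀ i j, i < j → appearanceOrder c i ≠ appearanceOrder c j := by
    intro i j hij heq
    have h1 := nextColour_notMem (c := c) (usedColours c j)
    refine h1 ?_
    change appearanceOrder c j ∈ _
    rw [← heq, usedColours_eq_image]
    exact Finset.mem_image_of_mem _ (Finset.mem_range.2 hij)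
  intro i j hij
  by_contra hne
  rcases lt_or_gt_of_ne hne with hlt | hgt
  · exact h i j hlt hij
  · exact h j i hgt hij.symm

/-- The first `k` colours in order of appearance are `j 0, …, j (k - 1)`. -/
def StartsWith (j : ℕ → ℕ) (k : ℕ) (c : ℕ → Option ℕ) : Prop :=
  ∀ i < k, FirstNew c ((Finset.range i).image j) (j i)

/-- With the prefix prescribed, the set of used colours is no longer random, so the recursion
becomes a list of conditions with fixed sets. -/
theorem appearanceOrder_eq_iff {j : ℕ → ℕ} {k : ℕ} :
    (∀ i < k, appearanceOrder c i = j i) ↔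
      ∀ i < k, nextColour c ((Finset.range i).image j) = j i := by
  induction k with
  | zero => simp
  | succ k ih =>
    have h : ∀ p : ℕ → Prop, (∀ i < k + 1, p i) ↔ (∀ i < k, p i) ∧ p k := fun p =>
      Nat.forall_lt_succ_right
    rw [h, h, ← ih]
    refine and_congr_right fun hk => ?_
    rw [appearanceOrder, usedColours_eq_image,
      Finset.image_congr fun i hi => hk i (Finset.mem_range.1 hi)]

/-- Since all the colours `j i` occur, the arbitrary default values of `nextColour` never come into
play. -/
theorem startsWith_iff (hc : ∀ t, c t ≠ none) {j : ℕ → ℕ} {k : ℕ}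
    (hmem : ∀ i < k, ∃ t, c t = some (j i)) :
    StartsWith j k c ↔ ∀ i < k, appearanceOrder c i = j i := by
  rw [appearanceOrder_eq_iff]
  refine forall₂_congr fun i hi => ⟨fun h => h.nextColour_eq, fun h => ?_⟩
  obtain ⟨t, ht⟩ := hmem i hi
  have hni : j i ∉ (Finset.range i).image j := by
    rw [← h]
    exact nextColour_notMem _
  obtain ⟨m, hm⟩ := exists_firstNew hc hni ht
  rwa [← hm.nextColour_eq, h] at hm

/-- When no position is uncoloured, clusters of `paint c` and occurring colours correspond: a
position starts a new cluster exactly if its colour is new. -/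
theorem mem_usedColours_rank (hc : ∀ t, c t ≠ none) (t m : ℕ) :
    m ∈ usedColours c (rank (paint c) 0 t) ↔ ∃ s < t, c s = some m := by
  induction t generalizing m with
  | zero => simp [rank_zero, usedColours]
  | succ t ih =>
    have hsplit : (∃ s < t + 1, c s = some m) ↔ c t = some m ∨ ∃ s < t, c s = some m := by
      constructor
      · rintro ⟨s, hs, h⟩
        rcases Nat.lt_succ_iff_lt_or_eq.1 hs with h' | rfl
        exacts [Or.inr ⟨s, h', h⟩, Or.inl h]
      · rintro (h | ⟨s, hs, h⟩)
        exacts [⟨t, Nat.lt_succ_self t, h⟩, ⟨s, hs.trans (Nat.lt_succ_self t), h⟩]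
    obtain ⟨l, hl⟩ := Option.ne_none_iff_exists'.1 (hc t)
    by_cases ht : IsFirstAfter (paint c) 0 t
    · have hnew : FirstNew c (usedColours c (rank (paint c) 0 t)) l := by
        refine ⟨fun hmem => ?_, t, hl, fun r hr => ?_⟩
        · obtain ⟨s, hs, hsl⟩ := (ih l).1 hmem
          exact ht.2 s zero_le hs (Or.inr ⟨hsl.trans hl.symm, hc s⟩)
        · obtain ⟨l', hl'⟩ := Option.ne_none_iff_exists'.1 (hc r)
          exact ⟨l', (ih l').2 ⟨r, hr, hl'⟩, hl'⟩
      rw [rank_succ_of_isFirstAfter ht, usedColours, hnew.nextColour_eq, Finset.mem_insert, ih,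
        hsplit, hl, Option.some_inj, eq_comm]
    · rw [rank_succ_of_not ht, ih, hsplit, or_iff_right_of_imp]
      intro htm
      obtain ⟨s, hs, hst, hle⟩ := exists_isFirstAfter (paint c) (zero_le (a := t))
      have hlt : s < t := lt_of_le_of_ne hle (by rintro rfl; exact ht hs)
      rcases hst with rfl | ⟨h, -⟩
      · exact absurd hlt (lt_irrefl _)
      · exact ⟨s, hlt, h.trans htm⟩

theorem appearanceOrder_rank (hc : ∀ t, c t ≠ none) {t m : ℕ}
    (ht : IsFirstAfter (paint c) 0 t) (hm : c t = some m) :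
    appearanceOrder c (rank (paint c) 0 t) = m := by
  refine FirstNew.nextColour_eq ⟨fun hmem => ?_, t, hm, fun r hr => ?_⟩
  · obtain ⟨s, hs, hsl⟩ := (mem_usedColours_rank hc t m).1 hmem
    exact ht.2 s zero_le hs (Or.inr ⟨hsl.trans hm.symm, hc s⟩)
  · obtain ⟨l', hl'⟩ := Option.ne_none_iff_exists'.1 (hc r)
    exact ⟨l', (mem_usedColours_rank hc t l').2 ⟨r, hr, hl'⟩, hl'⟩

/-- If fewer than `j + 1` clusters appear, the right side vanishes; so does the left, since a colour
with positive frequency would occur and its cluster would have rank `j` by injectivity. -/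
theorem HasFreqs.appearanceOrder_eq {x : ℕ → ℝ} (hx : ∀ j, 0 ≤ x j) (h : HasFreqs x c)
    (hc : ∀ t, c t ≠ none) (j : ℕ) : x (appearanceOrder c j) = appearanceFreq (paint c) 0 j := by
  by_cases hj : ∃ t, IsFirstAfter (paint c) 0 t ∧ rank (paint c) 0 t = j
  · obtain ⟨t, ht, rfl⟩ := hj
    obtain ⟨m, hm⟩ := Option.ne_none_iff_exists'.1 (hc t)
    rw [appearanceOrder_rank hc ht hm, appearanceFreq_rank ht, h.freq_eq hm]
  · push Not at hj
    rw [appearanceFreq_eq_zero hj]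
    by_contra hne
    obtain ⟨s, hs⟩ := h.exists_eq_some (lt_of_le_of_ne (hx _) (Ne.symm hne))
    obtain ⟨i, hi, his, -⟩ := exists_isFirstAfter (paint c) (zero_le (a := s))
    have hci : c i = some (appearanceOrder c j) := by
      rcases his with rfl | ⟨h', -⟩
      exacts [hs, h'.trans hs]
    exact hj i hi (appearanceOrder_injective (appearanceOrder_rank hc hi hci))

/-- The first `k` colours in order of appearance are `j 0, …, j (k - 1)`, they all appear before
time `t`, and no other ones do. -/
def StartsWithBefore (j : ℕ → ℕ) (k t : ℕ) (c : ℕ → Option ℕ) : Prop :=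
  AllBefore c ((Finset.range k).image j) t ∧
    ∀ i < k, j i ∉ (Finset.range i).image j ∧
      ∃ s < t, c s = some (j i) ∧ AllBefore c ((Finset.range i).image j) s

theorem startsWithBefore_congr {j : ℕ → ℕ} {k t : ℕ} {c' : ℕ → Option ℕ}
    (h : ∀ s < t, c s = c' s) : StartsWithBefore j k t c ↔ StartsWithBefore j k t c' := by
  have hall : ∀ S s, s ≤ t → (AllBefore c S s ↔ AllBefore c' S s) := fun S s hs =>
    forall₂_congr fun r hr => by rw [h r (hr.trans_le hs)]
  refine and_congr (hall _ _ le_rfl) (forall₂_congr fun i _ => and_congr_right fun _ =>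
    exists_congr fun s => and_congr_right fun hs => ?_)
  rw [h s hs, hall _ s hs.le]

/-- The first departure from the colours `j 0, …, j (k - 1)` into `G` happens at one time `t`.
Fixing `t` separates a condition on the past from one on the colour at `t`, as needed for
independence. -/
theorem startsWith_and_exists_iff {j : ℕ → ℕ} {k : ℕ} {G : Set (Option ℕ)}
    (hG : ∀ i < k, some (j i) ∉ G) :
    (StartsWith j k c ∧ ∃ t, c t ∈ G ∧ AllBefore c ((Finset.range k).image j) t) ↔
      ∃ t, StartsWithBefore j k t c ∧ c t ∈ G := by
  constructor
  · rintro ⟨h, t, ht, hall⟩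
    refine ⟨t, ⟨hall, fun i hi => ⟨(h i hi).1, ?_⟩⟩, ht⟩
    obtain ⟨s, hs, hb⟩ := (h i hi).2
    refine ⟨s, ?_, hs, hb⟩
    by_contra hlt
    rcases (not_lt.1 hlt).eq_or_lt with rfl | hts
    · exact hG i hi (hs ▸ ht)
    · obtain ⟨l, hl, hcl⟩ := hb t hts
      obtain ⟨i', hi', rfl⟩ := Finset.mem_image.1 hl
      exact hG i' ((Finset.mem_range.1 hi').trans hi) (hcl ▸ ht)
  · rintro ⟨t, ⟨hall, h⟩, ht⟩
    refine ⟨fun i hi => ⟨(h i hi).1, ?_⟩, t, ht, hall⟩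
    obtain ⟨s, -, hs, hb⟩ := (h i hi).2
    exact ⟨s, hs, hb⟩

theorem startsWithBefore_unique {j : ℕ → ℕ} {k : ℕ} {G : Set (Option ℕ)}
    (hG : ∀ i < k, some (j i) ∉ G) {t t' : ℕ} (h : StartsWithBefore j k t c) (ht : c t ∈ G)
    (h' : StartsWithBefore j k t' c) (ht' : c t' ∈ G) : t = t' := by
  have key : ∀ t t', c t ∈ G → StartsWithBefore j k t' c → ¬ t < t' := by
    intro t t' ht h' hlt
    obtain ⟨l, hl, hcl⟩ := h'.1 t hlt
    obtain ⟨i', hi', rfl⟩ := Finset.mem_image.1 hl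
    exact hG i' (Finset.mem_range.1 hi') (hcl ▸ ht)
  exact le_antisymm (not_lt.1 (key t' t ht' h)) (not_lt.1 (key t t' ht h'))

end AppearanceOrder

/-! ### Sampling gives a size-biased permutation -/

section SizeBiased

instance : MeasurableSpace (Option ℕ) := ⊤

instance : DiscreteMeasurableSpace (Option ℕ) := ⟨fun _ => trivial⟩

theorem measurable_colour : Measurable fun z : (ℕ → ℝ) × ℝ => colour z.1 z.2 := by
  have hsome : ∀ k, MeasurableSet ((fun z : (ℕ → ℝ) × ℝ => colour z.1 z.2) ⁻¹' {some k}) :=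
    measurableSet_colour
  refine measurable_to_countable' fun o => ?_
  cases o with
  | some k => exact hsome k
  | none =>
    have : (fun z : (ℕ → ℝ) × ℝ => colour z.1 z.2) ⁻¹' {none} =
        (⋃ k, (fun z : (ℕ → ℝ) × ℝ => colour z.1 z.2) ⁻¹' {some k})ᶜ := by
      ext z
      simp [Option.eq_none_iff_forall_ne_some]
    rw [this]
    exact (MeasurableSet.iUnion hsome).compl

/-- The sequence of colours in the paintbox construction. -/
noncomputable def colours (x u : ℕ → ℝ) (t : ℕ) : Option ℕ := colour x (u t)

theorem measurable_colours : Measurable fun z : (ℕ → ℝ) × (ℕ → ℝ) => colours z.1 z.2 :=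
  measurable_pi_lambda _ fun t => measurable_colour.comp
    (show Measurable fun z : (ℕ → ℝ) × (ℕ → ℝ) => (z.1, z.2 t) by fun_prop)

theorem measurable_colours_right (x : ℕ → ℝ) : Measurable (colours x) :=
  measurable_colours.comp measurable_prodMk_left

theorem measurableSet_coord (t : ℕ) (o : Option ℕ) :
    MeasurableSet {c : ℕ → Option ℕ | c t = o} :=
  (measurable_pi_apply (X := fun _ => Option ℕ) t) (MeasurableSet.of_discrete (s := {o}))

theorem measurableSet_allBefore (S : Finset ℕ) (t : ℕ) :
    MeasurableSet {c : ℕ → Option ℕ | AllBefore c S t} := by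
  have : {c : ℕ → Option ℕ | AllBefore c S t} =
      ⋂ r, ⋂ _ : r < t, ⋃ l ∈ S, {c : ℕ → Option ℕ | c r = some l} := by
    ext c; simp [AllBefore]
  rw [this]
  exact MeasurableSet.iInter fun r => MeasurableSet.iInter fun _ =>
    Finset.measurableSet_biUnion _ fun l _ => measurableSet_coord r _

theorem measurableSet_firstNew (S : Finset ℕ) (m : ℕ) :
    MeasurableSet {c : ℕ → Option ℕ | FirstNew c S m} := by
  have : {c : ℕ → Option ℕ | FirstNew c S m} = {_c | m ∉ S} ∩
      ⋃ s, ({c : ℕ → Option ℕ | c s = some m} ∩ {c | AllBefore c S s}) := by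
    ext c; simp [FirstNew]
  rw [this]
  exact (MeasurableSet.const _).inter (MeasurableSet.iUnion fun s =>
    (measurableSet_coord s _).inter (measurableSet_allBefore S s))

theorem measurable_nextColour (S : Finset ℕ) :
    Measurable fun c : ℕ → Option ℕ => nextColour c S := by
  refine measurable_to_countable' fun m => ?_
  have : (fun c : ℕ → Option ℕ => nextColour c S) ⁻¹' {m} = {c | FirstNew c S m} ∪
      ({_c | (Infinite.exists_notMem_finset S).choose = m} ∩
        (⋃ m', {c | FirstNew c S m'})ᶜ) := by
    ext c
    simp only [Set.mem_preimage, Set.mem_singleton_iff, Set.mem_union, Set.mem_inter_iff,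
      Set.mem_compl_iff, Set.mem_iUnion, Set.mem_ofPred_eq]
    by_cases h : ∃ m', FirstNew c S m'
    · have hspec := h.choose_spec
      simp only [h, not_true, and_false, or_false]
      exact ⟨fun hm => by rwa [← hm, hspec.nextColour_eq], fun hm => hm.nextColour_eq⟩
    · rw [nextColour_of_not h]
      simp only [h, not_false_eq_true, and_true]
      exact (or_iff_right fun hm => h ⟨m, hm⟩).symm
  rw [this]
  exact (measurableSet_firstNew S m).union ((MeasurableSet.const _).inter
    (MeasurableSet.iUnion fun m' => measurableSet_firstNew S m').compl)

theorem measurableSet_appearanceOrder_eq (j : ℕ → ℕ) (k : ℕ) :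
    MeasurableSet {c : ℕ → Option ℕ | ∀ i < k, appearanceOrder c i = j i} := by
  have : {c : ℕ → Option ℕ | ∀ i < k, appearanceOrder c i = j i} =
      ⋂ i, ⋂ _ : i < k, (fun c => nextColour c ((Finset.range i).image j)) ⁻¹' {j i} := by
    ext c
    simp only [Set.mem_ofPred_eq, appearanceOrder_eq_iff]
    simp
  rw [this]
  exact MeasurableSet.iInter fun i => MeasurableSet.iInter fun _ =>
    measurable_nextColour _ (measurableSet_singleton _)

/-- A value at time `k` is a countable union over the possible prefixes ending with it. -/
theorem measurable_appearanceOrder : Measurable appearanceOrder := by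
  refine measurable_pi_lambda _ fun k => measurable_to_countable' fun m => ?_
  have : (fun c => appearanceOrder c k) ⁻¹' {m} =
      ⋃ j : {j : Fin (k + 1) → ℕ // j (Fin.last k) = m},
        {c : ℕ → Option ℕ | ∀ i < k + 1,
          appearanceOrder c i = if h : i < k + 1 then j.1 ⟨i, h⟩ else 0} := by
    ext c
    simp only [Set.mem_preimage, Set.mem_singleton_iff, Set.mem_iUnion, Set.mem_ofPred_eq]
    constructor
    · rintro rfl
      exact ⟨⟨fun i => appearanceOrder c i, rfl⟩, fun i hi => by rw [dif_pos hi]⟩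
    · rintro ⟨⟨j, hj⟩, h⟩
      rw [h k (Nat.lt_succ_self k), dif_pos (Nat.lt_succ_self k)]
      exact hj
  rw [this]
  exact MeasurableSet.iUnion fun j => measurableSet_appearanceOrder_eq _ _

theorem measurableSet_startsWithBefore (j : ℕ → ℕ) (k t : ℕ) :
    MeasurableSet {c | StartsWithBefore j k t c} := by
  have : {c | StartsWithBefore j k t c} = {c | AllBefore c ((Finset.range k).image j) t} ∩
      ⋂ i, ⋂ _ : i < k, ({_c | j i ∉ (Finset.range i).image j} ∩
        ⋃ s, ⋃ _ : s < t, ({c : ℕ → Option ℕ | c s = some (j i)} ∩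
          {c | AllBefore c ((Finset.range i).image j) s})) := by
    ext c
    simp only [StartsWithBefore, Set.mem_ofPred_eq, Set.mem_inter_iff, Set.mem_iInter,
      Set.mem_iUnion, exists_prop]
  rw [this]
  exact (measurableSet_allBefore _ _).inter (MeasurableSet.iInter fun i =>
    MeasurableSet.iInter fun _ => (MeasurableSet.const _).inter (MeasurableSet.iUnion fun s =>
      MeasurableSet.iUnion fun _ => (measurableSet_coord s _).inter (measurableSet_allBefore _ _)))

variable {x : ℕ → ℝ}

theorem unifSeq_startsWithBefore_inter (x : ℕ → ℝ) (j : ℕ → ℕ) (k t : ℕ) (G : Set (Option ℕ)) :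
    unifSeq {u | StartsWithBefore j k t (colours x u) ∧ colours x u t ∈ G} =
      unifSeq {u | StartsWithBefore j k t (colours x u)} * unif {s | colour x s ∈ G} := by
  have hcol : Measurable (colour x) := measurable_colour.comp measurable_prodMk_left
  have hind : iIndepFun (fun i (u : ℕ → ℝ) => colour x (u i)) unifSeq :=
    iIndepFun_infinitePi (P := fun _ : ℕ => unif) fun _ => hcol
  have hpair := hind.indepFun_finset (Finset.range t) {t} (by simp)
    fun i => hcol.comp (measurable_pi_apply i)
  -- Continuing with `none` from `t` on exhibits the event as one about the first `t` colours; the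
  -- continuation is never inspected.
  let ext : (Finset.range t → Option ℕ) → ℕ → Option ℕ :=
    fun v i => if h : i ∈ Finset.range t then v ⟨i, h⟩ else none
  have hext : Measurable ext := by
    refine measurable_pi_lambda _ fun i => ?_
    by_cases h : i ∈ Finset.range t
    · simp only [ext, dif_pos h]
      exact measurable_pi_apply _
    · simp only [ext, dif_neg h]
      exact measurable_const
  have hA := hext (measurableSet_startsWithBefore j k t)
  have hB : MeasurableSet {v : ({t} : Finset ℕ) → Option ℕ | v ⟨t, Finset.mem_singleton_self t⟩ ∈ G} :=
    measurable_pi_apply (⟨t, Finset.mem_singleton_self t⟩ : ({t} : Finset ℕ))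
      (MeasurableSet.of_discrete (s := G))
  have h := hpair.measure_inter_preimage_eq_mul _ _ hA hB
  have h1 : (fun (u : ℕ → ℝ) (i : Finset.range t) => colour x (u i)) ⁻¹'
      (ext ⁻¹' {c | StartsWithBefore j k t c}) =
      {u | StartsWithBefore j k t (colours x u)} := by
    ext u
    refine startsWithBefore_congr fun s hs => ?_
    simp only [ext, Finset.mem_range, dif_pos hs]
    rfl
  rw [h1] at h
  refine h.trans (congrArg _ ?_)
  exact (measurePreserving_eval_infinitePi (fun _ : ℕ => unif) t).measure_preimage
    (hcol (MeasurableSet.of_discrete (s := G))).nullMeasurableSet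

/-- Summation over the time of departure. The first factor does not depend on `G`, so probabilities
for two choices of `G` can be compared without evaluating the series. -/
theorem unifSeq_startsWith_and (x : ℕ → ℝ) {j : ℕ → ℕ} {k : ℕ} {G : Set (Option ℕ)}
    (hG : ∀ i < k, some (j i) ∉ G) :
    unifSeq {u | StartsWith j k (colours x u) ∧ ∃ t, colours x u t ∈ G ∧
        AllBefore (colours x u) ((Finset.range k).image j) t} =
      (∑' t, unifSeq {u | StartsWithBefore j k t (colours x u)}) * unif {s | colour x s ∈ G} := by
  have h1 : {u | StartsWith j k (colours x u) ∧ ∃ t, colours x u t ∈ G ∧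
        AllBefore (colours x u) ((Finset.range k).image j) t} =
      ⋃ t, {u | StartsWithBefore j k t (colours x u) ∧ colours x u t ∈ G} := by
    ext u
    rw [Set.mem_iUnion]
    exact startsWith_and_exists_iff hG
  rw [h1, measure_iUnion, ← ENNReal.tsum_mul_right]
  · simp only [unifSeq_startsWithBefore_inter]
  · intro t t' hne
    exact Set.disjoint_left.2 fun u hu hu' =>
      hne (startsWithBefore_unique hG hu.1 hu.2 hu'.1 hu'.2)
  · intro t
    exact (measurable_colours_right x (measurableSet_startsWithBefore j k t)).inter
      (measurable_colours_right x (measurable_pi_apply t (MeasurableSet.of_discrete (s := G))))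

theorem unif_colour_mem (hx : IsSubProb x) (S : Finset ℕ) :
    unif.real {s | ∃ l ∈ S, colour x s = some l} = ∑ l ∈ S, x l := by
  have : {s | ∃ l ∈ S, colour x s = some l} = ⋃ l ∈ S, {s | colour x s = some l} := by
    ext s; simp
  rw [this, measureReal_biUnion_finset _ fun l _ => measurableSet_colour_right x l]
  · exact Finset.sum_congr rfl fun l _ => unif_colour hx l
  · intro l _ l' _ hne
    exact Set.disjoint_left.2 fun s hs hs' => hne (Option.some_inj.1 (hs.symm.trans hs'))

/-- Compare two choices of `G`: the single colour `j k`, and everything outside of `S`. The second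
event is almost surely just the prefix event, because `j k` has positive frequency and so forces a
departure from `S`. The common factor cancels, leaving the ratio of the two interval lengths. -/
theorem unifSeq_startsWith_succ (hx : IsSubProb x) {j : ℕ → ℕ} {k : ℕ}
    (hj : Set.InjOn j (Set.Iio (k + 1))) (hpos : 0 < x (j k)) :
    unifSeq.real {u | StartsWith j (k + 1) (colours x u)} =
      unifSeq.real {u | StartsWith j k (colours x u)} *
        (x (j k) / (1 - ∑ l ∈ Finset.range k, x (j l))) := by
  set S := (Finset.range k).image j with hS
  have hjS : j k ∉ S := by
    rw [hS, Finset.mem_image]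
    rintro ⟨i, hi, hij⟩
    have hik := Finset.mem_range.1 hi
    exact hik.ne (hj (Set.mem_Iio.2 (by omega)) (Set.mem_Iio.2 (by omega)) hij)
  have hsumS : ∑ l ∈ S, x l = ∑ l ∈ Finset.range k, x (j l) :=
    Finset.sum_image fun i hi i' hi' h => hj (Set.mem_Iio.2 (by
      have := Finset.mem_range.1 hi; omega)) (Set.mem_Iio.2 (by
      have := Finset.mem_range.1 hi'; omega)) h
  have hnew : {u | StartsWith j (k + 1) (colours x u)} =
      {u | StartsWith j k (colours x u) ∧ ∃ t, colours x u t ∈ ({some (j k)} : Set (Option ℕ)) ∧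
        AllBefore (colours x u) S t} := by
    ext u
    refine Nat.forall_lt_succ_right.trans (and_congr_right fun _ => ?_)
    exact and_iff_right hjS
  have hold : {u | StartsWith j k (colours x u)} =ᵐ[unifSeq]
      {u | StartsWith j k (colours x u) ∧ ∃ t, colours x u t ∈ {o | ¬ ∃ l ∈ S, o = some l} ∧
        AllBefore (colours x u) S t} := by
    filter_upwards [ae_hasFreqs hx] with u hu
    refine propext ((and_iff_left ?_).symm)
    classical
    have hex : ∃ t, ¬ ∃ l ∈ S, colours x u t = some l := by
      obtain ⟨t, ht⟩ := hu.exists_eq_some hpos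
      refine ⟨t, fun ⟨l, hl, hcl⟩ => hjS ?_⟩
      have := Option.some_inj.1 (Eq.trans (Eq.symm ht) hcl)
      rwa [this]
    exact ⟨Nat.find hex, Nat.find_spec hex, fun r hr => not_not.1 (Nat.find_min hex hr)⟩
  have h1 := unifSeq_startsWith_and x (j := j) (k := k) (G := {some (j k)}) fun i hi h => by
    have := Option.some_inj.1 h
    exact hjS (this ▸ Finset.mem_image_of_mem _ (Finset.mem_range.2 hi))
  have h2 := unifSeq_startsWith_and x (j := j) (k := k) (G := {o | ¬ ∃ l ∈ S, o = some l})
    fun i hi h => h ⟨j i, Finset.mem_image_of_mem _ (Finset.mem_range.2 hi), rfl⟩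
  rw [← hS] at h1 h2
  have h3 : unif.real {s | colour x s ∈ {o | ¬ ∃ l ∈ S, o = some l}} = 1 - ∑ l ∈ S, x l := by
    have hm : MeasurableSet {s | ∃ l ∈ S, colour x s = some l} :=
      (measurable_colour.comp (measurable_prodMk_left (x := x)))
        (MeasurableSet.of_discrete (s := {o : Option ℕ | ∃ l ∈ S, o = some l}))
    rw [← unif_colour_mem hx S, ← probReal_compl_eq_one_sub hm]
    rfl
  have hlt : 0 < 1 - ∑ l ∈ S, x l := by
    have h4 := unif_colour_mem hx (insert (j k) S)
    rw [Finset.sum_insert hjS] at h4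
    have h5 : unif.real {s | ∃ l ∈ insert (j k) S, colour x s = some l} ≤ 1 := measureReal_le_one
    linarith
  rw [measureReal_congr hold, hnew, Measure.real, Measure.real, h1, h2, ENNReal.toReal_mul,
    ENNReal.toReal_mul, ← hsumS]
  change _ * unif.real {s | colour x s = some (j k)} = _ * unif.real _ * _
  rw [unif_colour hx, h3]
  field_simp

theorem unifSeq_startsWith (hx : IsSubProb x) {j : ℕ → ℕ} {k : ℕ}
    (hj : Set.InjOn j (Set.Iio k)) (hpos : ∀ i < k, 0 < x (j i)) :
    unifSeq.real {u | StartsWith j k (colours x u)} =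
      ∏ i ∈ Finset.range k, x (j i) / (1 - ∑ l ∈ Finset.range i, x (j l)) := by
  induction k with
  | zero =>
    have : {u | StartsWith j 0 (colours x u)} = Set.univ :=
      Set.eq_univ_of_forall fun u i hi => absurd hi (Nat.not_lt_zero i)
    rw [this, probReal_univ, Finset.range_zero, Finset.prod_empty]
  | succ k ih =>
    rw [unifSeq_startsWith_succ hx hj (hpos k (Nat.lt_succ_self k)), Finset.prod_range_succ,
      ih (hj.mono (Set.Iio_subset_Iio (Nat.le_succ k))) fun i hi => hpos i (hi.trans
        (Nat.lt_succ_self k))]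

theorem isSubProb_of_hasSum (hx : ∀ j, 0 ≤ x j) (h : HasSum x 1) : IsSubProb x :=
  ⟨hx, fun _ => sum_le_hasSum _ (fun j _ => hx j) h⟩

/-- The intervals have total length one, so they exhaust the unit interval up to a null set. -/
theorem ae_colours_ne_none (hx : ∀ j, 0 ≤ x j) (h : HasSum x 1) :
    ∀ᵐ u ∂unifSeq, ∀ t, colours x u t ≠ none := by
  have hsub := isSubProb_of_hasSum hx h
  have h1 : ∀ᵐ s ∂unif, colour x s ≠ none := by
    have h2 : unif (⋃ k, {s | colour x s = some k}) = 1 := by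
      rw [measure_iUnion]
      · have h3 : ∀ k, unif {s | colour x s = some k} = ENNReal.ofReal (x k) := fun k => by
          rw [← unif_colour hsub k, ofReal_measureReal]
        simp only [h3]
        rw [← ENNReal.ofReal_tsum_of_nonneg hx h.summable, h.tsum_eq, ENNReal.ofReal_one]
      · intro l l' hne
        exact Set.disjoint_left.2 fun s hs hs' => hne (Option.some_inj.1 (hs.symm.trans hs'))
      · exact fun k => measurableSet_colour_right x k
    have hm : MeasurableSet (⋃ k, {s | colour x s = some k}) :=
      MeasurableSet.iUnion fun k => measurableSet_colour_right x k
    have h4 := (prob_compl_eq_zero_iff hm).2 h2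
    filter_upwards [measure_eq_zero_iff_ae_notMem.1 h4] with s hs hnone
    refine hs fun hmem => ?_
    obtain ⟨k, hk⟩ := Set.mem_iUnion.1 hmem
    exact absurd (hnone.symm.trans hk) (by simp)
  rw [ae_all_iff]
  exact fun t => (measurePreserving_eval_infinitePi (fun _ : ℕ => unif)
    t).quasiMeasurePreserving.ae h1

theorem unifSeq_appearanceOrder (hx : ∀ j, 0 ≤ x j) (h : HasSum x 1) {j : ℕ → ℕ} {k : ℕ}
    (hj : Set.InjOn j (Set.Iio k)) (hpos : ∀ i < k, 0 < x (j i)) :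
    unifSeq.real {u | ∀ i < k, appearanceOrder (colours x u) i = j i} =
      ∏ i ∈ Finset.range k, x (j i) / (1 - ∑ l ∈ Finset.range i, x (j l)) := by
  have hsub := isSubProb_of_hasSum hx h
  rw [← unifSeq_startsWith hsub hj hpos]
  refine measureReal_congr ?_
  filter_upwards [ae_hasFreqs hsub, ae_colours_ne_none hx h] with u hu hc
  exact propext (startsWith_iff hc fun i hi => hu.exists_eq_some (hpos i hi)).symm

/-- The joint law of a random sequence and of its indices in the order of a sample. -/
noncomputable def sampleLaw (L : Measure (ℕ → ℝ)) : Measure ((ℕ → ℝ) × (ℕ → ℕ)) :=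
  (L.prod unifSeq).map fun z => (z.1, appearanceOrder (colours z.1 z.2))

theorem measurable_sample : Measurable fun z : (ℕ → ℝ) × (ℕ → ℝ) =>
    (z.1, appearanceOrder (colours z.1 z.2)) :=
  measurable_fst.prodMk (measurable_appearanceOrder.comp measurable_colours)

theorem map_fst_sampleLaw (L : Measure (ℕ → ℝ)) : (sampleLaw L).map Prod.fst = L := by
  rw [sampleLaw, Measure.map_map measurable_fst measurable_sample]
  exact Measure.map_fst_prod.trans (by simp)

variable {L : Measure (ℕ → ℝ)} [IsProbabilityMeasure L]

instance : IsProbabilityMeasure (sampleLaw L) :=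
  Measure.isProbabilityMeasure_map measurable_sample.aemeasurable

/-- The sampling variables are independent of the sequence, so by Fubini conditioning on the
sequence amounts to freezing it. -/
theorem condExp_sampleLaw {E : Set (ℕ → ℕ)} (hE : MeasurableSet E) :
    (fun z => unifSeq.real {u | appearanceOrder (colours z.1 u) ∈ E}) =ᵐ[sampleLaw L]
      (sampleLaw L)⟦{y | y.2 ∈ E} | MeasurableSpace.comap Prod.fst inferInstance⟧ := by
  have hD : MeasurableSet {z : (ℕ → ℝ) × (ℕ → ℝ) | appearanceOrder (colours z.1 z.2) ∈ E} :=
    (measurable_appearanceOrder.comp measurable_colours) hE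
  have hg : Measurable fun x : ℕ → ℝ =>
      unifSeq.real {u | appearanceOrder (colours x u) ∈ E} :=
    (measurable_measure_prodMk_left (ν := unifSeq) hD).ennreal_toReal
  have hm : MeasurableSpace.comap (Prod.fst : (ℕ → ℝ) × (ℕ → ℕ) → _) inferInstance ≤
      (inferInstance : MeasurableSpace ((ℕ → ℝ) × (ℕ → ℕ))) := measurable_fst.comap_le
  have hE' : MeasurableSet {y : (ℕ → ℝ) × (ℕ → ℕ) | y.2 ∈ E} := measurable_snd hE
  have hgi : Integrable (fun x : ℕ → ℝ =>
      unifSeq.real {u | appearanceOrder (colours x u) ∈ E}) L :=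
    integrable_of_mem_unit hg (fun _ => measureReal_nonneg) fun _ => measureReal_le_one
  refine ae_eq_condExp_of_forall_setIntegral_eq hm
    ((integrable_const (1 : ℝ)).indicator hE') (fun s _ _ => ?_) (fun s hs _ => ?_) ?_
  · exact (integrable_of_mem_unit (hg.comp measurable_fst) (fun _ => measureReal_nonneg)
      fun _ => measureReal_le_one).integrableOn
  · obtain ⟨T, hT, rfl⟩ := hs
    have hTm : MeasurableSet ((Prod.fst : (ℕ → ℝ) × (ℕ → ℕ) → _) ⁻¹' T) := measurable_fst hT
    rw [setIntegral_indicator hE', setIntegral_const, smul_eq_mul, mul_one]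
    have h1 : ∫ z in Prod.fst ⁻¹' T, unifSeq.real {u | appearanceOrder (colours z.1 u) ∈ E}
        ∂sampleLaw L = ∫ x in T, unifSeq.real {u | appearanceOrder (colours x u) ∈ E} ∂L := by
      conv_rhs => rw [← map_fst_sampleLaw L]
      rw [setIntegral_map hT hg.aestronglyMeasurable measurable_fst.aemeasurable]
    rw [h1, sampleLaw, map_measureReal_apply measurable_sample (hTm.inter hE')]
    have h2 : (fun z : (ℕ → ℝ) × (ℕ → ℝ) => (z.1, appearanceOrder (colours z.1 z.2))) ⁻¹'
        (Prod.fst ⁻¹' T ∩ {y | y.2 ∈ E}) =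
        Prod.fst ⁻¹' T ∩ {z | appearanceOrder (colours z.1 z.2) ∈ E} := rfl
    rw [h2, Measure.real, Measure.prod_apply ((measurable_fst hT).inter hD),
      ← integral_indicator hT, integral_eq_lintegral_of_nonneg_ae]
    · congr 1
      refine lintegral_congr fun x => ?_
      by_cases hxT : x ∈ T
      · rw [Set.indicator_of_mem hxT, ofReal_measureReal]
        congr 1
        ext u
        exact (and_iff_right hxT).symm
      · rw [Set.indicator_of_notMem hxT, ENNReal.ofReal_zero]
        symm
        refine measure_mono_null (fun u hu => hxT hu.1) measure_empty
    · exact ae_of_all _ fun x => Set.indicator_nonneg (fun _ _ => measureReal_nonneg) x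
    · exact (hg.indicator hT).aestronglyMeasurable
  · exact (hg.comp (comap_measurable Prod.fst)).aestronglyMeasurable

theorem measurableSet_nonneg_hasSum :
    MeasurableSet {x : ℕ → ℝ | (∀ j, 0 ≤ x j) ∧ HasSum x 1} := by
  have : {x : ℕ → ℝ | (∀ j, 0 ≤ x j) ∧ HasSum x 1} = (⋂ j, {x | 0 ≤ x j}) ∩
      {x | Tendsto (fun n => ∑ j ∈ Finset.range n, x j) atTop (𝓝 1)} := by
    ext x
    simp only [Set.mem_ofPred_eq, Set.mem_inter_iff, Set.mem_iInter]
    exact and_congr_right fun h => hasSum_iff_tendsto_nat_of_nonneg h 1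
  rw [this]
  refine (MeasurableSet.iInter fun j => measurableSet_le measurable_const
    (measurable_pi_apply j)).inter ?_
  exact measurableSet_tendsto_fun
    (fun n => Finset.measurable_sum _ fun j _ => measurable_pi_apply j) measurable_const

theorem map_comp_sampleLaw (hL : ∀ᵐ x ∂L, (∀ j, 0 ≤ x j) ∧ HasSum x 1) :
    (sampleLaw L).map (fun z j => z.1 (z.2 j)) =
      ((L.prod unifSeq).map paintbox).map fun π => appearanceFreq π 0 := by
  have hm : Measurable fun (z : (ℕ → ℝ) × (ℕ → ℕ)) (j : ℕ) => z.1 (z.2 j) := by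
    refine measurable_pi_lambda _ fun j => ?_
    have h1 : Measurable fun p : (ℕ → ℝ) × ℕ => p.1 p.2 :=
      measurable_from_prod_countable_left fun i => measurable_pi_apply i
    exact h1.comp (measurable_fst.prodMk ((measurable_pi_apply j).comp measurable_snd))
  rw [sampleLaw, Measure.map_map hm measurable_sample,
    Measure.map_map (measurable_appearanceFreq 0) measurable_paintbox]
  refine Measure.map_congr ?_
  have hsub : ∀ᵐ x ∂L, IsSubProb x := by
    filter_upwards [hL] with x hx
    exact isSubProb_of_hasSum hx.1 hx.2
  have hnone : ∀ᵐ z ∂L.prod unifSeq, ∀ t, colours z.1 z.2 t ≠ none := by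
    rw [Measure.ae_prod_iff_ae_ae]
    · filter_upwards [hL] with x hx
      exact ae_colours_ne_none hx.1 hx.2
    · have : {z : (ℕ → ℝ) × (ℕ → ℝ) | ∀ t, colours z.1 z.2 t ≠ none} =
          ⋂ t, ((fun z : (ℕ → ℝ) × (ℕ → ℝ) => colours z.1 z.2) ⁻¹' {c | c t = none})ᶜ := by
        ext z; simp
      rw [this]
      exact MeasurableSet.iInter fun t => (measurable_colours (measurableSet_coord t _)).compl
  filter_upwards [ae_hasFreqs_prod hsub, hnone,
    Measure.quasiMeasurePreserving_fst.ae hL] with z h1 h2 h3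
  exact funext fun j => h1.appearanceOrder_eq h3.1 h2 j

theorem isSizeBiasedPermutation_paintbox (hL : ∀ᵐ x ∂L, (∀ j, 0 ≤ x j) ∧ HasSum x 1) :
    IsSizeBiasedPermutation L
      (((L.prod unifSeq).map paintbox).map fun π => appearanceFreq π 0) := by
  refine ⟨hL, sampleLaw L, inferInstance, map_fst_sampleLaw L, map_comp_sampleLaw hL, ?_, ?_⟩
  · have hinj : MeasurableSet {z : (ℕ → ℝ) × (ℕ → ℕ) | Function.Injective z.2} := by
      have : {z : (ℕ → ℝ) × (ℕ → ℕ) | Function.Injective z.2} =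
          ⋂ i, ⋂ j, ⋂ _ : i ≠ j, {z : (ℕ → ℝ) × (ℕ → ℕ) | z.2 i = z.2 j}ᶜ := by
        ext z
        simp only [Set.mem_ofPred_eq, Set.mem_iInter, Set.mem_compl_iff]
        exact ⟨fun h i j hne heq => hne (h heq), fun h i j heq => by
          by_contra hne
          exact h i j hne heq⟩
      rw [this]
      exact MeasurableSet.iInter fun i => MeasurableSet.iInter fun j => MeasurableSet.iInter
        fun _ => (measurableSet_eq_fun ((measurable_pi_apply i).comp measurable_snd)
          ((measurable_pi_apply j).comp measurable_snd)).compl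
    exact (ae_map_iff measurable_sample.aemeasurable hinj).2
      (ae_of_all _ fun z => appearanceOrder_injective)
  · intro k j hj
    -- Extension to all indices; only the values below `k` enter.
    let j' : ℕ → ℕ := fun i => if h : i < k then j ⟨i, h⟩ else 0
    have hj' : ∀ i : Fin k, j' i = j i := fun i => dif_pos i.2
    have hinj : Set.InjOn j' (Set.Iio k) := by
      intro a ha b hb hab
      have h1 := hj' ⟨a, ha⟩
      have h2 := hj' ⟨b, hb⟩
      simp only at h1 h2
      rw [h1, h2] at hab
      exact congrArg Fin.val (hj hab)
    have hEm : MeasurableSet {σ : ℕ → ℕ | ∀ i : Fin k, σ i = j i} := by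
      have : {σ : ℕ → ℕ | ∀ i : Fin k, σ i = j i} =
          ⋂ i : Fin k, (fun σ : ℕ → ℕ => σ i) ⁻¹' {j i} := by ext σ; simp
      rw [this]
      exact MeasurableSet.iInter fun i => measurable_pi_apply _ (measurableSet_singleton _)
    have hLz : ∀ᵐ z ∂sampleLaw L, (∀ j, 0 ≤ z.1 j) ∧ HasSum z.1 1 := by
      refine ae_of_ae_map measurable_fst.aemeasurable (p := fun x : ℕ → ℝ =>
        (∀ j, 0 ≤ x j) ∧ HasSum x 1) ?_
      rwa [map_fst_sampleLaw]
    filter_upwards [condExp_sampleLaw (L := L) hEm, hLz] with z hz hsum hpos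
    refine hz.symm.trans ?_
    have hset : {u | ∀ i : Fin k, appearanceOrder (colours z.1 u) i = j i} =
        {u | ∀ i < k, appearanceOrder (colours z.1 u) i = j' i} := by
      ext u
      refine ⟨fun h i hi => (h ⟨i, hi⟩).trans (hj' ⟨i, hi⟩).symm, fun h i => ?_⟩
      exact (h i i.2).trans (hj' i)
    change unifSeq.real {u | ∀ i : Fin k, appearanceOrder (colours z.1 u) i = j i} = _
    rw [hset, unifSeq_appearanceOrder hsum.1 hsum.2 hinj fun i hi => by
      rw [hj' ⟨i, hi⟩]; exact hpos ⟨i, hi⟩]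
    rw [← Fin.prod_univ_eq_prod_range
      (fun i => z.1 (j' i) / (1 - ∑ l ∈ Finset.range i, z.1 (j' l))) k]
    refine Finset.prod_congr rfl fun i _ => ?_
    rw [hj', ← Nat.Iio_eq_range, ← Fin.map_valEmbedding_Iio, Finset.sum_map]
    simp only [Fin.valEmbedding_apply, hj']

end SizeBiased

/-! ### Assembly of the convergence and stationarity statements -/

section Main

theorem sizeProb_map {Ω : Type*} [MeasurableSpace Ω] {μ : Measure Ω} {X : Ω → Setoid ℕ}
    (hX : Measurable X) : sizeProb (μ.map X) id = sizeProb μ X := by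
  funext n c
  unfold sizeProb
  split_ifs with h
  · exact map_measureReal_apply hX (measurableSet_restrict n _)
  · rfl

theorem HasPEPPF.measure_eq {P Q : Measure (Setoid ℕ)} [IsFiniteMeasure P] [IsFiniteMeasure Q]
    {p : CompositionFun} (hP : HasPEPPF P id p) (hQ : HasPEPPF Q id p) : P = Q := by
  refine ext_of_restrict 0 fun N _ s => ?_
  rw [← measureReal_eq_measureReal_iff]
  exact (hP N s).trans (hQ N s).symm

variable {P : Measure (Setoid ℕ)} [IsProbabilityMeasure P]

theorem tendsto_sizeProb_shift (hP : IsSwapInvariant P) {Q : Measure (Setoid ℕ)}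
    [IsProbabilityMeasure Q] (hQ : IsExchangeable Q id)
    (hPQ : P.map rankedFreq = Q.map rankedFreq) (m : ℕ) (c : Composition m) :
    Tendsto (fun n => sizeProb P (shift n) m c) atTop (𝓝 (sizeProb Q id m c)) := by
  unfold sizeProb
  split_ifs with h
  · exact tendsto_measureReal_restrict_shift hP hQ hPQ _
  · exact tendsto_const_nhds

theorem Regular.isSubProb_rankedFreq {π : Setoid ℕ} (hπ : Regular π) : IsSubProb (rankedFreq π) := by
  have h := hπ.sameCounts_rankedFreq_firstFreq.symm.hasSum (firstFreq_nonneg π)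
    (rankedFreq_nonneg π) hπ.summable_firstFreq.hasSum
  refine ⟨rankedFreq_nonneg π, fun n => (sum_le_hasSum _ (fun j _ => rankedFreq_nonneg π j) h).trans ?_⟩
  exact hπ.summable_firstFreq.tsum_le_of_sum_le hπ.sum_firstFreq_le_one

theorem isExchangeable_paintboxLaw {y : Setoid ℕ → ℕ → ℝ} (hy : Measurable y) :
    IsExchangeable (paintboxLaw P y) id := by
  have := Measure.isProbabilityMeasure_map (μ := P) hy.aemeasurable
  exact isExchangeable_paintbox _

theorem isProbabilityMeasure_paintboxLaw {y : Setoid ℕ → ℕ → ℝ} (hy : Measurable y) :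
    IsProbabilityMeasure (paintboxLaw P y) := by
  have := Measure.isProbabilityMeasure_map (μ := P) hy.aemeasurable
  exact Measure.isProbabilityMeasure_map measurable_paintbox.aemeasurable

theorem exists_isExchangeable_map_rankedFreq_eq (hP : IsSwapInvariant P) :
    ∃ Q : Measure (Setoid ℕ), IsProbabilityMeasure Q ∧ IsExchangeable Q id ∧
      P.map rankedFreq = Q.map rankedFreq := by
  have hreg := ae_regular hP
  refine ⟨paintboxLaw P rankedFreq, isProbabilityMeasure_paintboxLaw measurable_rankedFreq,
    isExchangeable_paintboxLaw measurable_rankedFreq,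
    (map_rankedFreq_paintboxLaw measurable_rankedFreq ?_ (ae_of_all _ fun _ _ _ => rfl) hreg).symm⟩
  filter_upwards [hreg] with π hπ
  exact hπ.isSubProb_rankedFreq

/-- The paintbox law built from `y` is exchangeable with the same ranked frequencies as `Q`, hence
equals `Q`. The order in which `y` lists its terms is irrelevant, which covers ranked frequencies
and frequencies in order of appearance at once. -/
theorem isSizeBiasedPermutation_of_sameCounts (hP : IsSwapInvariant P) {Q : Measure (Setoid ℕ)}
    [IsProbabilityMeasure Q] (hQ : IsExchangeable Q id)
    (hPQ : P.map rankedFreq = Q.map rankedFreq) (hsum : ∀ᵐ π ∂P, HasSum (rankedFreq π) 1)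
    {y : Setoid ℕ → ℕ → ℝ} (hy : Measurable y) (hy0 : ∀ π j, 0 ≤ y π j)
    (hc : ∀ᵐ π ∂P, SameCounts (rankedFreq π) (y π)) :
    IsSizeBiasedPermutation (P.map y) (Q.map fun π => appearanceFreq π 0) := by
  have := Measure.isProbabilityMeasure_map (μ := P) hy.aemeasurable
  have := isProbabilityMeasure_paintboxLaw (P := P) hy
  have h1 : ∀ᵐ π ∂P, (∀ j, 0 ≤ y π j) ∧ HasSum (y π) 1 := by
    filter_upwards [hsum, hc] with π h h'
    exact ⟨hy0 π, h'.hasSum (rankedFreq_nonneg π) (hy0 π) h⟩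
  have h2 : (paintboxLaw P y).map rankedFreq = P.map rankedFreq :=
    map_rankedFreq_paintboxLaw hy (h1.mono fun π h => isSubProb_of_hasSum h.1 h.2) hc
      (ae_regular hP)
  rw [eq_of_map_rankedFreq_eq hQ (isExchangeable_paintboxLaw hy) (hPQ.symm.trans h2.symm)]
  exact isSizeBiasedPermutation_paintbox
    ((ae_map_iff hy.aemeasurable measurableSet_nonneg_hasSum).2 h1)

theorem isExchangeable_tfae {p : CompositionFun} (h : HasPEPPF P id p) :
    [IsExchangeable P id, P.map (shift 1) = P, ∀ n, 1 ≤ n → P.map (shift n) = P,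
      sizeProb P (shift 1) = sizeProb P (shift 0),
      ∀ n, 1 ≤ n → sizeProb P (shift n) = sizeProb P (shift 0)].TFAE := by
  have hprob : ∀ n, IsProbabilityMeasure (P.map (shift n)) := fun n =>
    Measure.isProbabilityMeasure_map (measurable_shift n).aemeasurable
  have hone : P.map (shift 1) = P → ∀ n, P.map (shift n) = P := by
    intro h1 n
    induction n with
    | zero => rw [shift_zero, Measure.map_id]
    | succ n ih =>
      rw [← funext (shift_shift n 1), ← Function.comp_def,
        ← Measure.map_map (measurable_shift n) (measurable_shift 1), h1, ih]
  have hiff : ∀ n, sizeProb P (shift n) = sizeProb P (shift 0) ↔ P.map (shift n) = P := by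
    intro n
    refine ⟨fun hn => ?_, fun hn => ?_⟩
    · have h1 := (hasPEPPF_map (measurable_shift n)).2 (h.shift n)
      have h2 := h.shift 0
      rw [hn] at h1
      rw [shift_zero] at h1 h2
      exact h1.measure_eq h2
    · rw [← sizeProb_map (measurable_shift n), hn, shift_zero]
  simp only [hiff]
  tfae_have 1 → 3 := fun hex n _ => map_shift_eq_of_isExchangeable hex n
  tfae_have 3 → 2 := fun hn => hn 1 le_rfl
  tfae_have 2 → 4 := id
  tfae_have 4 → 5 := fun h1 n _ => hone h1 n
  -- Under stationarity the convergent sequence of laws of the shifts is constant, so `P` coincides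
  -- with its exchangeable limit.
  tfae_have 5 → 1 := by
    intro hn
    have hP := h.isSwapInvariant
    obtain ⟨Q, hQp, hQ, hPQ⟩ := exists_isExchangeable_map_rankedFreq_eq hP
    have hall := hone (hn 1 le_rfl)
    have hPQ' : P = Q := by
      refine ext_of_restrict 0 fun m _ s => ?_
      rw [← measureReal_eq_measureReal_iff]
      refine tendsto_nhds_unique ?_ (tendsto_measureReal_restrict_shift hP hQ hPQ s)
      refine tendsto_const_nhds.congr fun n => ?_
      conv_lhs => rw [← hall n]
      exact map_measureReal_apply (measurable_shift n) (measurableSet_restrict m s)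
    rwa [hPQ']
  tfae_finish

end Main

end RandomPartition

theorem theorem1 {Ω : Type*} [MeasurableSpace Ω] (μ : Measure Ω) [IsProbabilityMeasure μ]
    (X : Ω → Setoid ℕ) (hX : Measurable X)
    (hpe : RandomPartition.IsPartiallyExchangeable μ X) :
    -- almost surely, every cluster has a limiting relative frequency
    (∀ᵐ ω ∂μ, ∀ i : ℕ, Tendsto (RandomPartition.relFreq {m | X ω i m}) atTop
      (𝓝 (RandomPartition.freq {m | X ω i m}))) ∧
    -- there is an exchangeable partition with the same ranked frequencies
    (∃ (Ω' : Type) (_ : MeasurableSpace Ω') (ν : Measure Ω') (X' : Ω' → Setoid ℕ),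
      IsProbabilityMeasure ν ∧ Measurable X' ∧ RandomPartition.IsExchangeable ν X' ∧
      IdentDistrib (fun ω => RandomPartition.rankedFreq (X ω))
        (fun ω => RandomPartition.rankedFreq (X' ω)) μ ν) ∧
    -- all the shifted partitions are partially exchangeable, say with functions `p n`
    ∃ p : ℕ → RandomPartition.CompositionFun,
      (∀ n, RandomPartition.HasPEPPF μ (fun ω => RandomPartition.shift n (X ω)) (p n)) ∧
      -- convergence to any exchangeable partition with the same ranked frequencies
      (∀ (Ω' : Type*) [MeasurableSpace Ω'] (ν : Measure Ω') [IsProbabilityMeasure ν]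
        (X' : Ω' → Setoid ℕ), Measurable X' → RandomPartition.IsExchangeable ν X' →
        IdentDistrib (fun ω => RandomPartition.rankedFreq (X ω))
          (fun ω => RandomPartition.rankedFreq (X' ω)) μ ν →
        (∃ q : RandomPartition.CompositionFun, RandomPartition.HasPEPPF ν X' q ∧
          ∀ (m : ℕ) (c : Composition m), Tendsto (fun n => p n m c) atTop (𝓝 (q m c))) ∧
        (∀ J : Finset ℕ, TendstoInDistribution
          (fun (n : ℕ) (ω : Ω) (j : J) => RandomPartition.appearanceFreq (X ω) n j) atTop
          (fun (ω : Ω') (j : J) => RandomPartition.appearanceFreq (X' ω) 0 j)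
          (fun _ => μ) ν) ∧
        ((∀ᵐ ω ∂μ, HasSum (RandomPartition.rankedFreq (X ω)) 1) →
          RandomPartition.IsSizeBiasedPermutation
            (μ.map (fun ω => RandomPartition.rankedFreq (X ω)))
            (ν.map (fun ω => RandomPartition.appearanceFreq (X' ω) 0)) ∧
          ∀ n : ℕ, RandomPartition.IsSizeBiasedPermutation
            (μ.map (fun ω => RandomPartition.appearanceFreq (X ω) n))
            (ν.map (fun ω => RandomPartition.appearanceFreq (X' ω) 0)))) ∧
      -- exchangeability and stationarity
      [RandomPartition.IsExchangeable μ X,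
        IdentDistrib (fun ω => RandomPartition.shift 1 (X ω)) X μ μ,
        ∀ n, 1 ≤ n → IdentDistrib (fun ω => RandomPartition.shift n (X ω)) X μ μ,
        p 1 = p 0,
        ∀ n, 1 ≤ n → p n = p 0].TFAE := by
  -- All statements depend only on the law of the partition, so they are transferred to the space of
  -- partitions itself.
  set P := μ.map X with hPdef
  have : IsProbabilityMeasure P := Measure.isProbabilityMeasure_map hX.aemeasurable
  obtain ⟨p₀, hp₀⟩ := hpe
  have hpP : RandomPartition.HasPEPPF P id p₀ := (RandomPartition.hasPEPPF_map hX).2 hp₀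
  have hP : RandomPartition.IsSwapInvariant P := hpP.isSwapInvariant
  have hreg := RandomPartition.ae_regular hP
  have hident : ∀ n, IdentDistrib (fun ω => RandomPartition.shift n (X ω)) X μ μ ↔
      P.map (RandomPartition.shift n) = P := by
    intro n
    have hm := RandomPartition.measurable_shift n
    rw [hPdef, Measure.map_map hm hX]
    exact ⟨fun h => h.map_eq, fun h => ⟨(hm.comp hX).aemeasurable, hX.aemeasurable, h⟩⟩
  refine ⟨ae_of_ae_map hX.aemeasurable hreg, ?_,
    fun n => RandomPartition.sizeProb P (RandomPartition.shift n), fun n => ?_, ?_, ?_⟩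
  · obtain ⟨Q, hQp, hQ, hPQ⟩ := RandomPartition.exists_isExchangeable_map_rankedFreq_eq hP
    exact ⟨Setoid ℕ, inferInstance, Q, id, hQp, measurable_id, hQ,
      ((RandomPartition.measurable_rankedFreq.comp hX).aemeasurable),
      RandomPartition.measurable_rankedFreq.aemeasurable,
      (Measure.map_map RandomPartition.measurable_rankedFreq hX).symm.trans hPQ⟩
  · have hm := RandomPartition.measurable_shift n
    have h := (RandomPartition.hasPEPPF_map hm).2 (hpP.shift n)
    rw [hPdef, Measure.map_map hm hX] at h
    exact (RandomPartition.hasPEPPF_map (hm.comp hX)).1 h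
  · intro Ω' _ ν _ X' hX' hex hid
    set Q := ν.map X' with hQdef
    have : IsProbabilityMeasure Q := Measure.isProbabilityMeasure_map hX'.aemeasurable
    have hQ : RandomPartition.IsExchangeable Q id := (RandomPartition.isExchangeable_map hX').2 hex
    have hPQ : P.map RandomPartition.rankedFreq = Q.map RandomPartition.rankedFreq := by
      rw [hPdef, hQdef, Measure.map_map RandomPartition.measurable_rankedFreq hX,
        Measure.map_map RandomPartition.measurable_rankedFreq hX']
      exact hid.map_eq
    refine ⟨⟨RandomPartition.sizeProb Q id, ?_, fun m c =>
      RandomPartition.tendsto_sizeProb_shift hP hQ hPQ m c⟩, fun J => ?_, fun hsum => ?_⟩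
    · exact (RandomPartition.hasPEPPF_map hX').1 hQ.hasPEPPF
    · refine RandomPartition.tendstoInDistribution_appearanceFreq hX hX' (fun n => ?_) hQ hPQ J
      have : IsProbabilityMeasure (P.map (RandomPartition.shift n)) :=
        Measure.isProbabilityMeasure_map (RandomPartition.measurable_shift n).aemeasurable
      exact ((RandomPartition.hasPEPPF_map (RandomPartition.measurable_shift n)).2
        (hpP.shift n)).isSwapInvariant
    · have hmeas : MeasurableSet {π | HasSum (RandomPartition.rankedFreq π) 1} := by
        have : {π | HasSum (RandomPartition.rankedFreq π) 1} = RandomPartition.rankedFreq ⁻¹'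
            {x | (∀ j, 0 ≤ x j) ∧ HasSum x 1} := by
          ext π
          exact (and_iff_right (RandomPartition.rankedFreq_nonneg π)).symm
        rw [this]
        exact RandomPartition.measurable_rankedFreq RandomPartition.measurableSet_nonneg_hasSum
      have hsumP : ∀ᵐ π ∂P, HasSum (RandomPartition.rankedFreq π) 1 :=
        (ae_map_iff hX.aemeasurable hmeas).2 hsum
      have hmap : ∀ y : Setoid ℕ → ℕ → ℝ, Measurable y → (∀ π j, 0 ≤ y π j) →
          (∀ᵐ π ∂P, RandomPartition.SameCounts (RandomPartition.rankedFreq π) (y π)) →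
          RandomPartition.IsSizeBiasedPermutation (μ.map fun ω => y (X ω))
            (ν.map fun ω => RandomPartition.appearanceFreq (X' ω) 0) := by
        intro y hy hy0 hc
        have h := RandomPartition.isSizeBiasedPermutation_of_sameCounts hP hQ hPQ hsumP hy hy0 hc
        rwa [hPdef, hQdef, Measure.map_map hy hX,
          Measure.map_map (RandomPartition.measurable_appearanceFreq 0) hX'] at h
      refine ⟨hmap _ RandomPartition.measurable_rankedFreq RandomPartition.rankedFreq_nonneg
        (ae_of_all _ fun _ _ _ => rfl), fun n => hmap (fun π => RandomPartition.appearanceFreq π n)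
        (RandomPartition.measurable_appearanceFreq n)
        (fun π j => RandomPartition.appearanceFreq_nonneg π n j) ?_⟩
      filter_upwards [hreg] with π hπ
      exact hπ.sameCounts_rankedFreq n
  · have h := RandomPartition.isExchangeable_tfae hpP
    rw [RandomPartition.isExchangeable_map hX] at h
    simpa only [hident] using h
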